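/- **Setting.** Super fields are elements of an algebra of $N=2$ super fields: a supercommutative $\mathbb{Z}/2$-graded $\mathbb{Q}$-algebra with two odd super derivations $\mathbb{D}_1,\mathbb{D}_2$ satisfying $\mathbb{D}_1\mathbb{D}_2=-\mathbb{D}_2\mathbb{D}_1$ and $\mathbb{D}_1^2=\mathbb{D}_2^2=:\partial_y$ (for instance functions of $(y,\varrho_1,\varrho_2)$ with $\mathbb{D}_k=\partial_{\varrho_k}+\varrho_k\partial_y$). Subscripts $y$ denote $\partial_y$. Super pseudo-differential operators are formal series $\sum_{k\le N}(a_k+b_k\mathbb{D}_1+c_k\mathbb{D}_2+d_k\mathbb{D}_1\mathbb{D}_2)\partial_y^k$, and $(\cdot)_{\ge1}$ keeps the terms with $k\ge0$ other than the zeroth order term $a_0$. For a bosonic super field $U$ put $$L_{2m}=\partial_y^2-U_y\partial_y-\tfrac12(\mathbb{D}_2U)(\mathbb{D}_1U)\mathbb{D}_1\mathbb{D}_2+\tfrac14\big(-2(\mathbb{D}_2U_y)+(\mathbb{D}_2U)U_y-(\mathbb{D}_1U)(\mathbb{D}_1\mathbb{D}_2U)\big)\mathbb{D}_2+\tfrac14\big(-2(\mathbb{D}_1U_y)+(\mathbb{D}_1U)U_y+(\mathbb{D}_2U)(\mathbb{D}_1\mathbb{D}_2U)\big)\mathbb{D}_1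 .$$ **Proposition.** 1. Let $(y,\varrho_1,\varrho_2)\mapsto(x,\theta_1,\theta_2)$ be a superconformal transformation, i.e. a super diffeomorphism with $\mathbb{D}_kx=\theta_1(\mathbb{D}_k\theta_1)+\theta_2(\mathbb{D}_k\theta_2)$ $(k=1,2)$, $\mathbb{D}_1\theta_2=-\mathbb{D}_2\theta_1$ and $\mathbb{D}_2\theta_2=\mathbb{D}_1\theta_1$, such that $K=(\mathbb{D}_1\theta_1)^2+(\mathbb{D}_2\theta_1)^2$ is invertible, and let $\mathcal{D}_k=\partial_{\theta_k}+\theta_k\partial_x$. Then $\mathcal{D}_1=K^{-1}((\mathbb{D}_1\theta_1)\mathbb{D}_1+(\mathbb{D}_2\theta_1)\mathbb{D}_2)$, $\mathcal{D}_2=K^{-1}(-(\mathbb{D}_2\theta_1)\mathbb{D}_1+(\mathbb{D}_1\theta_1)\mathbb{D}_2)$, and if $W=K$ and $U=\log K$, the Harry Dym Lax operator $L_2=\frac12(\mathcal{D}_1W^2\mathcal{D}_1+\mathcal{D}_2W^2\mathcal{D}_2)\partial_x$ is transformed into $$\Big[K\partial_y+\tfrac12(\mathbb{D}_2K)\mathbb{D}_2+\tfrac12(\mathbb{D}_1K)\mathbb{D}_1\Big]K^{-1}\Big[\partial_y-\tfrac12(\mathbb{D}_2\log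 K)\mathbb{D}_2-\tfrac12(\mathbb{D}_1\log K)\mathbb{D}_1\Big]=L_{2m}.$$ 2. $L_{2m}$ has a unique square root of the form $L_{2m}^{1/2}=\partial_y+(\text{lower order terms})$, and the Lax equations $$\frac{\partial}{\partial\tau_n}L_{2m}=\Big[\big(L_{2m}^{n/2}\big)_{\ge1},L_{2m}\Big],\qquad n=1,3,5,\dots,$$ define an $N=2$ supersymmetric hierarchy: for every odd $n$ there is a bosonic differential super polynomial $F_n[U]$ in $U$ and its $\mathbb{D}_1,\mathbb{D}_2$-derivatives, with rational coefficients and without constant term, such that $U_{\tau_n}=F_n[U]$ implies the Lax equation, and the Lax equation implies $\partial_y(U_{\tau_n}-F_n[U])=0$; and these flows commute pairwise. The flow $n=1$ is the translation $U_{\tau_1}=U_y$, and the first nontrivial flow is $$U_{\tau_3}=\tfrac1{16}\Big(4U_{3y}-2U_y^3-3(\mathbb{D}_2U_y)(\mathbb{D}_2U)U_y+3(\mathbb{D}_2U_y)(\mathbb{D}_1U)(\mathbb{D}_1\mathbb{D}_2U)+3(\mathbb{D}_2U)(\mathbb{D}_1U_y)(\mathbb{D}_1\mathbb{D}_2U)-3(\mathbb{D}_1U_y)(\mathbb{D}_1U)U_y\Big).$$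 3. This equation is a modification of the SKdV$_{-2}$ equation: if $U$ satisfies it (with $\tau=\tau_3$), then $\Phi=\frac12(\mathbb{D}_1\mathbb{D}_2U)+\frac14(\mathbb{D}_2U)(\mathbb{D}_1U)$ satisfies, with $a=-2$, $$\Phi_\tau=\tfrac14\Big(\Phi_{3y}-3[\Phi(\mathbb{D}_1\mathbb{D}_2\Phi)]_y-\tfrac{a-1}2[\mathbb{D}_1\mathbb{D}_2\Phi^2]_y-3a\,\Phi^2\Phi_y\Big).$$ -/

import Mathlib

universe u v

namespace SuperHD

/-- An algebra of `N = 2` super fields, in its intrinsic form: a supercommutative algebra `A` over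
the rationals (which covers real and complex super fields) with two odd super derivations
`D 0`, `D 1` (the mathematical `D₁`, `D₂`) that anticommute and have the same square.
The `ℤ/2`-grading is recorded by its parity automorphism `σ`
(`σ a = a` on bosonic, `σ a = -a` on fermionic elements).
The super fields `f₀ + ρ₁ f₁ + ρ₂ f₂ + ρ₁ρ₂ f₁₂` with `D k = ∂_{ρₖ} + ρₖ ∂_y` are an instance. -/
class SuperFieldAlgebra (A : Type u) extends Ring A, Algebra ℚ A where
  σ : A →+* A
  σ_σ : ∀ a, σ (σ a) = a
  even_mul_comm : ∀ a b, σ a = a → a * b = b * a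
  odd_mul_odd : ∀ a b, σ a = -a → σ b = -b → a * b = -(b * a)
  D : Fin 2 → A →+ A
  σ_D : ∀ i a, σ (D i a) = -D i (σ a)
  D_mul : ∀ i a b, D i (a * b) = D i a * b + σ a * D i b
  D_sq : ∀ a, D 0 (D 0 a) = D 1 (D 1 a)
  D_anticomm : ∀ a, D 0 (D 1 a) = -D 1 (D 0 a)

open SuperFieldAlgebra

section Basic

variable {A : Type u} [SuperFieldAlgebra A]

/-- The parity automorphism, as a function. -/
abbrev par (f : A) : A := (σ : A →+* A) f

/-- `f` is a bosonic super field. -/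
def IsEven (f : A) : Prop := par f = f

/-- The space derivative `∂ = D₁² = D₂²`. -/
def dd (f : A) : A := D 0 (D 0 f)

theorem dd_zero : dd (0 : A) = 0 := by simp [dd]

theorem dd_iterate_zero (j : ℕ) : dd^[j] (0 : A) = 0 :=
  Function.iterate_fixed dd_zero j

end Basic

/-! ### Super pseudo-differential operators -/

/-- A formal super pseudo-differential operator
`∑_{k ≤ N} (p k 0 + p k 1 D₁ + p k 2 D₂ + p k 3 D₁D₂) ∂^k`, coefficients on the left. -/
@[ext]
structure PDO (A : Type u) [SuperFieldAlgebra A] where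
  coeff : ℤ → Fin 4 → A
  bdd : ∃ N : ℤ, ∀ k, N < k → coeff k = 0

namespace PDO

variable {A : Type u} [SuperFieldAlgebra A]

/-- Coefficients of `∂^k ∘ g`, from `∂^k ∘ b = ∑_{j ≥ 0} (k choose j) b^{(j)} ∂^{k-j}`,
for any integer `k`. -/
noncomputable def ddLeft (k : ℤ) (g : ℤ → Fin 4 → A) : ℤ → Fin 4 → A :=
  fun m s => ∑ᶠ j : ℕ, (Ring.choose k j : ℤ) • dd^[j] (g (m - k + j) s)

/-- Coefficients of `D₁ ∘ g`, from `D₁ ∘ b = (D₁ b) + σ(b) D₁`, `D₁D₁ = ∂`. -/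
def d1Left (g : ℤ → Fin 4 → A) : ℤ → Fin 4 → A :=
  fun m => ![D 0 (g m 0) + par (g (m - 1) 1), D 0 (g m 1) + par (g m 0),
    D 0 (g m 2) + par (g (m - 1) 3), D 0 (g m 3) + par (g m 2)]

/-- Coefficients of `D₂ ∘ g`, from `D₂ ∘ b = (D₂ b) + σ(b) D₂`, `D₂D₂ = ∂`, `D₂D₁ = -D₁D₂`. -/
def d2Left (g : ℤ → Fin 4 → A) : ℤ → Fin 4 → A :=
  fun m => ![D 1 (g m 0) + par (g (m - 1) 2), D 1 (g m 1) - par (g (m - 1) 3),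
    D 1 (g m 2) + par (g m 0), D 1 (g m 3) - par (g m 1)]

theorem ddLeft_eq_zero {g : ℤ → Fin 4 → A} {M : ℤ} (hg : ∀ k, M < k → g k = 0)
    (k m : ℤ) (hm : k + M < m) : ddLeft k g m = 0 := by
  funext s
  have : ∀ j : ℕ, (Ring.choose k j : ℤ) • dd^[j] (g (m - k + j) s) = 0 := by
    intro j
    rw [hg _ (by omega)]
    simp [dd_iterate_zero]
  simp [ddLeft, this]

theorem d1Left_eq_zero {g : ℤ → Fin 4 → A} {M : ℤ} (hg : ∀ k, M < k → g k = 0)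
    (m : ℤ) (hm : M + 1 < m) : d1Left g m = 0 := by
  funext s
  fin_cases s <;> simp [d1Left, hg m (by omega), hg (m - 1) (by omega)]

theorem d2Left_eq_zero {g : ℤ → Fin 4 → A} {M : ℤ} (hg : ∀ k, M < k → g k = 0)
    (m : ℤ) (hm : M + 1 < m) : d2Left g m = 0 := by
  funext s
  fin_cases s <;> simp [d2Left, hg m (by omega), hg (m - 1) (by omega)]

/-- Coefficients of the composition `f ∘ g`. For coefficients that vanish in high orders all the
sums have only finitely many nonzero terms. -/
noncomputable def mulCoeff (f g : ℤ → Fin 4 → A) : ℤ → Fin 4 → A :=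
  fun m s => ∑ᶠ k : ℤ,
    (f k 0 * ddLeft k g m s + f k 1 * d1Left (ddLeft k g) m s
      + f k 2 * d2Left (ddLeft k g) m s + f k 3 * d1Left (d2Left (ddLeft k g)) m s)

theorem mulCoeff_bdd (P Q : PDO A) :
    ∃ N : ℤ, ∀ k, N < k → mulCoeff P.coeff Q.coeff k = 0 := by
  obtain ⟨N, hN⟩ := P.bdd
  obtain ⟨M, hM⟩ := Q.bdd
  refine ⟨N + M + 2, fun m hm => ?_⟩
  funext s
  refine finsum_eq_zero_of_forall_eq_zero fun k => ?_
  by_cases hk : N < k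
  · simp [hN k hk]
  · have h0 : ∀ i, k + M < i → ddLeft k Q.coeff i = 0 := ddLeft_eq_zero hM k
    have h1 : ∀ i, k + M + 1 < i → d1Left (ddLeft k Q.coeff) i = 0 := d1Left_eq_zero h0
    have h2 : ∀ i, k + M + 1 < i → d2Left (ddLeft k Q.coeff) i = 0 := d2Left_eq_zero h0
    have h3 : ∀ i, k + M + 1 + 1 < i → d1Left (d2Left (ddLeft k Q.coeff)) i = 0 :=
      d1Left_eq_zero h2
    simp [h0 m (by omega), h1 m (by omega), h2 m (by omega), h3 m (by omega)]

/-- Composition of operators. -/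
noncomputable instance : Mul (PDO A) := ⟨fun P Q => ⟨mulCoeff P.coeff Q.coeff, mulCoeff_bdd P Q⟩⟩

instance : Add (PDO A) :=
  ⟨fun P Q => ⟨P.coeff + Q.coeff, by
    obtain ⟨N, hN⟩ := P.bdd
    obtain ⟨M, hM⟩ := Q.bdd
    refine ⟨max N M, fun k hk => ?_⟩
    simp [hN k (lt_of_le_of_lt (le_max_left _ _) hk), hM k (lt_of_le_of_lt (le_max_right _ _) hk)]⟩⟩

instance : Sub (PDO A) :=
  ⟨fun P Q => ⟨P.coeff - Q.coeff, by
    obtain ⟨N, hN⟩ := P.bdd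
    obtain ⟨M, hM⟩ := Q.bdd
    refine ⟨max N M, fun k hk => ?_⟩
    simp [hN k (lt_of_le_of_lt (le_max_left _ _) hk), hM k (lt_of_le_of_lt (le_max_right _ _) hk)]⟩⟩

instance : SMul ℚ (PDO A) :=
  ⟨fun c P => ⟨c • P.coeff, by
    obtain ⟨N, hN⟩ := P.bdd
    exact ⟨N, fun k hk => by simp [hN k hk]⟩⟩⟩

/-- The operator `a E_s ∂^k`, where `E_0 = 1`, `E_1 = D₁`, `E_2 = D₂`, `E_3 = D₁D₂`. -/
def mono (a : A) (k : ℤ) (s : Fin 4) : PDO A where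
  coeff := fun m t => if m = k ∧ t = s then a else 0
  bdd := ⟨k, fun m hm => by
    funext t
    simp [show m ≠ k by omega]⟩

/-- Multiplication by the super field `a`. -/
def fn (a : A) : PDO A := mono a 0 0

/-- The operator `D₁` (`i = 0`) or `D₂` (`i = 1`). -/
def Dop (i : Fin 2) : PDO A := if i = 0 then mono 1 0 1 else mono 1 0 2

/-- The operator `∂`. -/
def pd : PDO A := mono 1 1 0

instance : One (PDO A) := ⟨fn 1⟩

noncomputable instance : Pow (PDO A) ℕ := ⟨fun P n => npowRec n P⟩

/-- The projection `P_{≥ 1}`: the differential part of `P` without its zeroth order term. -/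
def geOne (P : PDO A) : PDO A where
  coeff := fun k s => if k < 0 ∨ (k = 0 ∧ s = 0) then 0 else P.coeff k s
  bdd := by
    obtain ⟨N, hN⟩ := P.bdd
    refine ⟨N, fun k hk => ?_⟩
    funext s
    simp [hN k hk]

/-- The action on super fields of (the differential part of) an operator. -/
noncomputable def act (P : PDO A) (f : A) : A :=
  ∑ᶠ k : ℕ, (P.coeff k 0 * dd^[k] f + P.coeff k 1 * D 0 (dd^[k] f)
    + P.coeff k 2 * D 1 (dd^[k] f) + P.coeff k 3 * D 0 (D 1 (dd^[k] f)))

/-- `R = L^{1/2}`, the square root of the form `∂ + (lower order terms)`. -/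
def IsSqrt (R L : PDO A) : Prop :=
  R * R = L ∧ R.coeff 1 = ![1, 0, 0, 0] ∧ ∀ k, 1 < k → R.coeff k = 0

end PDO

open PDO

/-! ### Superconformal transformations -/

/-- Coordinates `(x, θ₁, θ₂)` of the `N = 2` super space whose super fields form `B`:
in these coordinates `D k = ∂_{θₖ} + θₖ ∂_x`. -/
structure Coordinates (B : Type v) [SuperFieldAlgebra B] where
  x : B
  θ : Fin 2 → B
  x_even : par x = x
  θ_odd : ∀ j, par (θ j) = -θ j
  D_x : ∀ k, D k x = θ k
  D_θ : ∀ k j, D k (θ j) = if k = j then 1 else 0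

/-- A super diffeomorphism from the super space of `A` to the super space of `B` with coordinates
`(x, θ₁, θ₂)`, given by the pull-back of super fields, which obeys the chain rule. The functions
`x(y,ϱ)`, `θⱼ(y,ϱ)` are the pull-backs of the coordinates. -/
structure SuperDiffeo (A : Type u) {B : Type v} [SuperFieldAlgebra A] [SuperFieldAlgebra B]
    (c : Coordinates B) where
  pull : B ≃+* A
  pull_σ : ∀ f, pull (par f) = par (pull f)
  chain_rule : ∀ k f, D k (pull f) =
    (D k (pull c.x) - ∑ j, pull (c.θ j) * D k (pull (c.θ j))) * pull (dd f)
      + ∑ j, D k (pull (c.θ j)) * pull (D j f)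

namespace SuperDiffeo

variable {A : Type u} {B : Type v} [SuperFieldAlgebra A] [SuperFieldAlgebra B] {c : Coordinates B}

/-- The constraints that make a super diffeomorphism superconformal. -/
def IsSuperconformal (φ : SuperDiffeo A c) : Prop :=
  (∀ k, D k (φ.pull c.x) = ∑ j, φ.pull (c.θ j) * D k (φ.pull (c.θ j))) ∧
  D 0 (φ.pull (c.θ 1)) = -D 1 (φ.pull (c.θ 0)) ∧
  D 1 (φ.pull (c.θ 1)) = D 0 (φ.pull (c.θ 0))

/-- `K = (D₁θ₁)² + (D₂θ₁)²`. -/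
def confFactor (φ : SuperDiffeo A c) : A :=
  D 0 (φ.pull (c.θ 0)) ^ 2 + D 1 (φ.pull (c.θ 0)) ^ 2

/-- The super derivatives of the `(x, θ₁, θ₂)` space as operators in the `(y, ϱ₁, ϱ₂)` space,
`K⁻¹((D₁θ₁)D₁ + (D₂θ₁)D₂)` and `K⁻¹(-(D₂θ₁)D₁ + (D₁θ₁)D₂)`; here `Kinv` is `K⁻¹`. -/
noncomputable def newD (φ : SuperDiffeo A c) (Kinv : A) (i : Fin 2) : PDO A :=
  if i = 0 then
    fn Kinv * (fn (D 0 (φ.pull (c.θ 0))) * Dop 0 + fn (D 1 (φ.pull (c.θ 0))) * Dop 1)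
  else
    fn Kinv * (fn (-D 1 (φ.pull (c.θ 0))) * Dop 0 + fn (D 0 (φ.pull (c.θ 0))) * Dop 1)

end SuperDiffeo

section Equations

variable {A : Type u} [SuperFieldAlgebra A]

/-- `U = log K` up to an additive constant: `U` is bosonic and `D₁U = K⁻¹ D₁K`, `D₂U = K⁻¹ D₂K`. -/
def IsLog (U : A) (K : Aˣ) : Prop :=
  IsEven U ∧ ∀ i, D i U = (↑K⁻¹ : A) * D i (K : A)

/-- The Harry Dym Lax operator `½ (D₁ W² D₁ + D₂ W² D₂) ∂`. -/
noncomputable def L2 (W : A) : PDO A :=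
  (1 / 2 : ℚ) • (Dop 0 * fn (W ^ 2) * Dop 0 + Dop 1 * fn (W ^ 2) * Dop 1) * pd

/-- The modified Lax operator `L_{2m}`. -/
def L2m (U : A) : PDO A :=
  mono 1 2 0 - mono (dd U) 1 0 - mono ((1 / 2 : ℚ) • (D 1 U * D 0 U)) 0 3
    + mono ((1 / 4 : ℚ) • (-(2 : ℚ) • D 1 (dd U) + D 1 U * dd U - D 0 U * D 0 (D 1 U))) 0 2
    + mono ((1 / 4 : ℚ) • (-(2 : ℚ) • D 0 (dd U) + D 0 U * dd U + D 1 U * D 0 (D 1 U))) 0 1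

/-- Right-hand side of the first nontrivial flow. -/
def mkdvRHS (U : A) : A :=
  (1 / 16 : ℚ) • ((4 : ℚ) • dd (dd (dd U)) - (2 : ℚ) • dd U ^ 3
    - (3 : ℚ) • (D 1 (dd U) * D 1 U * dd U)
    + (3 : ℚ) • (D 1 (dd U) * D 0 U * D 0 (D 1 U))
    + (3 : ℚ) • (D 1 U * D 0 (dd U) * D 0 (D 1 U))
    - (3 : ℚ) • (D 0 (dd U) * D 0 U * dd U))

/-- Right-hand side of the `N = 2` supersymmetric KdV equation with parameter `a`. -/
def skdvRHS (a : ℚ) (Φ : A) : A :=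
  (1 / 4 : ℚ) • (dd (dd (dd Φ)) - (3 : ℚ) • dd (Φ * D 0 (D 1 Φ))
    - ((a - 1) / 2) • dd (D 0 (D 1 (Φ ^ 2))) - (3 * a) • (Φ ^ 2 * dd Φ))

/-- The Miura map `½ D₁D₂U + ¼ (D₂U)(D₁U)`. -/
def miura (U : A) : A :=
  (1 / 2 : ℚ) • D 0 (D 1 U) + (1 / 4 : ℚ) • (D 1 U * D 0 U)

end Equations

/-! ### Evolution -/

/-- A time derivative `∂_τ`: a bosonic derivation that commutes with `D₁` and `D₂`. -/
structure TimeDerivation (A : Type u) [SuperFieldAlgebra A] where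
  d : A →+ A
  d_mul : ∀ a b, d (a * b) = d a * b + a * d b
  d_σ : ∀ a, d (par a) = par (d a)
  d_D : ∀ i a, d (D i a) = D i (d a)

/-- The time derivative of an operator, coefficient by coefficient. -/
def TimeDerivation.onPDO {A : Type u} [SuperFieldAlgebra A] (δ : TimeDerivation A)
    (P : PDO A) : PDO A where
  coeff := fun k s => δ.d (P.coeff k s)
  bdd := by
    obtain ⟨N, hN⟩ := P.bdd
    refine ⟨N, fun k hk => ?_⟩
    funext s
    simp [hN k hk]

/-- The Lax equation `∂_τ L_{2m} = [(R^n)_{≥ 1}, L_{2m}]`, to be used with `R = L_{2m}^{1/2}`. -/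
def LaxEquation {A : Type u} [SuperFieldAlgebra A] (n : ℕ) (δ : TimeDerivation A) (U : A)
    (R : PDO A) : Prop :=
  δ.onPDO (L2m U) = geOne (R ^ n) * L2m U - L2m U * geOne (R ^ n)

/-- Differential super polynomials (with rational coefficients and no constant term) in one
super field, as expressions. -/
inductive DiffPoly : Type
  | U : DiffPoly
  | D (i : Fin 2) (p : DiffPoly) : DiffPoly
  | smul (r : ℚ) (p : DiffPoly) : DiffPoly
  | add (p q : DiffPoly) : DiffPoly
  | mul (p q : DiffPoly) : DiffPoly

namespace DiffPoly

/-- The value at the super field `f`. -/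
def eval {A : Type u} [SuperFieldAlgebra A] (f : A) : DiffPoly → A
  | U => f
  | D i p => SuperFieldAlgebra.D i (eval f p)
  | smul r p => r • eval f p
  | add p q => eval f p + eval f q
  | mul p q => eval f p * eval f q

/-- The Fréchet derivative of a differential super polynomial in the (bosonic) direction `V`,
i.e. its derivative along the flow `U_τ = V`. -/
def lin (V : DiffPoly) : DiffPoly → DiffPoly
  | U => V
  | D i p => D i (lin V p)
  | smul r p => smul r (lin V p)
  | add p q => add (lin V p) (lin V q)
  | mul p q => add (mul (lin V p) q) (mul p (lin V q))

end DiffPoly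

end SuperHD

set_option linter.unusedSimpArgs false
set_option linter.unusedSectionVars false

namespace SuperHD

open SuperFieldAlgebra

/-! ### Elementary rules for the parity and the super derivatives -/

section Basic

variable {A : Type u} [SuperFieldAlgebra A]

/-! Write q(f) = ½(D₁ f D₁ + D₂ f D₂) and J = D₁D₂∂⁻¹, so that J² = -1. For bosonic f the operator
q(f) is skew-adjoint; it commutes with J and has no zeroth order term. Conversely, a differential
operator without zeroth order term that commutes with J and has leading part f∂ is q(f) (`eq_qop`).
The whole argument rests on the factorization L_{2m} = q(K) q(K⁻¹) for K = exp U
(`qop_mul_qop_inv`). For part 1, the change of coordinates turns ½(𝒟₁K²𝒟₁ + 𝒟₂K²𝒟₂) into q(K) and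
∂_x = 𝒟₁² into q(K⁻¹) (`newD_products`).

Operators are compared through the filtration by order, with D₁ and D₂ of order ½. An operator
equation XT + TY = 0 in which X and Y begin with ∂ forces T = 0, since the order of T can be lowered
forever (`eq_zero_of_mul_add_mul`). This gives uniqueness of the square root R, and lets R inherit
the symmetries of L: it is even, it commutes with J, and with X = q(K), Y = q(K⁻¹), L* = YX it
satisfies R*Y = -YR and RX = -XR*. Existence is an iteration that converges in the filtration.

For odd n put Q = Rⁿ and P = Q_{≥1}. Then QX + XQ* = 0 = Q*Y + YQ, and [P, XY] = (PX + XP*)Y - X(P*Y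
+ YP). Both brackets are differential, have no zeroth order term and commute with J, because P does
(`geOne_mul_opJ`, `adj_geOne_coeff_zero_zero`). Their leading parts can be read off from Q - P, so
they are q(FK) and q(FK⁻¹), where F is -2 times the zeroth order coefficient of Q. The commutator is
therefore the derivative of q(K)q(K⁻¹) along U_τ = F. If A contains no exponential of U, one is
adjoined and the identity descends (`lax_commutator`). Carried out for a universal bosonic field,
the construction shows that F is a differential polynomial (`exists_diffPoly_eval_eq_flow`).

For commutativity, over the dual numbers the root moves along the n-th flow to R + ε[P_n, R]. The
mixed derivative is then the zeroth order coefficient of [P_n, R^m] up to a factor, and this is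
symmetric in m and n (`geOne_commutator_coeff_symm`). The flows n = 1, 3 and the Miura map are
finite identities between differential polynomials. They are checked by evaluating a normal form
procedure that is proved sound; for the flows a truncation of R of sufficient accuracy is used. -/

theorem par_add (a b : A) : par (a + b) = par a + par b := map_add _ a b

theorem par_sub (a b : A) : par (a - b) = par a - par b := map_sub _ a b

theorem par_neg (a : A) : par (-a) = -par a := map_neg _ a

theorem par_zero : par (0 : A) = 0 := map_zero _

theorem par_one : par (1 : A) = 1 := map_one _

theorem par_mul (a b : A) : par (a * b) = par a * par b := map_mul _ a b

theorem par_smul (c : ℚ) (a : A) : par (c • a) = c • par a := map_rat_smul (σ : A →+* A) c a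

theorem par_par (a : A) : par (par a) = a := σ_σ a

theorem par_D (i : Fin 2) (a : A) : par (D i a) = -D i (par a) := σ_D i a

theorem D_par (i : Fin 2) (a : A) : D i (par a) = -par (D i a) := by
  rw [par_D, neg_neg]

theorem D_smul (i : Fin 2) (c : ℚ) (a : A) : D i (c • a) = c • D i a := map_rat_smul (D i) c a

theorem D_one (i : Fin 2) : D i (1 : A) = 0 := by
  have h := D_mul i (1 : A) 1
  simpa using h

theorem D_D_same (i : Fin 2) (a : A) : D i (D i a) = dd a := by
  fin_cases i
  · rfl
  · exact (D_sq a).symm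

theorem D_one_D_zero (a : A) : D 1 (D 0 a) = -D 0 (D 1 a) := by
  rw [D_anticomm, neg_neg]

theorem dd_add (a b : A) : dd (a + b) = dd a + dd b := by simp [dd]

theorem dd_one : dd (1 : A) = 0 := by simp [dd, D_one]

theorem dd_par (a : A) : dd (par a) = par (dd a) := by
  simp only [dd, D_par, map_neg, neg_neg]

theorem dd_D (i : Fin 2) (a : A) : dd (D i a) = D i (dd a) := by
  rw [← D_D_same i (D i a), D_D_same i a]

theorem dd_iterate_add (j : ℕ) (a b : A) : dd^[j] (a + b) = dd^[j] a + dd^[j] b := by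
  induction j generalizing a b with
  | zero => rfl
  | succ j ih => simp only [Function.iterate_succ_apply, dd_add, ih]

theorem dd_iterate_one (j : ℕ) : dd^[j + 1] (1 : A) = 0 := by
  rw [Function.iterate_succ_apply, dd_one, dd_iterate_zero]

/-- The iterated space derivative as an additive map. -/
def ddIter (j : ℕ) : A →+ A where
  toFun := dd^[j]
  map_zero' := dd_iterate_zero j
  map_add' := dd_iterate_add j

theorem dd_iterate_zsmul (j : ℕ) (c : ℤ) (a : A) : dd^[j] (c • a) = c • dd^[j] a :=
  map_zsmul (ddIter j) c a

theorem eq_zero_of_eq_neg {M : Type*} [AddCommGroup M] [Module ℚ M] {a : M} (h : a = -a) :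
    a = 0 := by
  have h2 : (2 : ℚ) • a = 0 := by
    rw [two_smul]
    nth_rewrite 2 [h]
    exact add_neg_cancel a
  simpa using h2

end Basic

namespace PDO

variable {A : Type u} [SuperFieldAlgebra A]

/-! ### Additive structure -/

instance : Zero (PDO A) := ⟨⟨0, 0, fun _ _ => rfl⟩⟩

instance : Neg (PDO A) :=
  ⟨fun P => ⟨-P.coeff, by
    obtain ⟨N, hN⟩ := P.bdd
    exact ⟨N, fun k hk => by simp [hN k hk]⟩⟩⟩

@[simp] theorem zero_coeff (k : ℤ) (s : Fin 4) : (0 : PDO A).coeff k s = 0 := rfl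

@[simp] theorem add_coeff (P Q : PDO A) (k : ℤ) (s : Fin 4) :
    (P + Q).coeff k s = P.coeff k s + Q.coeff k s := rfl

@[simp] theorem sub_coeff (P Q : PDO A) (k : ℤ) (s : Fin 4) :
    (P - Q).coeff k s = P.coeff k s - Q.coeff k s := rfl

@[simp] theorem neg_coeff (P : PDO A) (k : ℤ) (s : Fin 4) :
    (-P).coeff k s = -P.coeff k s := rfl

@[simp] theorem smul_coeff (c : ℚ) (P : PDO A) (k : ℤ) (s : Fin 4) :
    (c • P).coeff k s = c • P.coeff k s := rfl

theorem mono_coeff (a : A) (k : ℤ) (s : Fin 4) (m : ℤ) (t : Fin 4) :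
    (mono a k s).coeff m t = if m = k ∧ t = s then a else 0 := rfl

theorem ext_coeff {P Q : PDO A} (h : ∀ k s, P.coeff k s = Q.coeff k s) : P = Q :=
  PDO.ext (funext fun k => funext fun s => h k s)

instance : AddCommGroup (PDO A) where
  add_assoc P Q R := ext_coeff fun k s => by simp [add_assoc]
  zero_add P := ext_coeff fun k s => by simp
  add_zero P := ext_coeff fun k s => by simp
  add_comm P Q := ext_coeff fun k s => by simp [add_comm]
  neg_add_cancel P := ext_coeff fun k s => by simp
  sub_eq_add_neg P Q := ext_coeff fun k s => by simp [sub_eq_add_neg]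
  nsmul := nsmulRec
  zsmul := zsmulRec

/-- The coefficient of `E_s ∂^k` as an additive map. -/
def coeffHom (k : ℤ) (s : Fin 4) : PDO A →+ A where
  toFun P := P.coeff k s
  map_zero' := rfl
  map_add' _ _ := rfl

@[simp] theorem sum_coeff {ι : Type*} (S : Finset ι) (f : ι → PDO A) (k : ℤ) (s : Fin 4) :
    (∑ i ∈ S, f i).coeff k s = ∑ i ∈ S, (f i).coeff k s := map_sum (coeffHom k s) f S

@[simp] theorem zsmul_coeff (c : ℤ) (P : PDO A) (k : ℤ) (s : Fin 4) :
    (c • P).coeff k s = c • P.coeff k s := map_zsmul (coeffHom k s) c P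

instance : Module ℚ (PDO A) where
  one_smul P := ext_coeff fun k s => by simp
  mul_smul a b P := ext_coeff fun k s => by simp [mul_smul]
  smul_zero a := ext_coeff fun k s => by simp
  smul_add a P Q := ext_coeff fun k s => by simp
  add_smul a b P := ext_coeff fun k s => by simp [add_smul]
  zero_smul P := ext_coeff fun k s => by simp

theorem mono_add (a b : A) (k : ℤ) (s : Fin 4) : mono (a + b) k s = mono a k s + mono b k s :=
  ext_coeff fun m t => by
    simp only [mono_coeff, add_coeff]
    split_ifs <;> simp

theorem mono_zero (k : ℤ) (s : Fin 4) : mono (0 : A) k s = 0 :=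
  ext_coeff fun m t => by simp [mono_coeff]

/-- The monomials with fixed `E_s ∂^k`, as an additive map of the coefficient. -/
def monoHom (k : ℤ) (s : Fin 4) : A →+ PDO A where
  toFun a := mono a k s
  map_zero' := mono_zero k s
  map_add' a b := mono_add a b k s

theorem mono_neg (a : A) (k : ℤ) (s : Fin 4) : mono (-a) k s = -mono a k s :=
  map_neg (monoHom k s) a

theorem mono_sub (a b : A) (k : ℤ) (s : Fin 4) : mono (a - b) k s = mono a k s - mono b k s :=
  map_sub (monoHom k s) a b

theorem mono_smul (c : ℚ) (a : A) (k : ℤ) (s : Fin 4) : mono (c • a) k s = c • mono a k s :=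
  map_rat_smul (monoHom k s) c a

theorem mono_zsmul (c : ℤ) (a : A) (k : ℤ) (s : Fin 4) : mono (c • a) k s = c • mono a k s :=
  map_zsmul (monoHom k s) c a

/-! ### The order filtration -/

/-- Twice the order of `E_s`. -/
def wt : Fin 4 → ℤ := ![0, 1, 1, 2]

theorem wt_nonneg (s : Fin 4) : 0 ≤ wt s := by fin_cases s <;> simp [wt]

theorem wt_le_two (s : Fin 4) : wt s ≤ 2 := by fin_cases s <;> simp [wt]

/-- The operators of order at most `d / 2`, where `∂` has order `1` and `D₁`, `D₂` have order
`1 / 2`. -/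
def filt (d : ℤ) : AddSubgroup (PDO A) where
  carrier := {P | ∀ k s, d < 2 * k + wt s → P.coeff k s = 0}
  zero_mem' _ _ _ := rfl
  add_mem' hP hQ k s h := by simp [hP k s h, hQ k s h]
  neg_mem' hP k s h := by simp [hP k s h]

theorem filt_mono {d e : ℤ} (h : d ≤ e) : filt (A := A) d ≤ filt e :=
  fun _ hP k s hk => hP k s (h.trans_lt hk)

theorem exists_mem_filt (P : PDO A) : ∃ d, P ∈ filt d := by
  obtain ⟨N, hN⟩ := P.bdd
  refine ⟨2 * N + 2, fun k s h => ?_⟩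
  rw [hN k (by have := wt_le_two s; omega)]
  rfl

theorem smul_mem_filt (c : ℚ) {P : PDO A} {d : ℤ} (hP : P ∈ filt d) : c • P ∈ filt d :=
  fun k s h => by simp [hP k s h]

theorem mono_mem_filt (a : A) {k : ℤ} {s : Fin 4} {d : ℤ} (h : 2 * k + wt s ≤ d) :
    mono a k s ∈ filt d := by
  intro m t hm
  rw [mono_coeff, if_neg]
  rintro ⟨rfl, rfl⟩
  omega

/-- The filtration is separated. This is what allows equalities of operators to be proved by
lowering the order of a difference indefinitely. -/
theorem eq_zero_of_forall_mem_filt {P : PDO A} (h : ∀ d, P ∈ filt d) : P = 0 :=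
  ext_coeff fun k s => h (2 * k + wt s - 1) k s (by omega)

/-- An operator is a finite sum of monomials up to terms of low order. -/
theorem exists_sum_mono_sub_mem_filt (P : PDO A) (d : ℤ) :
    ∃ S : Finset (ℤ × Fin 4), P - ∑ x ∈ S, mono (P.coeff x.1 x.2) x.1 x.2 ∈ filt d := by
  obtain ⟨e, he⟩ := exists_mem_filt P
  -- Only indices with d < 2k + wt s ≤ e matter; since 0 ≤ wt s ≤ 2, these lie in this generous box.
  refine ⟨(Finset.Icc (d - 2) e ∪ Finset.Icc (d / 2 - 2) (e / 2 + 2)) ×ˢ Finset.univ,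
    fun k s h => ?_⟩
  rw [sub_coeff, sum_coeff]
  by_cases hk : e < 2 * k + wt s
  · rw [he k s hk, zero_sub, neg_eq_zero]
    refine Finset.sum_eq_zero fun x _ => ?_
    rw [mono_coeff]
    split_ifs with hx
    · rw [← hx.1, ← hx.2, he k s hk]
    · rfl
  · rw [Finset.sum_eq_single (k, s)]
    · simp [mono_coeff]
    · rintro ⟨l, t⟩ _ hne
      rw [mono_coeff, if_neg]
      rintro ⟨rfl, rfl⟩
      exact hne rfl
    · intro hn
      exfalso
      apply hn
      have := wt_nonneg s
      have := wt_le_two s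
      simp only [Finset.mem_product, Finset.mem_union, Finset.mem_Icc, Finset.mem_univ, and_true]
      omega

/-- Additive maps that respect the order filtration up to a shift are determined by their values
on monomials. -/
theorem addHom_ext {A' : Type v} [SuperFieldAlgebra A'] {S T : PDO A →+ PDO A'} {c : ℤ}
    (hS : ∀ d, ∀ P ∈ filt d, S P ∈ filt (d + c)) (hT : ∀ d, ∀ P ∈ filt d, T P ∈ filt (d + c))
    (h : ∀ a k s, S (mono a k s) = T (mono a k s)) : S = T := by
  ext1 P
  rw [← sub_eq_zero]
  refine eq_zero_of_forall_mem_filt fun d => ?_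
  obtain ⟨X, hX⟩ := exists_sum_mono_sub_mem_filt P (d - c)
  -- The two maps agree on the finite sum of monomials, so only the low order remainder contributes
  -- to the difference.
  have key : S P - T P = S (P - ∑ x ∈ X, mono (P.coeff x.1 x.2) x.1 x.2)
      - T (P - ∑ x ∈ X, mono (P.coeff x.1 x.2) x.1 x.2) := by
    simp only [map_sub, map_sum, h]
    abel
  rw [key]
  have e : d - c + c = d := by ring
  exact sub_mem (e ▸ hS _ _ hX) (e ▸ hT _ _ hX)

/-! ### Left multiplication by the generators -/

/-- Left composition with `∂^k`, on operators. -/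
noncomputable def ddL (k : ℤ) (P : PDO A) : PDO A where
  coeff := ddLeft k P.coeff
  bdd := by
    obtain ⟨M, hM⟩ := P.bdd
    exact ⟨k + M, ddLeft_eq_zero hM k⟩

/-- The `finsum` in `ddLeft` becomes a sum over any sufficiently long range, so that sums belonging
to different operators can be brought to a common length. -/
theorem ddL_coeff_eq_sum (k : ℤ) (P : PDO A) (m : ℤ) (s : Fin 4) (n : ℕ)
    (h : ∀ j : ℕ, n ≤ j → P.coeff (m - k + j) s = 0) :
    (ddL k P).coeff m s =
      ∑ j ∈ Finset.range n, (Ring.choose k j : ℤ) • dd^[j] (P.coeff (m - k + j) s) := by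
  refine finsum_eq_sum_of_support_subset _ fun j hj => ?_
  rw [Function.mem_support] at hj
  simp only [Finset.coe_range, Set.mem_Iio]
  by_contra hn
  exact hj (by rw [h j (by omega), dd_iterate_zero, smul_zero])

theorem exists_bound (P : PDO A) (m : ℤ) :
    ∃ n : ℕ, ∀ j : ℕ, n ≤ j → ∀ s, P.coeff (m + j) s = 0 := by
  obtain ⟨N, hN⟩ := P.bdd
  refine ⟨(N - m + 1).toNat, fun j hj s => ?_⟩
  rw [hN _ (by omega)]
  rfl

theorem ddL_mem_filt (k : ℤ) {P : PDO A} {d : ℤ} (hP : P ∈ filt d) : ddL k P ∈ filt (d + 2 * k) := by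
  intro m s h
  -- Only coefficients with index m - k + j, j ≥ 0, enter, and all of these lie above the order of
  -- `P`; hence an empty range suffices.
  rw [ddL_coeff_eq_sum k P m s 0 fun j _ => hP _ _ (by omega)]
  rfl

theorem ddL_add (k : ℤ) (P Q : PDO A) : ddL k (P + Q) = ddL k P + ddL k Q := by
  refine ext_coeff fun m s => ?_
  obtain ⟨n, hn⟩ := exists_bound P (m - k)
  obtain ⟨n', hn'⟩ := exists_bound Q (m - k)
  rw [add_coeff, ddL_coeff_eq_sum k P m s (max n n') fun j hj => hn j (by omega) s,
    ddL_coeff_eq_sum k Q m s (max n n') fun j hj => hn' j (by omega) s,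
    ddL_coeff_eq_sum k (P + Q) m s (max n n') fun j hj => by
      rw [add_coeff, hn j (by omega) s, hn' j (by omega) s, add_zero], ← Finset.sum_add_distrib]
  simp only [add_coeff, dd_iterate_add, smul_add]

theorem ddL_zero (P : PDO A) : ddL 0 P = P := by
  refine ext_coeff fun m s => ?_
  obtain ⟨n, hn⟩ := exists_bound P (m - 0)
  rw [ddL_coeff_eq_sum 0 P m s (n + 1) fun j hj => hn j (by omega) s,
    Finset.sum_range_succ', Finset.sum_eq_zero]
  · simp
  · intro j _
    simp [Ring.choose_zero_succ]

theorem ddL_one_coeff (P : PDO A) (m : ℤ) (s : Fin 4) :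
    (ddL 1 P).coeff m s = dd (P.coeff m s) + P.coeff (m - 1) s := by
  obtain ⟨n, hn⟩ := exists_bound P (m - 1)
  rw [ddL_coeff_eq_sum 1 P m s (n + 2) fun j hj => hn j (by omega) s,
    Finset.sum_range_succ', Finset.sum_range_succ', Finset.sum_eq_zero]
  · simp
  · intro j _
    have h : Ring.choose (1 : ℤ) (j + 1 + 1) = 0 := by
      have := Ring.choose_natCast (R := ℤ) 1 (j + 1 + 1)
      rw [Nat.choose_eq_zero_of_lt (by omega)] at this
      simpa using this
    simp [h]

/-- `∂ ∘ ∂^k = ∂^{k+1}`. -/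
theorem ddL_one_ddL (k : ℤ) (P : PDO A) : ddL 1 (ddL k P) = ddL (k + 1) P := by
  refine ext_coeff fun m s => ?_
  obtain ⟨n, hn⟩ := exists_bound P (m - k - 1)
  have h1 : ∀ j : ℕ, n ≤ j → P.coeff (m - k + j) s = 0 := fun j hj => by
    have := hn (j + 1) (by omega) s
    rwa [show m - k - 1 + ((j + 1 : ℕ) : ℤ) = m - k + j by push_cast; ring] at this
  have h2 : ∀ j : ℕ, n + 1 ≤ j → P.coeff (m - 1 - k + j) s = 0 := fun j hj => by
    have := hn j (by omega) s
    rwa [show m - k - 1 + (j : ℤ) = m - 1 - k + j by ring] at this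
  have h3 : ∀ j : ℕ, n + 1 ≤ j → P.coeff (m - (k + 1) + j) s = 0 := fun j hj => by
    have := hn j (by omega) s
    rwa [show m - k - 1 + (j : ℤ) = m - (k + 1) + j by ring] at this
  rw [ddL_one_coeff, ddL_coeff_eq_sum k P m s n h1, ddL_coeff_eq_sum k P (m - 1) s (n + 1) h2,
    ddL_coeff_eq_sum (k + 1) P m s (n + 1) h3, Finset.sum_range_succ', Finset.sum_range_succ',
    ← add_assoc]
  congr 1
  -- With the j = 0 terms split off, the remaining terms match by Pascal's rule
  -- `Ring.choose_succ_succ`.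
  · rw [show ∀ x : A, dd x = ddIter 1 x from fun _ => rfl, map_sum, ← Finset.sum_add_distrib]
    refine Finset.sum_congr rfl fun j _ => ?_
    rw [map_zsmul, show ddIter 1 (dd^[j] (P.coeff (m - k + j) s)) =
        dd^[j + 1] (P.coeff (m - k + j) s) from (Function.iterate_succ_apply' dd j _).symm,
      show m - 1 - k + ((j + 1 : ℕ) : ℤ) = m - k + j by push_cast; ring,
      show m - (k + 1) + ((j + 1 : ℕ) : ℤ) = m - k + j by push_cast; ring,
      Ring.choose_succ_succ, add_smul]
  · simp only [Nat.cast_zero, add_zero, Function.iterate_zero, id, Ring.choose_zero_right]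
    rw [show m - 1 - k = m - (k + 1) by ring]

/-- Left composition with `D₁`, on operators. -/
def d1L : PDO A →+ PDO A where
  toFun P := ⟨d1Left P.coeff, by
    obtain ⟨M, hM⟩ := P.bdd
    exact ⟨M + 1, d1Left_eq_zero hM⟩⟩
  map_zero' := ext_coeff fun m s => by fin_cases s <;> simp [d1Left]
  map_add' P Q := ext_coeff fun m s => by
    fin_cases s <;> simp [d1Left] <;> abel

/-- Left composition with `D₂`, on operators. -/
def d2L : PDO A →+ PDO A where
  toFun P := ⟨d2Left P.coeff, by
    obtain ⟨M, hM⟩ := P.bdd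
    exact ⟨M + 1, d2Left_eq_zero hM⟩⟩
  map_zero' := ext_coeff fun m s => by fin_cases s <;> simp [d2Left]
  map_add' P Q := ext_coeff fun m s => by
    fin_cases s <;> simp [d2Left] <;> abel

/-- Left composition with a super field, on operators. -/
def fnL (a : A) : PDO A →+ PDO A where
  toFun P := ⟨fun k s => a * P.coeff k s, by
    obtain ⟨M, hM⟩ := P.bdd
    exact ⟨M, fun k hk => by simp [hM k hk]; rfl⟩⟩
  map_zero' := ext_coeff fun m s => by simp
  map_add' P Q := ext_coeff fun m s => by simp [mul_add]

@[simp] theorem fnL_coeff (a : A) (P : PDO A) (k : ℤ) (s : Fin 4) :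
    (fnL a P).coeff k s = a * P.coeff k s := rfl

theorem d1L_coeff_zero (P : PDO A) (m : ℤ) :
    (d1L P).coeff m 0 = D 0 (P.coeff m 0) + par (P.coeff (m - 1) 1) := rfl

theorem d1L_coeff_one (P : PDO A) (m : ℤ) :
    (d1L P).coeff m 1 = D 0 (P.coeff m 1) + par (P.coeff m 0) := rfl

theorem d1L_coeff_two (P : PDO A) (m : ℤ) :
    (d1L P).coeff m 2 = D 0 (P.coeff m 2) + par (P.coeff (m - 1) 3) := rfl

theorem d1L_coeff_three (P : PDO A) (m : ℤ) :
    (d1L P).coeff m 3 = D 0 (P.coeff m 3) + par (P.coeff m 2) := rfl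

theorem d2L_coeff_zero (P : PDO A) (m : ℤ) :
    (d2L P).coeff m 0 = D 1 (P.coeff m 0) + par (P.coeff (m - 1) 2) := rfl

theorem d2L_coeff_one (P : PDO A) (m : ℤ) :
    (d2L P).coeff m 1 = D 1 (P.coeff m 1) - par (P.coeff (m - 1) 3) := rfl

theorem d2L_coeff_two (P : PDO A) (m : ℤ) :
    (d2L P).coeff m 2 = D 1 (P.coeff m 2) + par (P.coeff m 0) := rfl

theorem d2L_coeff_three (P : PDO A) (m : ℤ) :
    (d2L P).coeff m 3 = D 1 (P.coeff m 3) - par (P.coeff m 1) := rfl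

theorem forall_fin_four {p : Fin 4 → Prop} (h0 : p 0) (h1 : p 1) (h2 : p 2) (h3 : p 3) :
    ∀ s, p s := by
  intro s
  fin_cases s <;> assumption

theorem d1L_mem_filt {P : PDO A} {d : ℤ} (hP : P ∈ filt d) : d1L P ∈ filt (d + 1) := by
  intro m
  refine forall_fin_four ?_ ?_ ?_ ?_ <;> intro h <;> simp only [wt, Matrix.cons_val] at h
  · rw [d1L_coeff_zero, hP _ _ (by simp [wt]; omega), hP _ _ (by simp [wt]; omega)]; simp
  · rw [d1L_coeff_one, hP _ _ (by simp [wt]; omega), hP _ _ (by simp [wt]; omega)]; simp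
  · rw [d1L_coeff_two, hP _ _ (by simp [wt]; omega), hP _ _ (by simp [wt]; omega)]; simp
  · rw [d1L_coeff_three, hP _ _ (by simp [wt]; omega), hP _ _ (by simp [wt]; omega)]; simp

theorem d2L_mem_filt {P : PDO A} {d : ℤ} (hP : P ∈ filt d) : d2L P ∈ filt (d + 1) := by
  intro m
  refine forall_fin_four ?_ ?_ ?_ ?_ <;> intro h <;> simp only [wt, Matrix.cons_val] at h
  · rw [d2L_coeff_zero, hP _ _ (by simp [wt]; omega), hP _ _ (by simp [wt]; omega)]; simp
  · rw [d2L_coeff_one, hP _ _ (by simp [wt]; omega), hP _ _ (by simp [wt]; omega)]; simp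
  · rw [d2L_coeff_two, hP _ _ (by simp [wt]; omega), hP _ _ (by simp [wt]; omega)]; simp
  · rw [d2L_coeff_three, hP _ _ (by simp [wt]; omega), hP _ _ (by simp [wt]; omega)]; simp

theorem fnL_mem_filt (a : A) {P : PDO A} {d : ℤ} (hP : P ∈ filt d) : fnL a P ∈ filt d :=
  fun m s h => by rw [fnL_coeff, hP m s h, mul_zero]

/-- The mixed terms D(par b) and par(D b) cancel because the derivations are odd; the second
derivative and the shift of the power of ∂ remain. The next two relations arise in the same way. -/
theorem d1L_d1L (P : PDO A) : d1L (d1L P) = ddL 1 P := by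
  refine ext_coeff fun m => forall_fin_four ?_ ?_ ?_ ?_ <;>
    simp only [d1L_coeff_zero, d1L_coeff_one, d1L_coeff_two, d1L_coeff_three, ddL_one_coeff,
      map_add, par_par, par_D, D_D_same] <;> abel

theorem d2L_d2L (P : PDO A) : d2L (d2L P) = ddL 1 P := by
  refine ext_coeff fun m => forall_fin_four ?_ ?_ ?_ ?_ <;>
    simp only [d2L_coeff_zero, d2L_coeff_one, d2L_coeff_two, d2L_coeff_three, ddL_one_coeff,
      map_add, map_sub, par_par, par_D, D_D_same] <;> abel

theorem d2L_d1L (P : PDO A) : d2L (d1L P) = -d1L (d2L P) := by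
  refine ext_coeff fun m => forall_fin_four ?_ ?_ ?_ ?_ <;>
    simp only [d2L_coeff_zero, d2L_coeff_one, d2L_coeff_two, d2L_coeff_three, d1L_coeff_zero,
      d1L_coeff_one, d1L_coeff_two, d1L_coeff_three, neg_coeff, D_one_D_zero,
      map_add, map_sub, par_par, par_D] <;> abel

theorem d1L_fnL (a : A) (P : PDO A) : d1L (fnL a P) = fnL (D 0 a) P + fnL (par a) (d1L P) := by
  refine ext_coeff fun m => forall_fin_four ?_ ?_ ?_ ?_ <;>
    simp only [d1L_coeff_zero, d1L_coeff_one, d1L_coeff_two, d1L_coeff_three, fnL_coeff, add_coeff,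
      D_mul, par_mul, mul_add] <;> abel

theorem d2L_fnL (a : A) (P : PDO A) : d2L (fnL a P) = fnL (D 1 a) P + fnL (par a) (d2L P) := by
  refine ext_coeff fun m => forall_fin_four ?_ ?_ ?_ ?_ <;>
    simp only [d2L_coeff_zero, d2L_coeff_one, d2L_coeff_two, d2L_coeff_three, fnL_coeff, add_coeff,
      D_mul, par_mul, mul_add, mul_sub] <;> abel

end PDO

end SuperHD

namespace SuperHD

open SuperFieldAlgebra

namespace PDO

variable {A : Type u} [SuperFieldAlgebra A]

/-! ### The ring of operators -/

/-- Left composition with `E_s`. -/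
def eL : Fin 4 → PDO A →+ PDO A := ![AddMonoidHom.id _, d1L, d2L, d1L.comp d2L]

theorem eL_zero (P : PDO A) : eL 0 P = P := rfl

theorem eL_one (P : PDO A) : eL 1 P = d1L P := rfl

theorem eL_two (P : PDO A) : eL 2 P = d2L P := rfl

theorem eL_three (P : PDO A) : eL 3 P = d1L (d2L P) := rfl

theorem eL_mem_filt (s : Fin 4) {P : PDO A} {d : ℤ} (hP : P ∈ filt d) :
    eL s P ∈ filt (d + wt s) := by
  revert s
  refine forall_fin_four ?_ ?_ ?_ ?_ <;> simp only [wt, Matrix.cons_val]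
  · rw [add_zero]; exact hP
  · exact d1L_mem_filt hP
  · exact d2L_mem_filt hP
  · rw [show d + 2 = d + 1 + 1 by ring]
    exact d1L_mem_filt (d2L_mem_filt hP)

/-- The contribution of the terms of `P` with `∂^k` to the product `P * Q`. -/
noncomputable def mulTerm (P Q : PDO A) (k : ℤ) : PDO A :=
  ∑ t, fnL (P.coeff k t) (eL t (ddL k Q))

theorem mul_coeff (P Q : PDO A) (m : ℤ) (s : Fin 4) :
    (P * Q).coeff m s = ∑ᶠ k, (mulTerm P Q k).coeff m s := by
  refine finsum_congr fun k => ?_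
  simp only [mulTerm, Fin.sum_univ_four]
  rfl

theorem mulTerm_mem_filt {P Q : PDO A} {p q : ℤ} (hP : P ∈ filt p) (hQ : Q ∈ filt q) (k : ℤ) :
    mulTerm P Q k ∈ filt (p + q) := by
  refine sum_mem fun t _ => ?_
  by_cases ht : p < 2 * k + wt t
  · rw [hP k t ht]
    intro m s _
    simp
  · exact filt_mono (by omega) (fnL_mem_filt _ (eL_mem_filt t (ddL_mem_filt k hQ)))

/-- A term with ∂^k contributes only if k is at most about p/2, since otherwise the left coefficient
vanishes, and at least about (2m + wt s - q)/2, since otherwise the right factor has too low an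
order. -/
theorem mul_coeff_eq_sum {P Q : PDO A} {p q m : ℤ} {s : Fin 4} (hP : P ∈ filt p) (hQ : Q ∈ filt q)
    {I : Finset ℤ} (hI : Finset.Icc ((2 * m + wt s - q) / 2 - 2) (p / 2 + 2) ⊆ I) :
    (P * Q).coeff m s = ∑ k ∈ I, (mulTerm P Q k).coeff m s := by
  rw [mul_coeff]
  refine finsum_eq_sum_of_support_subset _ fun k hk => ?_
  rw [Function.mem_support] at hk
  by_contra hn
  apply hk
  have hk' : k ∉ Finset.Icc ((2 * m + wt s - q) / 2 - 2) (p / 2 + 2) := fun h => hn (hI h)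
  rw [Finset.mem_Icc, not_and_or] at hk'
  rw [mulTerm, sum_coeff]
  refine Finset.sum_eq_zero fun t _ => ?_
  have := wt_nonneg t
  have := wt_le_two t
  rw [fnL_coeff]
  rcases hk' with h | h
  · rw [eL_mem_filt t (ddL_mem_filt k hQ) m s (by omega), mul_zero]
  · rw [hP k t (by omega), zero_mul]

theorem mul_mem_filt {P Q : PDO A} {p q : ℤ} (hP : P ∈ filt p) (hQ : Q ∈ filt q) :
    P * Q ∈ filt (p + q) := by
  intro m s h
  rw [mul_coeff_eq_sum hP hQ (Finset.Subset.refl _)]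
  exact Finset.sum_eq_zero fun k _ => mulTerm_mem_filt hP hQ k m s h

theorem fnL_zero_left (P : PDO A) : fnL 0 P = 0 := ext_coeff fun m s => by simp

theorem fnL_add_left (a b : A) (P : PDO A) : fnL (a + b) P = fnL a P + fnL b P :=
  ext_coeff fun m s => by simp [add_mul]

theorem fnL_one (P : PDO A) : fnL 1 P = P := ext_coeff fun m s => by simp

theorem mulTerm_add_left (P P' Q : PDO A) (k : ℤ) :
    mulTerm (P + P') Q k = mulTerm P Q k + mulTerm P' Q k := by
  simp only [mulTerm, add_coeff, fnL_add_left, Finset.sum_add_distrib]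

theorem mulTerm_add_right (P Q Q' : PDO A) (k : ℤ) :
    mulTerm P (Q + Q') k = mulTerm P Q k + mulTerm P Q' k := by
  simp only [mulTerm, ddL_add, map_add, Finset.sum_add_distrib]

theorem add_mul' (P P' Q : PDO A) : (P + P') * Q = P * Q + P' * Q := by
  refine ext_coeff fun m s => ?_
  obtain ⟨p, hp⟩ := exists_mem_filt P
  obtain ⟨p', hp'⟩ := exists_mem_filt P'
  obtain ⟨q, hq⟩ := exists_mem_filt Q
  have h := filt_mono (A := A) (le_max_left p p') hp
  have h' := filt_mono (A := A) (le_max_right p p') hp'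
  rw [add_coeff, mul_coeff_eq_sum (add_mem h h') hq (Finset.Subset.refl _),
    mul_coeff_eq_sum h hq (Finset.Subset.refl _), mul_coeff_eq_sum h' hq (Finset.Subset.refl _),
    ← Finset.sum_add_distrib]
  simp only [mulTerm_add_left, add_coeff]

theorem mul_add' (P Q Q' : PDO A) : P * (Q + Q') = P * Q + P * Q' := by
  refine ext_coeff fun m s => ?_
  obtain ⟨p, hp⟩ := exists_mem_filt P
  obtain ⟨q, hq⟩ := exists_mem_filt Q
  obtain ⟨q', hq'⟩ := exists_mem_filt Q'
  have h := filt_mono (A := A) (le_max_left q q') hq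
  have h' := filt_mono (A := A) (le_max_right q q') hq'
  rw [add_coeff, mul_coeff_eq_sum hp (add_mem h h') (Finset.Subset.refl _),
    mul_coeff_eq_sum hp h (Finset.Subset.refl _), mul_coeff_eq_sum hp h' (Finset.Subset.refl _),
    ← Finset.sum_add_distrib]
  simp only [mulTerm_add_right, add_coeff]

/-- Multiplication by a monomial on the left is a composite of the elementary left compositions.
Associativity thereby reduces to each of these commuting with right multiplication. -/
theorem mono_mul (a : A) (k : ℤ) (s : Fin 4) (Q : PDO A) :
    mono a k s * Q = fnL a (eL s (ddL k Q)) := by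
  refine ext_coeff fun m t => ?_
  have h : ∀ l r, (mono a k s).coeff l r = if l = k ∧ r = s then a else 0 := fun _ _ => rfl
  rw [mul_coeff, finsum_eq_single _ k]
  · rw [mulTerm, Finset.sum_eq_single s]
    · simp [h]
    · intro r _ hr
      simp [h, hr, fnL_zero_left]
    · simp
  · intro l hl
    simp [mulTerm, h, hl, fnL_zero_left]

theorem fnL_mono (a b : A) (k : ℤ) (s : Fin 4) : fnL a (mono b k s) = mono (a * b) k s :=
  ext_coeff fun m t => by
    simp only [fnL_coeff, mono_coeff]
    split_ifs <;> simp

theorem d1L_mono_zero (b : A) (k : ℤ) :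
    d1L (mono b k 0) = mono (D 0 b) k 0 + mono (par b) k 1 := by
  refine ext_coeff fun m => forall_fin_four ?_ ?_ ?_ ?_ <;>
    simp only [d1L_coeff_zero, d1L_coeff_one, d1L_coeff_two, d1L_coeff_three, add_coeff,
      mono_coeff] <;> split_ifs <;> simp_all

theorem d1L_mono_one (b : A) (k : ℤ) :
    d1L (mono b k 1) = mono (D 0 b) k 1 + mono (par b) (k + 1) 0 := by
  refine ext_coeff fun m => forall_fin_four ?_ ?_ ?_ ?_ <;>
    simp only [d1L_coeff_zero, d1L_coeff_one, d1L_coeff_two, d1L_coeff_three, add_coeff,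
      mono_coeff] <;> (split_ifs <;> simp_all; try omega)

theorem d1L_mono_two (b : A) (k : ℤ) :
    d1L (mono b k 2) = mono (D 0 b) k 2 + mono (par b) k 3 := by
  refine ext_coeff fun m => forall_fin_four ?_ ?_ ?_ ?_ <;>
    simp only [d1L_coeff_zero, d1L_coeff_one, d1L_coeff_two, d1L_coeff_three, add_coeff,
      mono_coeff] <;> split_ifs <;> simp_all

theorem d1L_mono_three (b : A) (k : ℤ) :
    d1L (mono b k 3) = mono (D 0 b) k 3 + mono (par b) (k + 1) 2 := by
  refine ext_coeff fun m => forall_fin_four ?_ ?_ ?_ ?_ <;>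
    simp only [d1L_coeff_zero, d1L_coeff_one, d1L_coeff_two, d1L_coeff_three, add_coeff,
      mono_coeff] <;> (split_ifs <;> simp_all; try omega)

theorem d2L_mono_zero (b : A) (k : ℤ) :
    d2L (mono b k 0) = mono (D 1 b) k 0 + mono (par b) k 2 := by
  refine ext_coeff fun m => forall_fin_four ?_ ?_ ?_ ?_ <;>
    simp only [d2L_coeff_zero, d2L_coeff_one, d2L_coeff_two, d2L_coeff_three, add_coeff,
      mono_coeff] <;> split_ifs <;> simp_all

theorem d2L_mono_one (b : A) (k : ℤ) :
    d2L (mono b k 1) = mono (D 1 b) k 1 - mono (par b) k 3 := by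
  refine ext_coeff fun m => forall_fin_four ?_ ?_ ?_ ?_ <;>
    simp only [d2L_coeff_zero, d2L_coeff_one, d2L_coeff_two, d2L_coeff_three, sub_coeff,
      mono_coeff] <;> split_ifs <;> simp_all

theorem d2L_mono_two (b : A) (k : ℤ) :
    d2L (mono b k 2) = mono (D 1 b) k 2 + mono (par b) (k + 1) 0 := by
  refine ext_coeff fun m => forall_fin_four ?_ ?_ ?_ ?_ <;>
    simp only [d2L_coeff_zero, d2L_coeff_one, d2L_coeff_two, d2L_coeff_three, add_coeff,
      mono_coeff] <;> (split_ifs <;> simp_all; try omega)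

theorem d2L_mono_three (b : A) (k : ℤ) :
    d2L (mono b k 3) = mono (D 1 b) k 3 - mono (par b) (k + 1) 1 := by
  refine ext_coeff fun m => forall_fin_four ?_ ?_ ?_ ?_ <;>
    simp only [d2L_coeff_zero, d2L_coeff_one, d2L_coeff_two, d2L_coeff_three, sub_coeff,
      mono_coeff] <;> (split_ifs <;> simp_all; try omega)

/-- Right multiplication by an operator. -/
noncomputable def rmul (S : PDO A) : PDO A →+ PDO A :=
  AddMonoidHom.mk' (· * S) fun P Q => add_mul' P Q S

theorem rmul_apply (S P : PDO A) : rmul S P = P * S := rfl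

/-- Left multiplication by an operator. -/
noncomputable def lmul (S : PDO A) : PDO A →+ PDO A :=
  AddMonoidHom.mk' (S * ·) fun P Q => mul_add' S P Q

theorem lmul_apply (S P : PDO A) : lmul S P = S * P := rfl

/-- Both sides are additive in `P` and shift the filtration by the same amount, so monomials
suffice. There the claim is the super Leibniz rule together with the relations between D₁, D₂ and ∂.
-/
theorem d1L_mul (P S : PDO A) : d1L P * S = d1L (P * S) := by
  obtain ⟨e, he⟩ := exists_mem_filt S
  have : (rmul S).comp d1L = d1L.comp (rmul S) := by
    refine addHom_ext (c := e + 1) (fun d P hP => ?_) (fun d P hP => ?_) fun b k => ?_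
    · exact filt_mono (by omega) (mul_mem_filt (d1L_mem_filt hP) he)
    · exact filt_mono (by omega) (d1L_mem_filt (mul_mem_filt hP he))
    · refine forall_fin_four ?_ ?_ ?_ ?_ <;> simp only [AddMonoidHom.comp_apply]
      · rw [d1L_mono_zero, map_add]
        simp only [rmul_apply, mono_mul, d1L_fnL, eL_zero, eL_one]
      · rw [d1L_mono_one, map_add]
        simp only [rmul_apply, mono_mul, d1L_fnL, eL_zero, eL_one, d1L_d1L, ddL_one_ddL]
      · rw [d1L_mono_two, map_add]
        simp only [rmul_apply, mono_mul, d1L_fnL, eL_two, eL_three]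
      · rw [d1L_mono_three, map_add]
        simp only [rmul_apply, mono_mul, d1L_fnL, eL_two, eL_three, d1L_d1L]
        -- ∂ commutes with D₂, both ∂D₂ and D₂∂ being D₂³.
        rw [← d2L_d2L, d2L_d2L (ddL k S), ddL_one_ddL]
  exact DFunLike.congr_fun this P

theorem d2L_mul (P S : PDO A) : d2L P * S = d2L (P * S) := by
  obtain ⟨e, he⟩ := exists_mem_filt S
  have : (rmul S).comp d2L = d2L.comp (rmul S) := by
    refine addHom_ext (c := e + 1) (fun d P hP => ?_) (fun d P hP => ?_) fun b k => ?_
    · exact filt_mono (by omega) (mul_mem_filt (d2L_mem_filt hP) he)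
    · exact filt_mono (by omega) (d2L_mem_filt (mul_mem_filt hP he))
    · refine forall_fin_four ?_ ?_ ?_ ?_ <;> simp only [AddMonoidHom.comp_apply]
      · rw [d2L_mono_zero, map_add]
        simp only [rmul_apply, mono_mul, d2L_fnL, eL_zero, eL_two]
      · rw [d2L_mono_one, map_sub]
        simp only [rmul_apply, mono_mul, d2L_fnL, eL_one, eL_three, d2L_d1L, map_neg]
        abel
      · rw [d2L_mono_two, map_add]
        simp only [rmul_apply, mono_mul, d2L_fnL, eL_zero, eL_two, d2L_d2L, ddL_one_ddL]
      · rw [d2L_mono_three, map_sub]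
        simp only [rmul_apply, mono_mul, d2L_fnL, eL_one, eL_three, d2L_d1L, d2L_d2L, ddL_one_ddL,
          map_neg]
        abel
  exact DFunLike.congr_fun this P

theorem ddL_one_mul (P S : PDO A) : ddL 1 P * S = ddL 1 (P * S) := by
  rw [← d1L_d1L, d1L_mul, d1L_mul, d1L_d1L]

/-- If ∂ annihilates an operator, each coefficient is minus the derivative of the one above it; the
top ones vanish, hence all do. Negative powers of ∂ are handled later by cancelling a ∂ with this.
-/
theorem ddL_one_injective : Function.Injective (ddL 1 : PDO A → PDO A) := by
  intro P Q h
  obtain ⟨N, hN⟩ := (P - Q).bdd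
  have hc : ∀ m s, (P - Q).coeff (m - 1) s = -dd ((P - Q).coeff m s) := by
    intro m s
    have hPQ : ddL 1 (P - Q) = 0 := by
      have := ddL_add 1 (P - Q) Q
      rw [sub_add_cancel, h] at this
      simpa using this
    have := congrArg (fun X : PDO A => X.coeff m s) hPQ
    simp only [ddL_one_coeff, zero_coeff] at this
    exact eq_neg_of_add_eq_zero_right this
  have key : ∀ n : ℕ, ∀ s, (P - Q).coeff (N + 1 - n) s = 0 := by
    intro n
    induction n with
    | zero => intro s; rw [hN _ (by omega)]; rfl
    | succ n ih =>
      intro s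
      rw [show N + 1 - ((n + 1 : ℕ) : ℤ) = N + 1 - n - 1 by push_cast; ring, hc, ih, dd_zero,
        neg_zero]
  rw [← sub_eq_zero]
  refine ext_coeff fun k s => ?_
  rcases le_or_gt k N with hk | hk
  · have := key (N + 1 - k).toNat s
    rwa [show N + 1 - ((N + 1 - k).toNat : ℤ) = k by omega] at this
  · rw [hN k hk]
    rfl

theorem ddL_mul (k : ℤ) (P S : PDO A) : ddL k P * S = ddL k (P * S) := by
  induction k with
  | zero => rw [ddL_zero, ddL_zero]
  | succ k ih => rw [← ddL_one_ddL, ddL_one_mul, ih, ddL_one_ddL]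
  | pred k ih =>
    apply ddL_one_injective
    rw [← ddL_one_mul, ddL_one_ddL, ddL_one_ddL, sub_add_cancel, ih]

theorem fnL_mul (a : A) (P S : PDO A) : fnL a P * S = fnL a (P * S) := by
  refine ext_coeff fun m s => ?_
  obtain ⟨p, hp⟩ := exists_mem_filt P
  obtain ⟨q, hq⟩ := exists_mem_filt S
  rw [fnL_coeff, mul_coeff_eq_sum (fnL_mem_filt a hp) hq (Finset.Subset.refl _),
    mul_coeff_eq_sum hp hq (Finset.Subset.refl _), Finset.mul_sum]
  simp only [mulTerm, sum_coeff, fnL_coeff, Finset.mul_sum, mul_assoc]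

theorem eL_mul (t : Fin 4) (P S : PDO A) : eL t P * S = eL t (P * S) := by
  revert t
  refine forall_fin_four ?_ ?_ ?_ ?_
  · rfl
  · exact d1L_mul P S
  · exact d2L_mul P S
  · simp only [eL_three, d1L_mul, d2L_mul]

/-- As functions of `P` both sides are additive and filtered, so `P` may be a monomial; its
elementary left compositions then pass through the right multiplications. -/
theorem mul_assoc' (P Q S : PDO A) : P * Q * S = P * (Q * S) := by
  obtain ⟨q, hq⟩ := exists_mem_filt Q
  obtain ⟨e, he⟩ := exists_mem_filt S
  have : (rmul S).comp (rmul Q) = rmul (Q * S) := by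
    refine addHom_ext (c := q + e) (fun d P hP => ?_) (fun d P hP => ?_) fun b k s => ?_
    · exact filt_mono (by omega) (mul_mem_filt (mul_mem_filt hP hq) he)
    · exact mul_mem_filt hP (mul_mem_filt hq he)
    · simp only [AddMonoidHom.comp_apply, rmul_apply, mono_mul, fnL_mul, eL_mul, ddL_mul]
  exact DFunLike.congr_fun this P

theorem fn_mul (a : A) (P : PDO A) : fn a * P = fnL a P := by
  rw [fn, mono_mul, eL_zero, ddL_zero]

theorem ddL_mono_one (k l : ℤ) (s : Fin 4) : ddL k (mono (1 : A) l s) = mono 1 (k + l) s := by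
  refine ext_coeff fun m t => ?_
  obtain ⟨n, hn⟩ := exists_bound (mono (1 : A) l s) (m - k)
  rw [ddL_coeff_eq_sum k _ m t (n + 1) fun j hj => hn j (by omega) t, Finset.sum_range_succ',
    Finset.sum_eq_zero]
  · simp only [Ring.choose_zero_right, mono_coeff, Nat.cast_zero, add_zero, Function.iterate_zero,
      id, one_smul, zero_add, show m - k = l ↔ m = k + l by omega]
  · intro j _
    rw [mono_coeff]
    split_ifs
    · rw [dd_iterate_one, smul_zero]
    · rw [dd_iterate_zero, smul_zero]

theorem mul_one' (P : PDO A) : P * 1 = P := by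
  have : rmul (1 : PDO A) = AddMonoidHom.id _ := by
    refine addHom_ext (c := 0) (fun d P hP => ?_) (fun d P hP => ?_) fun b k => ?_
    · exact mul_mem_filt hP (mono_mem_filt _ (by simp [wt]))
    · rw [add_zero]; exact hP
    · refine forall_fin_four ?_ ?_ ?_ ?_ <;>
        simp only [rmul_apply, mono_mul, AddMonoidHom.id_apply, eL_zero, eL_one, eL_two, eL_three,
          show (1 : PDO A) = mono 1 0 0 from rfl, ddL_mono_one, add_zero, d1L_mono_zero,
          d2L_mono_zero, d1L_mono_two, D_one, mono_zero, zero_add, par_one, fnL_mono, mul_one]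
  exact DFunLike.congr_fun this P

noncomputable instance : Ring (PDO A) where
  left_distrib := mul_add'
  right_distrib := add_mul'
  zero_mul P := map_zero (rmul P)
  mul_zero P := map_zero (lmul P)
  mul_assoc := mul_assoc'
  one_mul P := by rw [show (1 : PDO A) = fn 1 from rfl, fn_mul, fnL_one]
  mul_one := mul_one'
  __ := (inferInstance : AddCommGroup (PDO A))
  -- The monoid power is taken to be the power already defined on operators, so that the two
  -- readings of `R ^ n` agree definitionally.
  npow n P := P ^ n
  npow_zero _ := rfl
  npow_succ _ _ := rfl

noncomputable instance : Algebra ℚ (PDO A) :=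
  Algebra.ofModule (fun c P Q => map_rat_smul (rmul Q) c P) (fun c P Q => map_rat_smul (lmul P) c Q)

end PDO

end SuperHD

namespace SuperHD

open SuperFieldAlgebra

namespace PDO

variable {A : Type u} [SuperFieldAlgebra A]

/-! ### Relations between the generators -/

theorem fn_add (a b : A) : fn (a + b) = fn a + fn b := mono_add a b 0 0

theorem fn_sub (a b : A) : fn (a - b) = fn a - fn b := mono_sub a b 0 0

theorem fn_neg (a : A) : fn (-a) = -fn a := mono_neg a 0 0

theorem fn_zero : fn (0 : A) = 0 := mono_zero 0 0

theorem fn_smul (c : ℚ) (a : A) : fn (c • a) = c • fn a := mono_smul c a 0 0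

theorem fn_one : fn (1 : A) = 1 := rfl

theorem fn_mul_mono (a b : A) (k : ℤ) (s : Fin 4) : fn a * mono b k s = mono (a * b) k s := by
  rw [fn_mul, fnL_mono]

theorem fn_mul_fn (a b : A) : fn a * fn b = fn (a * b) := fn_mul_mono a b 0 0

theorem fn_coeff (a : A) (k : ℤ) (s : Fin 4) :
    (fn a).coeff k s = if k = 0 ∧ s = 0 then a else 0 := rfl

theorem fn_mul_coeff (a : A) (P : PDO A) (k : ℤ) (s : Fin 4) :
    (fn a * P).coeff k s = a * P.coeff k s := by
  rw [fn_mul, fnL_coeff]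

theorem Dop_zero_mul (P : PDO A) : Dop 0 * P = d1L P := by
  rw [show Dop 0 = mono (1 : A) 0 1 from rfl, mono_mul, ddL_zero, eL_one, fnL_one]

theorem Dop_one_mul (P : PDO A) : Dop 1 * P = d2L P := by
  rw [show Dop 1 = mono (1 : A) 0 2 from rfl, mono_mul, ddL_zero, eL_two, fnL_one]

theorem pd_mul (P : PDO A) : pd * P = ddL 1 P := by
  rw [pd, mono_mul, eL_zero, fnL_one]

theorem pd_mul_coeff (P : PDO A) (m : ℤ) (s : Fin 4) :
    (pd * P).coeff m s = dd (P.coeff m s) + P.coeff (m - 1) s := by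
  rw [pd_mul, ddL_one_coeff]

/-- The operator `∂⁻¹`. -/
def pdi : PDO A := mono 1 (-1) 0

theorem mono_mul_mono (k l : ℤ) (s : Fin 4) :
    mono (1 : A) k 0 * mono 1 l s = mono 1 (k + l) s := by
  rw [mono_mul, eL_zero, fnL_one, ddL_mono_one]

theorem pd_mul_pdi : (pd : PDO A) * pdi = 1 := mono_mul_mono 1 (-1) 0

theorem pdi_mul_pd : (pdi : PDO A) * pd = 1 := mono_mul_mono (-1) 1 0

theorem pd_mul_pdi_mul (P : PDO A) : pd * (pdi * P) = P := by
  rw [← mul_assoc, pd_mul_pdi, one_mul]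

theorem pdi_mul_pd_mul (P : PDO A) : pdi * (pd * P) = P := by
  rw [← mul_assoc, pdi_mul_pd, one_mul]

theorem Dop_zero_mul_self : Dop 0 * Dop 0 = (pd : PDO A) := by
  rw [Dop_zero_mul, show Dop 0 = mono (1 : A) 0 1 from rfl, d1L_mono_one, D_one, mono_zero,
    zero_add, par_one, pd, zero_add]

theorem Dop_one_mul_self : Dop 1 * Dop 1 = (pd : PDO A) := by
  rw [Dop_one_mul, show Dop 1 = mono (1 : A) 0 2 from rfl, d2L_mono_two, D_one, mono_zero,
    zero_add, par_one, pd, zero_add]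

theorem Dop_mul_self (i : Fin 2) : Dop i * Dop i = (pd : PDO A) := by
  fin_cases i
  · exact Dop_zero_mul_self
  · exact Dop_one_mul_self

theorem Dop_zero_mul_Dop_one : Dop 0 * Dop 1 = mono (1 : A) 0 3 := by
  rw [Dop_zero_mul, show Dop 1 = mono (1 : A) 0 2 from rfl, d1L_mono_two, D_one, mono_zero,
    zero_add, par_one]

theorem Dop_one_mul_Dop_zero : Dop 1 * Dop 0 = -(Dop 0 * Dop 1 : PDO A) := by
  rw [Dop_zero_mul_Dop_one, Dop_one_mul, show Dop 0 = mono (1 : A) 0 1 from rfl, d2L_mono_one,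
    D_one, mono_zero, zero_sub, par_one]

theorem Dop_mul_fn (i : Fin 2) (a : A) : Dop i * fn a = fn (D i a) + fn (par a) * Dop i := by
  fin_cases i
  · change Dop 0 * fn a = fn (D 0 a) + fn (par a) * Dop 0
    rw [Dop_zero_mul, fn, d1L_mono_zero, show Dop 0 = mono (1 : A) 0 1 from rfl, fn_mul_mono,
      mul_one]
    rfl
  · change Dop 1 * fn a = fn (D 1 a) + fn (par a) * Dop 1
    rw [Dop_one_mul, fn, d2L_mono_zero, show Dop 1 = mono (1 : A) 0 2 from rfl, fn_mul_mono,
      mul_one]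
    rfl

theorem pd_mul_fn (a : A) : pd * fn a = fn (dd a) + fn a * pd := by
  rw [← Dop_mul_self 0, mul_assoc, Dop_mul_fn, mul_add, Dop_mul_fn, ← mul_assoc, Dop_mul_fn,
    add_mul, D_par, par_par, D_D_same, fn_neg, mul_assoc]
  noncomm_ring

theorem pd_mul_Dop (i : Fin 2) : pd * Dop i = (Dop i * pd : PDO A) := by
  rw [← Dop_mul_self i, mul_assoc]

theorem Dop_mul_fn_mul (i : Fin 2) (a : A) (P : PDO A) :
    Dop i * (fn a * P) = fn (D i a) * P + fn (par a) * (Dop i * P) := by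
  rw [← mul_assoc, Dop_mul_fn, add_mul, mul_assoc]

theorem Dop_mul_Dop_mul (i : Fin 2) (P : PDO A) : Dop i * (Dop i * P) = pd * P := by
  rw [← mul_assoc, Dop_mul_self]

theorem Dop_one_mul_Dop_zero_mul (P : PDO A) :
    Dop 1 * (Dop 0 * P) = -(Dop 0 * (Dop 1 * P)) := by
  rw [← mul_assoc, Dop_one_mul_Dop_zero, neg_mul, mul_assoc]

theorem pd_mul_fn_mul (a : A) (P : PDO A) :
    pd * (fn a * P) = fn (dd a) * P + fn a * (pd * P) := by
  rw [← mul_assoc, pd_mul_fn, add_mul, mul_assoc]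

theorem pd_mul_Dop_mul (i : Fin 2) (P : PDO A) : pd * (Dop i * P) = Dop i * (pd * P) := by
  rw [← mul_assoc, pd_mul_Dop, mul_assoc]

theorem fn_mul_fn_mul (a b : A) (P : PDO A) : fn a * (fn b * P) = fn (a * b) * P := by
  rw [← mul_assoc, fn_mul_fn]

theorem pdi_mul_Dop (i : Fin 2) : pdi * Dop i = (Dop i * pdi : PDO A) := by
  calc pdi * Dop i = (pdi * (Dop i * (pd * pdi)) : PDO A) := by rw [pd_mul_pdi, mul_one]
    _ = pdi * (pd * Dop i) * pdi := by rw [pd_mul_Dop]; simp only [mul_assoc]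
    _ = Dop i * pdi := by rw [pdi_mul_pd_mul]

/-- The relation ∂a = a' + a∂ is multiplied by ∂⁻¹ on both sides. One step of the infinite expansion
is enough, since the correction has lower order. -/
theorem pdi_mul_fn (a : A) : pdi * fn a = fn a * pdi - pdi * fn (dd a) * pdi := by
  have h := pd_mul_fn a
  calc pdi * fn a = pdi * (fn a * pd) * pdi := by
        rw [mul_assoc, mul_assoc, pd_mul_pdi, mul_one]
    _ = pdi * (pd * fn a - fn (dd a)) * pdi := by rw [h, add_sub_cancel_left]
    _ = _ := by rw [mul_sub, pdi_mul_pd_mul, sub_mul]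

theorem mono_eq (a : A) (k : ℤ) (s : Fin 4) : mono a k s = fn a * mono 1 0 s * mono 1 k 0 := by
  rw [mul_assoc, fn_mul, mono_mul, fnL_one, ddL_zero]
  revert s
  refine forall_fin_four ?_ ?_ ?_ ?_ <;>
    simp [eL_zero, eL_one, eL_two, eL_three, fnL_mono, d1L_mono_zero, d2L_mono_zero, d1L_mono_two,
      D_one, mono_zero]

theorem fn_mem_filt (a : A) {d : ℤ} (h : 0 ≤ d) : fn a ∈ filt d :=
  mono_mem_filt a (by simpa [wt] using h)

theorem Dop_mem_filt (i : Fin 2) : (Dop i : PDO A) ∈ filt 1 := by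
  fin_cases i
  · exact mono_mem_filt (k := 0) (s := 1) 1 (by simp [wt])
  · exact mono_mem_filt (k := 0) (s := 2) 1 (by simp [wt])

theorem pd_mem_filt : (pd : PDO A) ∈ filt 2 := mono_mem_filt 1 (by simp [wt])

theorem pdi_mem_filt : (pdi : PDO A) ∈ filt (-2) := mono_mem_filt 1 (by simp [wt])

/-! ### Right multiplication by `∂^k` -/

/-- Shift of the powers of `∂`. -/
def shift (l : ℤ) : PDO A →+ PDO A where
  toFun P := ⟨fun k s => P.coeff (k - l) s, by
    obtain ⟨M, hM⟩ := P.bdd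
    exact ⟨M + l, fun k hk => by rw [hM _ (by omega)]⟩⟩
  map_zero' := rfl
  map_add' _ _ := rfl

theorem shift_coeff (l : ℤ) (P : PDO A) (k : ℤ) (s : Fin 4) :
    (shift l P).coeff k s = P.coeff (k - l) s := rfl

theorem shift_mem_filt (l : ℤ) {P : PDO A} {d : ℤ} (hP : P ∈ filt d) :
    shift l P ∈ filt (d + 2 * l) :=
  fun k s h => hP _ _ (by omega)

theorem shift_mono (l : ℤ) (a : A) (k : ℤ) (s : Fin 4) :
    shift l (mono a k s) = mono a (k + l) s :=
  ext_coeff fun m t => by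
    simp only [shift_coeff, mono_coeff, show m - l = k ↔ m = k + l by omega]

theorem mono_mul_mono_zero (a : A) (k l : ℤ) (s : Fin 4) :
    mono a k s * mono 1 l 0 = mono a (k + l) s := by
  rw [mono_eq a k s, mul_assoc, mono_mul_mono, ← mono_eq]

theorem mul_mono_zero (P : PDO A) (l : ℤ) : P * mono 1 l 0 = shift l P := by
  have : rmul (mono (1 : A) l 0) = shift l := by
    refine addHom_ext (c := 2 * l) (fun d P hP => ?_) (fun d P hP => ?_) fun b k s => ?_
    · exact mul_mem_filt hP (mono_mem_filt _ (by simp [wt]))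
    · exact shift_mem_filt l hP
    · rw [rmul_apply, mono_mul_mono_zero, shift_mono]
  exact DFunLike.congr_fun this P

theorem mul_pd_coeff (P : PDO A) (k : ℤ) (s : Fin 4) :
    (P * pd).coeff k s = P.coeff (k - 1) s := by
  rw [pd, mul_mono_zero, shift_coeff]

/-- The shifts by ∂ cancel and only the derivatives of the coefficients remain, so the commutator
does not raise the order although ∂ itself does. -/
theorem pd_commutator_mem_filt {P : PDO A} {d : ℤ} (hP : P ∈ filt d) :
    pd * P - P * pd ∈ filt d := by
  intro k s h
  rw [sub_coeff, pd_mul_coeff, mul_pd_coeff, hP k s h, dd_zero, zero_add, sub_self]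

theorem mem_filt_of_mul_pd {P : PDO A} {d : ℤ} (h : P * pd ∈ filt d) : P ∈ filt (d - 2) := by
  have := mul_mem_filt h (pdi_mem_filt (A := A))
  rwa [mul_assoc, pd_mul_pdi, mul_one] at this

theorem mem_filt_of_pd_mul {P : PDO A} {d : ℤ} (h : pd * P ∈ filt d) : P ∈ filt (d - 2) := by
  have := mul_mem_filt (pdi_mem_filt (A := A)) h
  rw [pdi_mul_pd_mul] at this
  exact filt_mono (by omega) this

theorem mem_filt_of_smul {P : PDO A} {d : ℤ} {c : ℚ} (hc : c ≠ 0) (h : c • P ∈ filt d) :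
    P ∈ filt d := by
  have := smul_mem_filt c⁻¹ h
  rwa [smul_smul, inv_mul_cancel₀ hc, one_smul] at this

/-! ### Square roots -/

/-- Multiplication on both sides by operators `∂ + ⋯` does not lose order. -/
theorem mem_filt_of_mul_add_mul {X Y T : PDO A} {e : ℤ} (hX : X - pd ∈ filt 1)
    (hY : Y - pd ∈ filt 1) (h : X * T + T * Y ∈ filt e) : T ∈ filt (e - 2) := by
  -- From 2T∂ = (XT + TY) - (X - ∂)T - T(Y - ∂) - [∂, T] every term on the right has degree at most
  -- d + 1, and cancelling ∂ lowers the degree by 2.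
  have step : ∀ d, e ≤ d + 1 → T ∈ filt d → T ∈ filt (d - 1) := by
    intro d hd hT
    have h1 : (X - pd) * T ∈ filt (d + 1) := filt_mono (by omega) (mul_mem_filt hX hT)
    have h2 : T * (Y - pd) ∈ filt (d + 1) := mul_mem_filt hT hY
    have h3 : (2 : ℚ) • (T * pd) ∈ filt (d + 1) := by
      have h4 := sub_mem (sub_mem (sub_mem (filt_mono hd h) h1) h2)
        (filt_mono (by omega : d ≤ d + 1) (pd_commutator_mem_filt hT))
      convert h4 using 1
      rw [two_smul]
      noncomm_ring
    exact filt_mono (by omega) (mem_filt_of_mul_pd (mem_filt_of_smul two_ne_zero h3))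
  obtain ⟨d, hd⟩ := exists_mem_filt T
  have key : ∀ n : ℕ, T ∈ filt (max (e - 2) (d - n)) := by
    intro n
    induction n with
    | zero => exact filt_mono (by simp) hd
    | succ n ih =>
      by_cases hn : d - n ≤ e - 2
      · rw [max_eq_left hn] at ih
        exact filt_mono (le_max_left _ _) ih
      · rw [max_eq_right (by omega)] at ih
        exact filt_mono (by push_cast; omega) (step _ (by omega) ih)
  exact filt_mono (by omega) (key (d - e + 2).toNat)

/-- The order of `T` descends without end. This is the uniqueness principle behind the square root
and behind every symmetry that the root inherits from L_{2m}. -/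
theorem eq_zero_of_mul_add_mul {X Y T : PDO A} (hX : X - pd ∈ filt 1) (hY : Y - pd ∈ filt 1)
    (h : X * T + T * Y = 0) : T = 0 :=
  eq_zero_of_forall_mem_filt fun d => by
    have := mem_filt_of_mul_add_mul (e := d + 2) hX hY (by rw [h]; exact zero_mem _)
    rwa [add_sub_cancel_right] at this

theorem pd_mul_pd : (pd : PDO A) * pd = mono 1 2 0 := mono_mul_mono 1 1 0

/-- `IsSqrt` grades by powers of ∂, where D₁D₂ is lower than ∂, while the filtration gives both the
same degree. A possible term d D₁D₂ of `R` must therefore be excluded: in R² the coefficient of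
D₁D₂∂ is 2d, since the square of d D₁D₂ has no such term. -/
theorem IsSqrt.sub_pd_mem_filt {R L : PDO A} (h : IsSqrt R L) (hL : L.coeff 1 3 = 0) :
    R - pd ∈ filt 1 := by
  obtain ⟨hR, h1, h2⟩ := h
  have hc : ∀ k s, 0 < k → (R - pd).coeff k s = 0 := by
    intro k s hk
    rw [sub_coeff, pd, mono_coeff]
    rcases eq_or_lt_of_le (Int.add_one_le_of_lt hk) with h | h
    · rw [zero_add] at h
      rw [← h, h1]
      revert s
      exact forall_fin_four (by simp) (by simp) (by simp) (by simp)
    · rw [h2 k (by omega), if_neg (by omega), sub_zero]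
      rfl
  set S := R - pd with hS
  set d := S.coeff 0 3 with hd
  have hS1 : S - mono d 0 3 ∈ filt 1 := by
    intro k s hk
    rw [sub_coeff, mono_coeff]
    rcases lt_or_ge 0 k with h | h
    · rw [hc k s h, if_neg (by omega), sub_zero]
    · have := wt_le_two s
      obtain rfl : k = 0 := by omega
      revert s
      refine forall_fin_four ?_ ?_ ?_ ?_ <;> intro hk hw <;> simp [wt] at hk hw
      simp [hd]
  have hm : (mono d 0 3 : PDO A) ∈ filt 2 := mono_mem_filt _ (by simp [wt])
  have hS2 : S ∈ filt 2 := by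
    rw [← sub_add_cancel S (mono d 0 3)]
    exact add_mem (filt_mono (by omega) hS1) hm
  have hsq : (S * S).coeff 1 3 = 0 := by
    have e : S * S = mono d 0 3 * mono d 0 3 + ((S - mono d 0 3) * S
        + mono d 0 3 * (S - mono d 0 3)) := by noncomm_ring
    have e2 : (S - mono d 0 3) * S + mono d 0 3 * (S - mono d 0 3) ∈ filt 3 :=
      add_mem (mul_mem_filt hS1 hS2) (mul_mem_filt hm hS1)
    rw [e, add_coeff, e2 1 3 (by simp [wt]), add_zero, mono_mul, eL_three, ddL_zero,
      d2L_mono_three, map_sub, d1L_mono_three, d1L_mono_one]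
    simp [mono_coeff]
  have hd0 : d = 0 := by
    have e : R * R = pd * pd + pd * S + S * pd + S * S := by
      rw [show R = pd + S by rw [hS]; abel]
      noncomm_ring
    have e3 := congrArg (fun X : PDO A => X.coeff 1 3) e
    simp only [add_coeff, hR, hL, hsq, pd_mul_pd, pd_mul_coeff, mul_pd_coeff,
      hc 1 3 (by omega), dd_zero] at e3
    simp only [mono_coeff, sub_self, ← hd] at e3
    have : d = -d := by
      rw [eq_neg_iff_add_eq_zero]
      simpa using e3.symm
    exact eq_zero_of_eq_neg this
  rwa [hd0, mono_zero, sub_zero] at hS1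

/-- The difference of two roots solves R(R - R') + (R - R')R' = R² - R'² = 0. -/
theorem IsSqrt.eq {R R' L : PDO A} (h : IsSqrt R L) (h' : IsSqrt R' L) (hL : L.coeff 1 3 = 0) :
    R = R' := by
  rw [← sub_eq_zero]
  refine eq_zero_of_mul_add_mul (h.sub_pd_mem_filt hL) (h'.sub_pd_mem_filt hL) ?_
  have e : R * (R - R') + (R - R') * R' = R * R - R' * R' := by noncomm_ring
  rw [e, h.1, h'.1, sub_self]

/-- Newton iteration for the square root of `L`. -/
noncomputable def sqrtSeq (L : PDO A) : ℕ → PDO A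
  | 0 => pd
  | n + 1 => sqrtSeq L n - (1 / 2 : ℚ) • ((sqrtSeq L n * sqrtSeq L n - L) * pdi)

/-- Each step divides the error by the fixed leading part 2∂ instead of 2R. The new error then
consists of commutators with ∂ and products with R - ∂ and is two degrees lower, so convergence is
linear. -/
theorem sqrtSeq_spec {L : PDO A} (hL : L - pd * pd ∈ filt 2) (n : ℕ) :
    sqrtSeq L n - pd ∈ filt 0 ∧ sqrtSeq L n * sqrtSeq L n - L ∈ filt (2 - 2 * n) := by
  induction n with
  | zero =>
    refine ⟨by simp [sqrtSeq, zero_mem], ?_⟩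
    have := neg_mem hL
    rw [neg_sub] at this
    simpa [sqrtSeq] using this
  | succ n ih =>
    obtain ⟨h1, h2⟩ := ih
    rw [sqrtSeq]
    set R := sqrtSeq L n
    set E := R * R - L with hE
    have h3 : E * pdi ∈ filt (-2 * n) := filt_mono (by omega) (mul_mem_filt h2 pdi_mem_filt)
    refine ⟨?_, ?_⟩
    · rw [sub_right_comm]
      exact sub_mem h1 (smul_mem_filt _ (filt_mono (by omega) h3))
    · have a1 : (R - pd) * (E * pdi) ∈ filt (-2 * n) :=
        filt_mono (by omega) (mul_mem_filt h1 h3)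
      have a2 : (E * pdi) * (R - pd) ∈ filt (-2 * n) :=
        filt_mono (by omega) (mul_mem_filt h3 h1)
      have a3 : (E * pdi) * (E * pdi) ∈ filt (-2 * n) :=
        filt_mono (by omega) (mul_mem_filt h3 h3)
      have a4 : pd * (E * pdi) - (E * pdi) * pd ∈ filt (-2 * n) := pd_commutator_mem_filt h3
      have key : (R - (1 / 2 : ℚ) • (E * pdi)) * (R - (1 / 2 : ℚ) • (E * pdi)) - L =
          (1 / 4 : ℚ) • ((E * pdi) * (E * pdi)) - (1 / 2 : ℚ) • ((R - pd) * (E * pdi)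
            + (E * pdi) * (R - pd) + (pd * (E * pdi) - (E * pdi) * pd)) := by
        have e1 : (E * pdi) * pd = E := by rw [mul_assoc, pdi_mul_pd, mul_one]
        have e2 : R * R - L = (1 / 2 : ℚ) • ((2 : ℚ) • ((E * pdi) * pd)) := by
          rw [e1, smul_smul, ← hE]; norm_num
        simp only [sub_mul, mul_sub, smul_mul_assoc, mul_smul_comm, smul_smul, smul_sub, smul_add]
        rw [sub_eq_iff_eq_add] at e2
        rw [e2]
        simp only [two_smul, smul_add]
        norm_num
        abel
      rw [key]
      refine filt_mono (by push_cast; omega) (sub_mem (smul_mem_filt _ a3)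
        (smul_mem_filt _ (add_mem (add_mem a1 a2) a4)))

theorem sqrtSeq_sub_mem_filt {L : PDO A} (hL : L - pd * pd ∈ filt 2) (n m : ℕ) :
    sqrtSeq L (n + m) - sqrtSeq L n ∈ filt (-2 * n) := by
  induction m with
  | zero => simp [zero_mem]
  | succ m ih =>
    rw [← add_assoc, sqrtSeq, sub_right_comm]
    refine sub_mem ih (smul_mem_filt _ (filt_mono ?_ (mul_mem_filt (sqrtSeq_spec hL (n + m)).2
      pdi_mem_filt)))
    push_cast
    omega

/-- The square root of `L`, the limit of the Newton iteration. -/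
noncomputable def sqrt (L : PDO A) : PDO A where
  -- After n steps all coefficients with 2k + wt s > -2n are final; n = 1 - k, or 0 for k ≥ 1,
  -- satisfies this.
  coeff k s := (sqrtSeq L (1 - k).toNat).coeff k s
  bdd := by
    refine ⟨1, fun k hk => funext fun s => ?_⟩
    rw [show (1 - k).toNat = 0 by omega, sqrtSeq, pd, mono_coeff, if_neg (by omega)]
    rfl

theorem sqrt_sub_mem_filt {L : PDO A} (hL : L - pd * pd ∈ filt 2) (n : ℕ) :
    sqrt L - sqrtSeq L n ∈ filt (-2 * n) := by
  intro k s hk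
  have e : (sqrt L).coeff k s = (sqrtSeq L (1 - k).toNat).coeff k s := rfl
  rw [sub_coeff, e]
  have := wt_le_two s
  have := wt_nonneg s
  rcases le_total (1 - k).toNat n with h | h
  · obtain ⟨m, rfl⟩ := Nat.exists_eq_add_of_le h
    have := sqrtSeq_sub_mem_filt hL (1 - k).toNat m k s (by omega)
    rw [sub_coeff] at this
    rw [← neg_sub, this, neg_zero]
  · obtain ⟨m, hm⟩ := Nat.exists_eq_add_of_le h
    rw [hm, ← sub_coeff]
    exact sqrtSeq_sub_mem_filt hL n m k s hk

theorem sqrt_mul_self {L : PDO A} (hL : L - pd * pd ∈ filt 2) : sqrt L * sqrt L = L := by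
  rw [← sub_eq_zero]
  refine eq_zero_of_forall_mem_filt fun d => ?_
  -- Any n with 2 - 2n ≤ d puts all three error terms below into degree d.
  set n := (4 - d).toNat
  have h1 := sqrt_sub_mem_filt hL n
  have h2 := (sqrtSeq_spec hL n).2
  have h4 : sqrtSeq L n ∈ filt 2 := by
    rw [← sub_add_cancel (sqrtSeq L n) pd]
    exact add_mem (filt_mono (by omega) (sqrtSeq_spec hL n).1) pd_mem_filt
  have h3 : sqrt L ∈ filt 2 := by
    rw [← sub_add_cancel (sqrt L) (sqrtSeq L n)]
    exact add_mem (filt_mono (by omega) h1) h4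
  have e : sqrt L * sqrt L - L = (sqrt L - sqrtSeq L n) * sqrt L
      + sqrtSeq L n * (sqrt L - sqrtSeq L n) + (sqrtSeq L n * sqrtSeq L n - L) := by
    noncomm_ring
  rw [e]
  exact add_mem (add_mem (filt_mono (by omega) (mul_mem_filt h1 h3))
    (filt_mono (by omega) (mul_mem_filt h4 h1))) (filt_mono (by omega) h2)

theorem isSqrt_sqrt {L : PDO A} (hL : L - pd * pd ∈ filt 2) : IsSqrt (sqrt L) L := by
  have h0 : sqrt L - pd ∈ filt 0 := by
    have := sqrt_sub_mem_filt hL 0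
    simpa [sqrtSeq] using this
  have hc : ∀ k s, 0 < k → (sqrt L).coeff k s = (pd : PDO A).coeff k s := by
    intro k s hk
    rw [← sub_eq_zero, ← sub_coeff]
    exact h0 k s (by have := wt_nonneg s; omega)
  refine ⟨sqrt_mul_self hL, ?_, fun k hk => ?_⟩
  · funext s
    rw [hc 1 s one_pos, pd, mono_coeff]
    revert s
    exact forall_fin_four (by simp) (by simp) (by simp) (by simp)
  · funext s
    rw [hc k s (by omega), pd, mono_coeff, if_neg (by omega)]
    rfl

end PDO

open PDO

/-! ### Existence and uniqueness of the square root of L_{2m} -/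

section L2m

variable {A : Type u} [SuperFieldAlgebra A]

theorem L2m_sub_mem_filt (U : A) : L2m U - pd * pd ∈ filt 2 := by
  rw [pd_mul_pd, L2m]
  have h : ∀ a b c d e : PDO A, a - b - c + d + e - a = -b - c + d + e := fun a b c d e => by abel
  rw [h]
  refine add_mem (add_mem (sub_mem (neg_mem ?_) ?_) ?_) ?_ <;>
    exact mono_mem_filt _ (by simp [wt])

theorem L2m_coeff_one_three (U : A) : (L2m U).coeff 1 3 = 0 := by
  have := L2m_sub_mem_filt U 1 3 (by simp [wt])
  rw [sub_coeff, pd_mul_pd, mono_coeff] at this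
  simpa using this

theorem existsUnique_isSqrt (U : A) : ∃! R : PDO A, IsSqrt R (L2m U) :=
  ⟨sqrt (L2m U), isSqrt_sqrt (L2m_sub_mem_filt U), fun _ h =>
    h.eq (isSqrt_sqrt (L2m_sub_mem_filt U)) (L2m_coeff_one_three U)⟩

end L2m

end SuperHD

namespace SuperHD

open SuperFieldAlgebra

/-! ### Functoriality -/

/-- A morphism of algebras of super fields, up to a common sign `ε` of the super derivatives. -/
structure SuperHom (A : Type u) (A' : Type v) [SuperFieldAlgebra A] [SuperFieldAlgebra A']
    extends A →+* A' where
  ε : ℤ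
  ε_mul_self : ε * ε = 1
  map_par' : ∀ a, toFun (par a) = par (toFun a)
  map_D' : ∀ i a, toFun (D i a) = ε • D i (toFun a)

namespace SuperHom

variable {A : Type u} {A' : Type v} [SuperFieldAlgebra A] [SuperFieldAlgebra A']

instance : CoeFun (SuperHom A A') fun _ => A → A' := ⟨fun f => f.toRingHom⟩

variable (f : SuperHom A A')

theorem map_par (a : A) : f (par a) = par (f a) := f.map_par' a

theorem map_D (i : Fin 2) (a : A) : f (D i a) = f.ε • D i (f a) := f.map_D' i a

theorem map_dd (a : A) : f (dd a) = dd (f a) := by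
  rw [dd, map_D, map_D, map_zsmul, smul_smul, f.ε_mul_self, one_smul, dd]

theorem map_dd_iterate (j : ℕ) (a : A) : f (dd^[j] a) = dd^[j] (f a) := by
  induction j generalizing a with
  | zero => rfl
  | succ j ih => rw [Function.iterate_succ_apply, ih, map_dd, Function.iterate_succ_apply]

/-- The sign of `E_s`. -/
def sign : Fin 4 → ℤ := ![1, f.ε, f.ε, 1]

theorem sign_zero : f.sign 0 = 1 := rfl

theorem sign_one : f.sign 1 = f.ε := rfl

theorem sign_two : f.sign 2 = f.ε := rfl

theorem sign_three : f.sign 3 = 1 := rfl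

/-- The map on operators as an additive map. -/
def mapAdd : PDO A →+ PDO A' where
  toFun P := ⟨fun k s => f.sign s • f (P.coeff k s), by
    obtain ⟨M, hM⟩ := P.bdd
    exact ⟨M, fun k hk => funext fun s => by rw [hM k hk]; simp⟩⟩
  map_zero' := PDO.ext_coeff fun k s => by simp
  map_add' P Q := PDO.ext_coeff fun k s => by simp

theorem mapAdd_coeff (P : PDO A) (k : ℤ) (s : Fin 4) :
    (f.mapAdd P).coeff k s = f.sign s • f (P.coeff k s) := rfl

theorem mapAdd_mem_filt {P : PDO A} {d : ℤ} (hP : P ∈ PDO.filt d) : f.mapAdd P ∈ PDO.filt d :=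
  fun k s h => by rw [mapAdd_coeff, hP k s h, map_zero, smul_zero]

theorem mapAdd_mono (a : A) (k : ℤ) (s : Fin 4) :
    f.mapAdd (PDO.mono a k s) = f.sign s • PDO.mono (f a) k s := by
  refine PDO.ext_coeff fun m t => ?_
  rw [mapAdd_coeff, PDO.zsmul_coeff, PDO.mono_coeff, PDO.mono_coeff]
  split_ifs with h
  · rw [h.2]
  · simp

theorem mapAdd_fnL (a : A) (P : PDO A) : f.mapAdd (PDO.fnL a P) = PDO.fnL (f a) (f.mapAdd P) :=
  PDO.ext_coeff fun m t => by
    rw [mapAdd_coeff, PDO.fnL_coeff, PDO.fnL_coeff, mapAdd_coeff, map_mul, mul_smul_comm]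

theorem mapAdd_ddL (k : ℤ) (P : PDO A) : f.mapAdd (PDO.ddL k P) = PDO.ddL k (f.mapAdd P) := by
  refine PDO.ext_coeff fun m t => ?_
  obtain ⟨n, hn⟩ := PDO.exists_bound P (m - k)
  rw [mapAdd_coeff, PDO.ddL_coeff_eq_sum k P m t n fun j hj => hn j hj t,
    PDO.ddL_coeff_eq_sum k _ m t n fun j hj => by
      rw [mapAdd_coeff, hn j hj t, map_zero, smul_zero], map_sum, Finset.smul_sum]
  refine Finset.sum_congr rfl fun j _ => ?_
  rw [mapAdd_coeff, dd_iterate_zsmul, ← map_dd_iterate, map_zsmul, smul_comm]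

theorem mapAdd_d1L (P : PDO A) : f.mapAdd (PDO.d1L P) = f.ε • PDO.d1L (f.mapAdd P) := by
  have h := f.ε_mul_self
  refine PDO.ext_coeff fun m => PDO.forall_fin_four ?_ ?_ ?_ ?_ <;>
    simp only [PDO.zsmul_coeff, PDO.d1L_coeff_zero, PDO.d1L_coeff_one, PDO.d1L_coeff_two,
      PDO.d1L_coeff_three, mapAdd_coeff, sign_zero, sign_one, sign_two, sign_three, map_add,
      map_D, map_par, smul_add, smul_smul, map_zsmul, h, one_smul, one_mul]

theorem mapAdd_d2L (P : PDO A) : f.mapAdd (PDO.d2L P) = f.ε • PDO.d2L (f.mapAdd P) := by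
  have h := f.ε_mul_self
  refine PDO.ext_coeff fun m => PDO.forall_fin_four ?_ ?_ ?_ ?_ <;>
    simp only [PDO.zsmul_coeff, PDO.d2L_coeff_zero, PDO.d2L_coeff_one, PDO.d2L_coeff_two,
      PDO.d2L_coeff_three, mapAdd_coeff, sign_zero, sign_one, sign_two, sign_three, map_add,
      map_sub, map_D, map_par, smul_add, smul_sub, smul_smul, map_zsmul, h, one_smul, one_mul]

theorem mapAdd_eL (s : Fin 4) (P : PDO A) :
    f.mapAdd (PDO.eL s P) = f.sign s • PDO.eL s (f.mapAdd P) := by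
  revert s
  refine PDO.forall_fin_four ?_ ?_ ?_ ?_
  · rw [sign_zero, one_smul]; rfl
  · exact f.mapAdd_d1L P
  · exact f.mapAdd_d2L P
  · rw [PDO.eL_three, mapAdd_d1L, mapAdd_d2L, map_zsmul, smul_smul, f.ε_mul_self]; rfl

/-- Monomials on the left suffice once more; on them the map respects each elementary left
composition up to the sign of E_s, which it also puts on the monomial. -/
theorem mapAdd_mul (P Q : PDO A) : f.mapAdd (P * Q) = f.mapAdd P * f.mapAdd Q := by
  obtain ⟨q, hq⟩ := PDO.exists_mem_filt Q
  have : f.mapAdd.comp (PDO.rmul Q) = (PDO.rmul (f.mapAdd Q)).comp f.mapAdd := by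
    refine PDO.addHom_ext (c := q) (fun d P hP => ?_) (fun d P hP => ?_) fun a k s => ?_
    · exact f.mapAdd_mem_filt (PDO.mul_mem_filt hP hq)
    · exact PDO.mul_mem_filt (f.mapAdd_mem_filt hP) (f.mapAdd_mem_filt hq)
    · simp only [AddMonoidHom.comp_apply, PDO.rmul_apply, PDO.mono_mul, mapAdd_fnL, mapAdd_eL,
        mapAdd_ddL, mapAdd_mono, map_zsmul]
  exact DFunLike.congr_fun this P

/-- The ring homomorphism between rings of operators. -/
noncomputable def map : PDO A →+* PDO A' where
  __ := f.mapAdd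
  map_one' := by
    change f.mapAdd (PDO.mono 1 0 0) = PDO.mono 1 0 0
    rw [mapAdd_mono, sign_zero, one_smul, map_one]
  map_mul' := f.mapAdd_mul

theorem map_coeff (P : PDO A) (k : ℤ) (s : Fin 4) :
    (f.map P).coeff k s = f.sign s • f (P.coeff k s) := rfl

theorem map_mono (a : A) (k : ℤ) (s : Fin 4) :
    f.map (PDO.mono a k s) = f.sign s • PDO.mono (f a) k s := f.mapAdd_mono a k s

theorem map_fn (a : A) : f.map (PDO.fn a) = PDO.fn (f a) := by
  rw [PDO.fn, map_mono, sign_zero, one_smul]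
  rfl

theorem map_Dop (i : Fin 2) : f.map (PDO.Dop i) = f.ε • PDO.Dop i := by
  fin_cases i
  · exact (f.map_mono 1 0 1).trans (by rw [map_one]; rfl)
  · exact (f.map_mono 1 0 2).trans (by rw [map_one]; rfl)

theorem map_pd : f.map PDO.pd = PDO.pd := by
  rw [PDO.pd, map_mono, sign_zero, one_smul, map_one]
  rfl

theorem map_mem_filt {P : PDO A} {d : ℤ} (hP : P ∈ PDO.filt d) : f.map P ∈ PDO.filt d :=
  f.mapAdd_mem_filt hP

/-- Combined with uniqueness this makes the root natural: it is fixed by the parity and is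
compatible with evaluation of a universal field. -/
theorem map_isSqrt {R L : PDO A} (h : PDO.IsSqrt R L) : PDO.IsSqrt (f.map R) (f.map L) := by
  obtain ⟨h1, h2, h3⟩ := h
  refine ⟨by rw [← map_mul, h1], ?_, fun k hk => ?_⟩
  · funext s
    rw [map_coeff, h2]
    revert s
    exact PDO.forall_fin_four (by simp [sign]) (by simp) (by simp) (by simp)
  · funext s
    rw [map_coeff, h3 k hk]
    simp

theorem map_geOne (P : PDO A) : f.map (PDO.geOne P) = PDO.geOne (f.map P) := by
  refine PDO.ext_coeff fun k s => ?_
  simp only [map_coeff, PDO.geOne]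
  split_ifs <;> simp

end SuperHom

/-! ### The parity automorphism of the ring of operators -/

section Parity

variable {A : Type u} [SuperFieldAlgebra A]

/-- The parity automorphism reverses the sign of the super derivatives. -/
def parSuperHom : SuperHom A A where
  toRingHom := σ
  ε := -1
  ε_mul_self := by norm_num
  map_par' _ := rfl
  map_D' i a := by
    rw [neg_smul, one_smul]
    exact par_D i a

/-- The parity automorphism of the ring of operators. -/
noncomputable def opPar : PDO A →+* PDO A := parSuperHom.map

theorem opPar_coeff (P : PDO A) (k : ℤ) (s : Fin 4) :
    (opPar P).coeff k s = (![1, -1, -1, 1] s : ℤ) • par (P.coeff k s) := rfl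

theorem opPar_mono (a : A) (k : ℤ) (s : Fin 4) :
    opPar (PDO.mono a k s) = (![1, -1, -1, 1] s : ℤ) • PDO.mono (par a) k s :=
  parSuperHom.map_mono a k s

theorem opPar_opPar (P : PDO A) : opPar (opPar P) = P := by
  refine PDO.ext_coeff fun k => PDO.forall_fin_four ?_ ?_ ?_ ?_ <;>
    simp [opPar_coeff, par_par]

theorem opPar_Dop (i : Fin 2) : opPar (PDO.Dop i : PDO A) = -PDO.Dop i := by
  rw [opPar, SuperHom.map_Dop]
  change (-1 : ℤ) • _ = _
  simp

theorem opPar_fn (a : A) : opPar (PDO.fn a) = PDO.fn (par a) := parSuperHom.map_fn a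

theorem opPar_mem_filt {P : PDO A} {d : ℤ} (hP : P ∈ PDO.filt d) : opPar P ∈ PDO.filt d :=
  parSuperHom.map_mem_filt hP

end Parity

namespace PDO

variable {A : Type u} [SuperFieldAlgebra A]

/-! ### The formal adjoint -/

/-- The invertible operator `-∂`. -/
noncomputable def negPd : (PDO A)ˣ where
  val := -pd
  inv := -pdi
  val_inv := by rw [neg_mul_neg, pd_mul_pdi]
  inv_val := by rw [neg_mul_neg, pdi_mul_pd]

theorem negPd_zpow_succ (k : ℤ) :
    ((negPd ^ (k + 1) : (PDO A)ˣ) : PDO A) = -((negPd ^ k : (PDO A)ˣ) : PDO A) * pd := by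
  rw [zpow_add_one, Units.val_mul, neg_mul, ← mul_neg]
  rfl

theorem negPd_zpow_mem_filt (k : ℤ) : ((negPd ^ k : (PDO A)ˣ) : PDO A) ∈ filt (2 * k) := by
  induction k with
  | zero => exact mono_mem_filt 1 (by simp [wt])
  | succ k ih =>
    rw [zpow_add_one, Units.val_mul]
    exact filt_mono (by omega) (mul_mem_filt ih (neg_mem pd_mem_filt))
  | pred k ih =>
    rw [zpow_sub_one, Units.val_mul]
    exact filt_mono (by omega) (mul_mem_filt ih (neg_mem pdi_mem_filt))

/-- The adjoint of the monomial `a E_s ∂^k`. -/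
noncomputable def adjMono (k : ℤ) (s : Fin 4) (a : A) : PDO A :=
  ((negPd ^ k : (PDO A)ˣ) : PDO A) *
    -- For homogeneous a one has (aDᵢ)* = (-1)^{|a|} Dᵢ* a = -Dᵢ par(a), while (D₁D₂)* = -D₂*D₁* =
    -- D₁D₂.
    (![fn a, -(Dop 0 * fn (par a)), -(Dop 1 * fn (par a)), Dop 0 * Dop 1 * fn a] s)

theorem adjMono_zero_right (k : ℤ) (s : Fin 4) : adjMono k s (0 : A) = 0 := by
  revert s
  refine forall_fin_four ?_ ?_ ?_ ?_ <;> simp [adjMono, fn_zero]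

theorem adjMono_add (k : ℤ) (s : Fin 4) (a b : A) :
    adjMono k s (a + b) = adjMono k s a + adjMono k s b := by
  revert s
  refine forall_fin_four ?_ ?_ ?_ ?_ <;> simp only [adjMono, Matrix.cons_val, par_add, fn_add] <;>
    noncomm_ring

theorem adjMono_mem_filt (k : ℤ) (s : Fin 4) (a : A) : adjMono k s a ∈ filt (2 * k + wt s) := by
  refine mul_mem_filt (negPd_zpow_mem_filt k) ?_
  revert s
  refine forall_fin_four ?_ ?_ ?_ ?_ <;> simp only [wt, Matrix.cons_val]
  · exact fn_mem_filt a le_rfl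
  · exact neg_mem (mul_mem_filt (Dop_mem_filt 0) (fn_mem_filt _ le_rfl))
  · exact neg_mem (mul_mem_filt (Dop_mem_filt 1) (fn_mem_filt _ le_rfl))
  · exact mul_mem_filt (mul_mem_filt (Dop_mem_filt 0) (Dop_mem_filt 1)) (fn_mem_filt _ le_rfl)

/-- The adjoint of the part of `P` with `∂^k`. -/
noncomputable def adjTerm (P : PDO A) (k : ℤ) : PDO A := ∑ t, adjMono k t (P.coeff k t)

theorem adjTerm_coeff_eq_zero {P : PDO A} {p m k : ℤ} {s : Fin 4} (hP : P ∈ filt p)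
    (hk : k ∉ Finset.Icc (m - 1) (p / 2 + 1)) : (adjTerm P k).coeff m s = 0 := by
  rw [adjTerm, sum_coeff]
  refine Finset.sum_eq_zero fun t _ => ?_
  have := wt_nonneg s
  have := wt_le_two t
  have := wt_nonneg t
  rw [Finset.mem_Icc, not_and_or] at hk
  rcases hk with h | h
  · exact adjMono_mem_filt k t _ m s (by omega)
  · rw [hP k t (by omega), adjMono_zero_right]
    rfl

theorem adjTerm_mem_filt {P : PDO A} {p : ℤ} (hP : P ∈ filt p) (k : ℤ) :
    adjTerm P k ∈ filt p := by
  refine sum_mem fun t _ => ?_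
  by_cases h : p < 2 * k + wt t
  · rw [hP k t h, adjMono_zero_right]
    exact zero_mem _
  · exact filt_mono (by omega) (adjMono_mem_filt k t _)

theorem finsum_adjTerm {P : PDO A} {p m : ℤ} {s : Fin 4} (hP : P ∈ filt p) :
    ∑ᶠ k, (adjTerm P k).coeff m s =
      ∑ k ∈ Finset.Icc (m - 1) (p / 2 + 1), (adjTerm P k).coeff m s := by
  refine finsum_eq_sum_of_support_subset _ fun k hk => ?_
  by_contra hn
  exact hk (adjTerm_coeff_eq_zero hP hn)

/-- The formal adjoint, with `Dᵢ* = -Dᵢ` and `(PQ)* = ± Q* P*`, the sign being negative when `P`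
and `Q` are both odd. -/
noncomputable def adj : PDO A →+ PDO A where
  toFun P := ⟨fun m s => ∑ᶠ k, (adjTerm P k).coeff m s, by
    obtain ⟨p, hp⟩ := exists_mem_filt P
    refine ⟨max p 0, fun m hm => funext fun s => ?_⟩
    rw [finsum_adjTerm hp]
    exact Finset.sum_eq_zero fun k _ =>
      adjTerm_mem_filt hp k m s (by have := wt_nonneg s; omega)⟩
  map_zero' := ext_coeff fun m s => by
    simp [adjTerm, adjMono_zero_right]
  map_add' P Q := ext_coeff fun m s => by
    obtain ⟨p, hp⟩ := exists_mem_filt P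
    obtain ⟨q, hq⟩ := exists_mem_filt Q
    have h := filt_mono (A := A) (le_max_left p q) hp
    have h' := filt_mono (A := A) (le_max_right p q) hq
    rw [add_coeff]
    simp only
    rw [finsum_adjTerm h, finsum_adjTerm h', finsum_adjTerm (add_mem h h'),
      ← Finset.sum_add_distrib]
    simp only [adjTerm, add_coeff, adjMono_add, Finset.sum_add_distrib]

theorem adj_coeff (P : PDO A) (m : ℤ) (s : Fin 4) :
    (adj P).coeff m s = ∑ᶠ k, (adjTerm P k).coeff m s := rfl

theorem adj_mem_filt {P : PDO A} {p : ℤ} (hP : P ∈ filt p) : adj P ∈ filt p := by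
  intro m s h
  rw [adj_coeff, finsum_adjTerm hP]
  exact Finset.sum_eq_zero fun k _ => adjTerm_mem_filt hP k m s h

theorem adj_mono (a : A) (k : ℤ) (s : Fin 4) : adj (mono a k s) = adjMono k s a := by
  refine ext_coeff fun m t => ?_
  rw [adj_coeff, finsum_eq_single _ k]
  · rw [adjTerm, Finset.sum_eq_single s]
    · simp [mono_coeff]
    · intro r _ hr
      simp [mono_coeff, hr, adjMono_zero_right]
    · simp
  · intro l hl
    simp [adjTerm, mono_coeff, hl, adjMono_zero_right]

theorem adj_mono_zero (a : A) (k : ℤ) :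
    adj (mono a k 0) = ((negPd ^ k : (PDO A)ˣ) : PDO A) * fn a := adj_mono a k 0

theorem adj_mono_one (a : A) (k : ℤ) :
    adj (mono a k 1) = ((negPd ^ k : (PDO A)ˣ) : PDO A) * -(Dop 0 * fn (par a)) := adj_mono a k 1

theorem adj_mono_two (a : A) (k : ℤ) :
    adj (mono a k 2) = ((negPd ^ k : (PDO A)ˣ) : PDO A) * -(Dop 1 * fn (par a)) := adj_mono a k 2

theorem adj_mono_three (a : A) (k : ℤ) :
    adj (mono a k 3) = ((negPd ^ k : (PDO A)ˣ) : PDO A) * (Dop 0 * Dop 1 * fn a) := adj_mono a k 3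

theorem opPar_mono_zero (a : A) (k : ℤ) : opPar (mono a k 0) = mono (par a) k 0 := by
  rw [opPar_mono]; exact one_smul ℤ _

theorem opPar_mono_one (a : A) (k : ℤ) : opPar (mono a k 1) = -mono (par a) k 1 := by
  rw [opPar_mono]; exact neg_one_smul ℤ _

theorem opPar_mono_two (a : A) (k : ℤ) : opPar (mono a k 2) = -mono (par a) k 2 := by
  rw [opPar_mono]; exact neg_one_smul ℤ _

theorem opPar_mono_three (a : A) (k : ℤ) : opPar (mono a k 3) = mono (par a) k 3 := by
  rw [opPar_mono]; exact one_smul ℤ _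

/-- The graded rule gives (DP)* = (-1)^{|P|} P* D* with D* = -D; `opPar` carries the sign for `P`
without definite parity. On each kind of monomial the claim is a normal ordering computation. -/
theorem adj_Dop_zero_mul (P : PDO A) : adj (Dop 0 * P) = -(adj (opPar P) * Dop 0) := by
  have : adj.comp (d1L (A := A)) = -((rmul (Dop 0)).comp (adj.comp opPar.toAddMonoidHom)) := by
    refine addHom_ext (c := 1) (fun d P hP => ?_) (fun d P hP => ?_) fun b k => ?_
    · exact adj_mem_filt (d1L_mem_filt hP)
    · exact neg_mem (mul_mem_filt (adj_mem_filt (opPar_mem_filt hP)) (Dop_mem_filt 0))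
    · refine forall_fin_four ?_ ?_ ?_ ?_ <;>
        simp only [AddMonoidHom.comp_apply, AddMonoidHom.neg_apply, rmul_apply,
          RingHom.toAddMonoidHom_eq_coe, AddMonoidHom.coe_coe]
      · simp only [d1L_mono_zero, opPar_mono_zero, map_add, map_sub, map_neg, adj_mono_zero,
          adj_mono_one, adj_mono_two, adj_mono_three, negPd_zpow_succ]
        simp only [par_par, mul_assoc, Dop_mul_fn, Dop_mul_fn_mul, Dop_mul_Dop_mul, Dop_mul_self,
            Dop_one_mul_Dop_zero_mul, Dop_one_mul_Dop_zero, pd_mul_fn, pd_mul_fn_mul, pd_mul_Dop_mul,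
            pd_mul_Dop, D_D_same, D_one_D_zero, D_par, fn_neg, map_neg, par_neg, neg_mul, mul_neg, mul_add, add_mul, dd_D, dd_par]
        abel
      · simp only [d1L_mono_one, opPar_mono_one, map_add, map_sub, map_neg, adj_mono_zero,
          adj_mono_one, adj_mono_two, adj_mono_three, negPd_zpow_succ]
        simp only [par_par, mul_assoc, Dop_mul_fn, Dop_mul_fn_mul, Dop_mul_Dop_mul, Dop_mul_self,
            Dop_one_mul_Dop_zero_mul, Dop_one_mul_Dop_zero, pd_mul_fn, pd_mul_fn_mul, pd_mul_Dop_mul,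
            pd_mul_Dop, D_D_same, D_one_D_zero, D_par, fn_neg, map_neg, par_neg, neg_mul, mul_neg, mul_add, add_mul, dd_D, dd_par]
        abel
      · simp only [d1L_mono_two, opPar_mono_two, map_add, map_sub, map_neg, adj_mono_zero,
          adj_mono_one, adj_mono_two, adj_mono_three, negPd_zpow_succ]
        simp only [par_par, mul_assoc, Dop_mul_fn, Dop_mul_fn_mul, Dop_mul_Dop_mul, Dop_mul_self,
            Dop_one_mul_Dop_zero_mul, Dop_one_mul_Dop_zero, pd_mul_fn, pd_mul_fn_mul, pd_mul_Dop_mul,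
            pd_mul_Dop, D_D_same, D_one_D_zero, D_par, fn_neg, map_neg, par_neg, neg_mul, mul_neg, mul_add, add_mul, dd_D, dd_par]
        abel
      · simp only [d1L_mono_three, opPar_mono_three, map_add, map_sub, map_neg, adj_mono_zero,
          adj_mono_one, adj_mono_two, adj_mono_three, negPd_zpow_succ]
        simp only [par_par, mul_assoc, Dop_mul_fn, Dop_mul_fn_mul, Dop_mul_Dop_mul, Dop_mul_self,
            Dop_one_mul_Dop_zero_mul, Dop_one_mul_Dop_zero, pd_mul_fn, pd_mul_fn_mul, pd_mul_Dop_mul,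
            pd_mul_Dop, D_D_same, D_one_D_zero, D_par, fn_neg, map_neg, par_neg, neg_mul, mul_neg, mul_add, add_mul, dd_D, dd_par]
        abel
  rw [Dop_zero_mul]
  exact DFunLike.congr_fun this P

theorem adj_Dop_one_mul (P : PDO A) : adj (Dop 1 * P) = -(adj (opPar P) * Dop 1) := by
  have : adj.comp (d2L (A := A)) = -((rmul (Dop 1)).comp (adj.comp opPar.toAddMonoidHom)) := by
    refine addHom_ext (c := 1) (fun d P hP => ?_) (fun d P hP => ?_) fun b k => ?_
    · exact adj_mem_filt (d2L_mem_filt hP)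
    · exact neg_mem (mul_mem_filt (adj_mem_filt (opPar_mem_filt hP)) (Dop_mem_filt 1))
    · refine forall_fin_four ?_ ?_ ?_ ?_ <;>
        simp only [AddMonoidHom.comp_apply, AddMonoidHom.neg_apply, rmul_apply,
          RingHom.toAddMonoidHom_eq_coe, AddMonoidHom.coe_coe]
      · simp only [d2L_mono_zero, opPar_mono_zero, map_add, map_sub, map_neg, adj_mono_zero,
          adj_mono_one, adj_mono_two, adj_mono_three, negPd_zpow_succ]
        simp only [par_par, mul_assoc, Dop_mul_fn, Dop_mul_fn_mul, Dop_mul_Dop_mul, Dop_mul_self,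
            Dop_one_mul_Dop_zero_mul, Dop_one_mul_Dop_zero, pd_mul_fn, pd_mul_fn_mul, pd_mul_Dop_mul,
            pd_mul_Dop, D_D_same, D_one_D_zero, D_par, fn_neg, map_neg, par_neg, neg_mul, mul_neg, mul_add, add_mul, dd_D, dd_par]
        abel
      · simp only [d2L_mono_one, opPar_mono_one, map_add, map_sub, map_neg, adj_mono_zero,
          adj_mono_one, adj_mono_two, adj_mono_three, negPd_zpow_succ]
        simp only [par_par, mul_assoc, Dop_mul_fn, Dop_mul_fn_mul, Dop_mul_Dop_mul, Dop_mul_self,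
            Dop_one_mul_Dop_zero_mul, Dop_one_mul_Dop_zero, pd_mul_fn, pd_mul_fn_mul, pd_mul_Dop_mul,
            pd_mul_Dop, D_D_same, D_one_D_zero, D_par, fn_neg, map_neg, par_neg, neg_mul, mul_neg, mul_add, add_mul, dd_D, dd_par]
        abel
      · simp only [d2L_mono_two, opPar_mono_two, map_add, map_sub, map_neg, adj_mono_zero,
          adj_mono_one, adj_mono_two, adj_mono_three, negPd_zpow_succ]
        simp only [par_par, mul_assoc, Dop_mul_fn, Dop_mul_fn_mul, Dop_mul_Dop_mul, Dop_mul_self,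
            Dop_one_mul_Dop_zero_mul, Dop_one_mul_Dop_zero, pd_mul_fn, pd_mul_fn_mul, pd_mul_Dop_mul,
            pd_mul_Dop, D_D_same, D_one_D_zero, D_par, fn_neg, map_neg, par_neg, neg_mul, mul_neg, mul_add, add_mul, dd_D, dd_par]
        abel
      · simp only [d2L_mono_three, opPar_mono_three, map_add, map_sub, map_neg, adj_mono_zero,
          adj_mono_one, adj_mono_two, adj_mono_three, negPd_zpow_succ]
        simp only [par_par, mul_assoc, Dop_mul_fn, Dop_mul_fn_mul, Dop_mul_Dop_mul, Dop_mul_self,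
            Dop_one_mul_Dop_zero_mul, Dop_one_mul_Dop_zero, pd_mul_fn, pd_mul_fn_mul, pd_mul_Dop_mul,
            pd_mul_Dop, D_D_same, D_one_D_zero, D_par, fn_neg, map_neg, par_neg, neg_mul, mul_neg, mul_add, add_mul, dd_D, dd_par]
        abel
  rw [Dop_one_mul]
  exact DFunLike.congr_fun this P

end PDO

end SuperHD

namespace SuperHD

open SuperFieldAlgebra

/-! ### Supercommutation with elements of mixed parity -/

section Parity

variable {A : Type u} [SuperFieldAlgebra A]

theorem even_half_add_par (b : A) :
    par ((1 / 2 : ℚ) • (b + par b)) = (1 / 2 : ℚ) • (b + par b) := by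
  rw [par_smul, par_add, par_par, add_comm]

theorem odd_half_sub_par (b : A) :
    par ((1 / 2 : ℚ) • (b - par b)) = -((1 / 2 : ℚ) • (b - par b)) := by
  rw [par_smul, par_sub, par_par, ← smul_neg, neg_sub]

theorem half_add_par_add_half_sub_par (b : A) :
    (1 / 2 : ℚ) • (b + par b) + (1 / 2 : ℚ) • (b - par b) = b := by
  rw [← smul_add, add_add_sub_cancel, ← two_smul ℚ, smul_smul]
  norm_num

theorem even_comm {a : A} (ha : par a = a) (b : A) : a * b = b * a := even_mul_comm a b ha

/-- Splitting b into its even and odd halves gives the sign of each half, and `par b` collects the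
two signs. -/
theorem odd_mul {a : A} (ha : par a = -a) (b : A) : a * b = par b * a := by
  rw [← half_add_par_add_half_sub_par b, mul_add, par_add, add_mul, even_half_add_par,
    odd_half_sub_par, neg_mul, ← even_comm (even_half_add_par b) a,
    odd_mul_odd a _ ha (odd_half_sub_par b)]

end Parity

/-! ### Antimultiplicativity of the adjoint on even operators -/

namespace PDO

variable {A : Type u} [SuperFieldAlgebra A]

theorem adj_fn_mul_of_even {a : A} (ha : par a = a) (P : PDO A) :
    adj (fn a * P) = adj P * fn a := by
  have : adj.comp (fnL a) = (rmul (fn a)).comp adj := by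
    refine addHom_ext (c := 0) (fun d P hP => ?_) (fun d P hP => ?_) fun b k => ?_
    · rw [add_zero]; exact adj_mem_filt (fnL_mem_filt a hP)
    · exact mul_mem_filt (adj_mem_filt hP) (fn_mem_filt a le_rfl)
    · refine forall_fin_four ?_ ?_ ?_ ?_ <;>
        simp only [AddMonoidHom.comp_apply, rmul_apply, fnL_mono, adj_mono_zero, adj_mono_one,
          adj_mono_two, adj_mono_three, par_mul, ha, even_comm ha, ← fn_mul_fn, mul_assoc, mul_neg,
          neg_mul]
  rw [fn_mul]
  exact DFunLike.congr_fun this P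

theorem adj_fn_mul_of_odd {a : A} (ha : par a = -a) (P : PDO A) :
    adj (fn a * P) = adj (opPar P) * fn a := by
  have : adj.comp (fnL a) = (rmul (fn a)).comp (adj.comp opPar.toAddMonoidHom) := by
    refine addHom_ext (c := 0) (fun d P hP => ?_) (fun d P hP => ?_) fun b k => ?_
    · rw [add_zero]; exact adj_mem_filt (fnL_mem_filt a hP)
    · exact mul_mem_filt (adj_mem_filt (opPar_mem_filt hP)) (fn_mem_filt a le_rfl)
    · refine forall_fin_four ?_ ?_ ?_ ?_ <;>
        simp only [AddMonoidHom.comp_apply, rmul_apply, RingHom.toAddMonoidHom_eq_coe,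
          AddMonoidHom.coe_coe, fnL_mono, opPar_mono_zero, opPar_mono_one, opPar_mono_two,
          opPar_mono_three, map_neg, adj_mono_zero, adj_mono_one,
          adj_mono_two, adj_mono_three, par_mul, ha, odd_mul ha, par_par, neg_mul, fn_neg,
          ← fn_mul_fn, mul_assoc, mul_neg, neg_neg]
  rw [fn_mul]
  exact DFunLike.congr_fun this P

theorem adj_pd_mul (P : PDO A) : adj (pd * P) = -(adj P * pd) := by
  rw [← Dop_mul_self 0, mul_assoc, adj_Dop_zero_mul, map_mul, opPar_Dop, neg_mul, map_neg,
    adj_Dop_zero_mul, opPar_opPar, neg_neg, mul_assoc]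

theorem adj_ddL (k : ℤ) (P : PDO A) :
    adj (ddL k P) = adj P * ((negPd ^ k : (PDO A)ˣ) : PDO A) := by
  induction k with
  | zero => rw [ddL_zero, zpow_zero, Units.val_one, mul_one]
  | succ k ih =>
    rw [← ddL_one_ddL, ← pd_mul, adj_pd_mul, ih, negPd_zpow_succ, neg_mul, mul_neg, mul_assoc]
  | pred k ih =>
    have h : adj (ddL (-k) P) = adj (ddL (-k - 1) P) * (negPd : (PDO A)ˣ) := by
      have := adj_pd_mul (ddL (-k - 1) P)
      rw [pd_mul, ddL_one_ddL, sub_add_cancel] at this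
      rw [this, ← mul_neg]
      rfl
    rw [zpow_sub_one, Units.val_mul, ← mul_assoc, ← ih, h, Units.mul_inv_cancel_right]

theorem adj_mono_mul {a : A} {k : ℤ} (s : Fin 4) (h : opPar (mono a k s) = mono a k s)
    (P : PDO A) : adj (mono a k s * P) = adj P * adj (mono a k s) := by
  -- An even monomial has a coefficient of the same parity as E_s; this decides which of the two
  -- rules for super fields applies.
  have hc := congrArg (fun X : PDO A => X.coeff k s) h
  simp only [opPar_coeff, mono_coeff, and_self, if_true] at hc
  rw [mono_mul, ← fn_mul]
  revert s
  refine forall_fin_four ?_ ?_ ?_ ?_ <;> intro _ hc <;>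
    simp only [Matrix.cons_val, one_smul, neg_smul] at hc
  · rw [adj_fn_mul_of_even hc, eL_zero, adj_ddL, adj_mono_zero, mul_assoc]
  · rw [neg_eq_iff_eq_neg] at hc
    rw [adj_fn_mul_of_odd hc, eL_one, ← Dop_zero_mul, map_mul, opPar_Dop, neg_mul, map_neg,
      adj_Dop_zero_mul, opPar_opPar, adj_ddL, adj_mono_one, hc, fn_neg]
    simp only [neg_neg, mul_neg, mul_assoc]
  · rw [neg_eq_iff_eq_neg] at hc
    rw [adj_fn_mul_of_odd hc, eL_two, ← Dop_one_mul, map_mul, opPar_Dop, neg_mul, map_neg,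
      adj_Dop_one_mul, opPar_opPar, adj_ddL, adj_mono_two, hc, fn_neg]
    simp only [neg_neg, mul_neg, mul_assoc]
  · rw [adj_fn_mul_of_even hc, eL_three, ← Dop_zero_mul, ← Dop_one_mul, adj_Dop_zero_mul, map_mul,
      opPar_Dop, neg_mul (Dop 1), map_neg, adj_Dop_one_mul, opPar_opPar, adj_ddL, adj_mono_three]
    simp only [neg_neg, mul_neg, mul_assoc, neg_mul, Dop_one_mul_Dop_zero_mul]

/-- The even part of an operator. -/
noncomputable def evenPart : PDO A →+ PDO A where
  toFun P := (1 / 2 : ℚ) • (P + opPar P)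
  map_zero' := by simp
  map_add' P Q := by rw [map_add, ← smul_add]; congr 1; abel

theorem evenPart_apply (P : PDO A) : evenPart P = (1 / 2 : ℚ) • (P + opPar P) := rfl

theorem evenPart_eq_self {P : PDO A} (h : opPar P = P) : evenPart P = P := by
  rw [evenPart_apply, h, ← two_smul ℚ, smul_smul]
  norm_num

theorem opPar_evenPart (P : PDO A) : opPar (evenPart P) = evenPart P := by
  rw [evenPart_apply, map_rat_smul opPar, map_add, opPar_opPar, add_comm]

theorem evenPart_mem_filt {P : PDO A} {d : ℤ} (hP : P ∈ filt d) : evenPart P ∈ filt d :=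
  smul_mem_filt _ (add_mem hP (opPar_mem_filt hP))

theorem exists_evenPart_mono (a : A) (k : ℤ) (s : Fin 4) :
    ∃ b, evenPart (mono a k s) = mono b k s := by
  refine ⟨(1 / 2 : ℚ) • (a + (![1, -1, -1, 1] s : ℤ) • par a), ?_⟩
  rw [evenPart_apply, opPar_mono, mono_smul, mono_add, mono_zsmul]

/-- For even `P` the graded product rule has no sign. To reduce to monomials, the rule is extended
to all `P` through the even part, which sends monomials to even monomials. -/
theorem adj_mul {P : PDO A} (h : opPar P = P) (Q : PDO A) : adj (P * Q) = adj Q * adj P := by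
  obtain ⟨q, hq⟩ := exists_mem_filt Q
  have : adj.comp ((rmul Q).comp evenPart) = (lmul (adj Q)).comp (adj.comp evenPart) := by
    refine addHom_ext (c := q) (fun d P hP => ?_) (fun d P hP => ?_) fun b k s => ?_
    · exact adj_mem_filt (mul_mem_filt (evenPart_mem_filt hP) hq)
    · exact filt_mono (by omega)
        (mul_mem_filt (adj_mem_filt hq) (adj_mem_filt (evenPart_mem_filt hP)))
    · simp only [AddMonoidHom.comp_apply, rmul_apply, lmul_apply]
      obtain ⟨c, hc⟩ := exists_evenPart_mono b k s
      rw [hc]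
      exact adj_mono_mul s (by rw [← hc, opPar_evenPart]) Q
  have := DFunLike.congr_fun this P
  simpa only [AddMonoidHom.comp_apply, rmul_apply, lmul_apply, evenPart_eq_self h] using this

theorem adj_fn (a : A) : adj (fn a) = fn a := by
  rw [fn, adj_mono_zero, zpow_zero, Units.val_one, one_mul]
  rfl

theorem adj_one : adj (1 : PDO A) = 1 := adj_fn 1

theorem adj_pow {P : PDO A} (h : opPar P = P) (n : ℕ) : adj (P ^ n) = adj P ^ n := by
  induction n with
  | zero => rw [pow_zero, pow_zero, adj_one]
  | succ n ih => rw [pow_succ', adj_mul h, ih, pow_succ]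

/-! ### Differential operators -/

/-- The operators without negative powers of `∂`. -/
def IsDiff (P : PDO A) : Prop := ∀ k < 0, ∀ s, P.coeff k s = 0

theorem IsDiff.add {P Q : PDO A} (hP : IsDiff P) (hQ : IsDiff Q) : IsDiff (P + Q) :=
  fun k hk s => by rw [add_coeff, hP k hk, hQ k hk, add_zero]

theorem IsDiff.sub {P Q : PDO A} (hP : IsDiff P) (hQ : IsDiff Q) : IsDiff (P - Q) :=
  fun k hk s => by rw [sub_coeff, hP k hk, hQ k hk, sub_zero]

theorem IsDiff.neg {P : PDO A} (hP : IsDiff P) : IsDiff (-P) :=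
  fun k hk s => by rw [neg_coeff, hP k hk, neg_zero]

theorem IsDiff.smul (c : ℚ) {P : PDO A} (hP : IsDiff P) : IsDiff (c • P) :=
  fun k hk s => by rw [smul_coeff, hP k hk, smul_zero]

theorem isDiff_mono (a : A) {k : ℤ} (hk : 0 ≤ k) (s : Fin 4) : IsDiff (mono a k s) :=
  fun m hm t => by rw [mono_coeff, if_neg (by omega)]

theorem isDiff_fn (a : A) : IsDiff (fn a) := isDiff_mono a le_rfl 0

theorem isDiff_pd : IsDiff (pd : PDO A) := isDiff_mono 1 zero_le_one 0

theorem isDiff_Dop (i : Fin 2) : IsDiff (Dop i : PDO A) := by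
  fin_cases i
  · exact isDiff_mono 1 le_rfl 1
  · exact isDiff_mono 1 le_rfl 2

theorem isDiff_geOne (P : PDO A) : IsDiff (geOne P) := fun _ hk _ => if_pos (Or.inl hk)

theorem geOne_coeff_zero_zero (P : PDO A) : (geOne P).coeff 0 0 = 0 := by
  simp [geOne]

theorem IsDiff.d1L {P : PDO A} (hP : IsDiff P) : IsDiff (d1L P) := by
  intro k hk
  refine forall_fin_four ?_ ?_ ?_ ?_ <;>
    simp [d1L_coeff_zero, d1L_coeff_one, d1L_coeff_two, d1L_coeff_three, hP k hk,
      hP (k - 1) (by omega)]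

theorem IsDiff.d2L {P : PDO A} (hP : IsDiff P) : IsDiff (d2L P) := by
  intro k hk
  refine forall_fin_four ?_ ?_ ?_ ?_ <;>
    simp [d2L_coeff_zero, d2L_coeff_one, d2L_coeff_two, d2L_coeff_three, hP k hk,
      hP (k - 1) (by omega)]

theorem IsDiff.eL {P : PDO A} (hP : IsDiff P) : ∀ s, IsDiff (eL s P) :=
  forall_fin_four hP hP.d1L hP.d2L hP.d2L.d1L

theorem IsDiff.ddL {P : PDO A} (hP : IsDiff P) (n : ℕ) : IsDiff (ddL n P) := by
  induction n with
  | zero => rw [Nat.cast_zero, ddL_zero]; exact hP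
  | succ n ih =>
    intro k hk s
    rw [Nat.cast_succ, ← ddL_one_ddL, ddL_one_coeff, ih k hk, ih (k - 1) (by omega), dd_zero,
      add_zero]

theorem IsDiff.mul {P Q : PDO A} (hP : IsDiff P) (hQ : IsDiff Q) : IsDiff (P * Q) := by
  intro m hm s
  rw [mul_coeff]
  refine finsum_eq_zero_of_forall_eq_zero fun k => ?_
  rw [mulTerm, sum_coeff]
  refine Finset.sum_eq_zero fun t _ => ?_
  rw [fnL_coeff]
  rcases lt_or_ge k 0 with hk | hk
  · rw [hP k hk, zero_mul]
  · lift k to ℕ using hk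
    rw [(hQ.ddL k).eL t m hm, mul_zero]

/-- Differential operators without zeroth order term form a left ideal. -/
theorem IsDiff.mul_coeff_zero_zero {P Q : PDO A} (hP : IsDiff P) (hQ : IsDiff Q)
    (h0 : Q.coeff 0 0 = 0) : (P * Q).coeff 0 0 = 0 := by
  have hd : ∀ n : ℕ, (PDO.ddL n Q).coeff 0 0 = 0 := by
    intro n
    induction n with
    | zero => rw [Nat.cast_zero, ddL_zero, h0]
    | succ n ih =>
      rw [Nat.cast_succ, ← ddL_one_ddL, ddL_one_coeff, ih, dd_zero, zero_add,
        hQ.ddL n _ (by omega)]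
  have h1 : ∀ X : PDO A, IsDiff X → X.coeff 0 0 = 0 → (PDO.d1L X).coeff 0 0 = 0 :=
    fun X hX h => by rw [d1L_coeff_zero, h, hX _ (by omega), map_zero, par_zero, add_zero]
  have h2 : ∀ X : PDO A, IsDiff X → X.coeff 0 0 = 0 → (PDO.d2L X).coeff 0 0 = 0 :=
    fun X hX h => by rw [d2L_coeff_zero, h, hX _ (by omega), map_zero, par_zero, add_zero]
  rw [mul_coeff]
  refine finsum_eq_zero_of_forall_eq_zero fun k => ?_
  rw [mulTerm, sum_coeff]
  refine Finset.sum_eq_zero fun t ht => ?_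
  clear ht
  rw [fnL_coeff]
  rcases lt_or_ge k 0 with hk | hk
  · rw [hP k hk, zero_mul]
  · lift k to ℕ using hk
    have hX := hQ.ddL k
    have h := hd k
    suffices (PDO.eL t (PDO.ddL k Q)).coeff 0 0 = 0 by rw [this, mul_zero]
    revert t
    exact forall_fin_four h (h1 _ hX h) (h2 _ hX h) (h1 _ hX.d2L (h2 _ hX h))

theorem isDiff_negPd_pow (n : ℕ) : IsDiff ((negPd ^ (n : ℤ) : (PDO A)ˣ) : PDO A) := by
  induction n with
  | zero => exact isDiff_fn 1
  | succ n ih =>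
    rw [Nat.cast_succ, negPd_zpow_succ]
    exact ih.neg.mul isDiff_pd

theorem IsDiff.adj {P : PDO A} (hP : IsDiff P) : IsDiff (adj P) := by
  intro m hm s
  rw [adj_coeff]
  refine finsum_eq_zero_of_forall_eq_zero fun k => ?_
  rw [adjTerm, sum_coeff]
  refine Finset.sum_eq_zero fun t ht => ?_
  clear ht
  rcases lt_or_ge k 0 with hk | hk
  · rw [hP k hk, adjMono_zero_right]
    rfl
  · lift k to ℕ using hk
    refine IsDiff.mul (isDiff_negPd_pow k) ?_ m hm s
    revert t
    exact forall_fin_four (isDiff_fn _) ((isDiff_Dop 0).mul (isDiff_fn _)).neg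
      ((isDiff_Dop 1).mul (isDiff_fn _)).neg
      (((isDiff_Dop 0).mul (isDiff_Dop 1)).mul (isDiff_fn _))

/-! ### The complex structure `J = D₁D₂∂⁻¹` -/

/-- The operator `J = D₁D₂∂⁻¹`, which satisfies `J² = -1`. -/
def opJ : PDO A := mono 1 (-1) 3

theorem opJ_eq : (opJ : PDO A) = Dop 0 * Dop 1 * pdi := by
  rw [opJ, mono_eq, fn_one, one_mul, Dop_zero_mul_Dop_one]
  rfl

theorem opJ_mem_filt : (opJ : PDO A) ∈ filt 0 := mono_mem_filt 1 (by simp [wt])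

theorem opPar_opJ : opPar (opJ : PDO A) = opJ := by
  rw [opJ, opPar_mono_three, par_one]

theorem adj_opJ : adj (opJ : PDO A) = -opJ := by
  have h : pdi * (Dop 0 * Dop 1) = (Dop 0 * Dop 1 * pdi : PDO A) := by
    rw [← mul_assoc, pdi_mul_Dop, mul_assoc, pdi_mul_Dop, mul_assoc]
  rw [opJ, adj_mono_three, fn_one, mul_one, zpow_neg, zpow_one,
    show ((negPd⁻¹ : (PDO A)ˣ) : PDO A) = -pdi from rfl, neg_mul, h, ← opJ_eq, opJ]

/-- Right multiplication by `J`, on coefficients. -/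
def mulJ : PDO A →+ PDO A where
  toFun P := ⟨fun m => ![-P.coeff (m - 1) 3, -P.coeff m 2, P.coeff m 1, P.coeff (m + 1) 0], by
    obtain ⟨M, hM⟩ := P.bdd
    refine ⟨M + 1, fun k hk => funext ?_⟩
    rw [hM k (by omega), hM (k - 1) (by omega), hM (k + 1) (by omega)]
    exact forall_fin_four (by simp) (by simp) (by simp) (by simp)⟩
  map_zero' := ext_coeff fun m => forall_fin_four (by simp) (by simp) (by simp) (by simp)
  map_add' P Q := ext_coeff fun m => by
    refine forall_fin_four ?_ ?_ ?_ ?_ <;> simp <;> abel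

theorem mulJ_mem_filt {P : PDO A} {d : ℤ} (hP : P ∈ filt d) : mulJ P ∈ filt d := by
  intro m
  refine forall_fin_four ?_ ?_ ?_ ?_ <;> intro h <;> simp only [wt, Matrix.cons_val] at h
  · exact neg_eq_zero.2 (hP (m - 1) 3 (by simp [wt]; omega))
  · exact neg_eq_zero.2 (hP m 2 (by simp [wt]; omega))
  · exact hP m 1 (by simp [wt]; omega)
  · exact hP (m + 1) 0 (by simp [wt]; omega)

/-- J has constant coefficients, so it only permutes coefficients up to sign and no derivatives
occur. In particular the zeroth order coefficient of `P` becomes the coefficient of D₁D₂∂⁻¹ in `P *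
opJ`: absence of a zeroth order term is detected by differentiality after multiplication by J. -/
theorem mul_opJ_eq_mulJ (P : PDO A) : P * opJ = mulJ P := by
  have : rmul opJ = mulJ (A := A) := by
    refine addHom_ext (c := 0) (fun d P hP => ?_) (fun d P hP => ?_) fun a k => ?_
    · exact mul_mem_filt hP opJ_mem_filt
    · rw [add_zero]; exact mulJ_mem_filt hP
    · have e : (k + -1 + 1 : ℤ) = k := by ring
      refine forall_fin_four ?_ ?_ ?_ ?_ <;>
        simp only [rmul_apply, mono_mul, opJ, ddL_mono_one, eL_zero, eL_one, eL_two, eL_three,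
          d1L_mono_three, d2L_mono_three, d1L_mono_one, D_one, mono_zero, zero_add, zero_sub,
          par_one, map_neg, e, fnL_mono, mul_one] <;>
      refine ext_coeff fun m => forall_fin_four ?_ ?_ ?_ ?_ <;>
        simp [mulJ, mono_coeff] <;> (try (split_ifs <;> simp_all; try omega))
  exact DFunLike.congr_fun this P

theorem mul_opJ_coeff_zero (P : PDO A) (m : ℤ) : (P * opJ).coeff m 0 = -P.coeff (m - 1) 3 := by
  rw [mul_opJ_eq_mulJ]; rfl

theorem mul_opJ_coeff_one (P : PDO A) (m : ℤ) : (P * opJ).coeff m 1 = -P.coeff m 2 := by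
  rw [mul_opJ_eq_mulJ]; rfl

theorem mul_opJ_coeff_two (P : PDO A) (m : ℤ) : (P * opJ).coeff m 2 = P.coeff m 1 := by
  rw [mul_opJ_eq_mulJ]; rfl

theorem mul_opJ_coeff_three (P : PDO A) (m : ℤ) : (P * opJ).coeff m 3 = P.coeff (m + 1) 0 := by
  rw [mul_opJ_eq_mulJ]; rfl

end PDO

end SuperHD

namespace SuperHD

open SuperFieldAlgebra PDO

namespace PDO

variable {A : Type u} [SuperFieldAlgebra A]

/-! ### Operators commuting with `J` -/

/-- Moving a super field through D₁D₂∂⁻¹ spends at least one super derivative on it, which costs one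
unit of degree. -/
theorem opJ_mul_fn_sub_mem_filt (a : A) : opJ * fn a - fn a * opJ ∈ filt (-1) := by
  have h1 : Dop 0 * fn (D 1 a) * pdi ∈ filt (-1) :=
    mul_mem_filt (p := 1) (mul_mem_filt (q := 0) (Dop_mem_filt 0) (fn_mem_filt _ le_rfl))
      pdi_mem_filt
  have h2 : fn (D 0 (par a)) * Dop 1 * pdi ∈ filt (-1) :=
    mul_mem_filt (p := 1) (mul_mem_filt (p := 0) (fn_mem_filt _ le_rfl) (Dop_mem_filt 1))
      pdi_mem_filt
  have h3 : Dop 0 * Dop 1 * (pdi * fn (dd a) * pdi) ∈ filt (-1) :=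
    filt_mono (by omega) (mul_mem_filt (mul_mem_filt (Dop_mem_filt 0) (Dop_mem_filt 1))
      (mul_mem_filt (mul_mem_filt pdi_mem_filt (fn_mem_filt (dd a) le_rfl)) pdi_mem_filt))
  convert sub_mem (add_mem h1 h2) h3 using 1
  rw [opJ_eq, mul_assoc (Dop 0 * Dop 1) pdi, pdi_mul_fn, mul_sub, mul_assoc (Dop 0) (Dop 1)
    (fn a * pdi), Dop_mul_fn_mul, mul_add, Dop_mul_fn_mul 0 (par a), par_par]
  noncomm_ring

/-- The only term of the differential part that J would make nonlocal is the zeroth order one, and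
`geOne` removes exactly it. This is why the projection (·)_{≥1} is the right one here. -/
theorem isDiff_geOne_mul_opJ (Q : PDO A) : IsDiff (geOne Q * opJ) := by
  intro m hm
  have h := isDiff_geOne Q
  refine forall_fin_four ?_ ?_ ?_ ?_
  · rw [mul_opJ_coeff_zero, h _ (by omega), neg_zero]
  · rw [mul_opJ_coeff_one, h _ hm, neg_zero]
  · rw [mul_opJ_coeff_two, h _ hm]
  · rw [mul_opJ_coeff_three]
    rcases eq_or_lt_of_le (Int.add_one_le_of_lt hm) with h' | h'
    · rw [h', geOne_coeff_zero_zero]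
    · exact h _ h' _

/-- The terms of an operator that are not in its differential part. -/
theorem sub_geOne_mem_filt (Q : PDO A) :
    Q - geOne Q - (fn (Q.coeff 0 0) + fn (Q.coeff (-1) 3) * opJ) ∈ filt (-1) := by
  intro k s hk
  rw [sub_coeff, sub_coeff, add_coeff, fn_mul_coeff, fn_coeff, opJ, mono_coeff]
  simp only [geOne]
  rcases lt_trichotomy k 0 with h | h | h
  · have := wt_le_two s
    obtain rfl : k = -1 := by omega
    revert s
    refine forall_fin_four ?_ ?_ ?_ ?_ <;> simp [wt]
  · subst h
    revert s
    refine forall_fin_four ?_ ?_ ?_ ?_ <;> simp [wt]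
  · rw [if_neg (by omega), if_neg (by omega), if_neg (by omega)]
    simp

theorem sub_geOne_mem_filt_zero (Q : PDO A) : Q - geOne Q ∈ filt 0 := by
  have h := sub_geOne_mem_filt Q
  rw [← sub_add_cancel (Q - geOne Q) (fn (Q.coeff 0 0) + fn (Q.coeff (-1) 3) * opJ)]
  exact add_mem (filt_mono (by omega) h) (add_mem (fn_mem_filt _ le_rfl)
    (mul_mem_filt (p := 0) (fn_mem_filt _ le_rfl) opJ_mem_filt))

/-- The removed part is a + dJ + lower order terms, and super fields commute with J up to lower
order. -/
theorem commutator_opJ_mem_filt (Q : PDO A) :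
    opJ * (Q - geOne Q) - (Q - geOne Q) * opJ ∈ filt (-1) := by
  set a := Q.coeff 0 0
  set d := Q.coeff (-1) 3
  have h := sub_geOne_mem_filt Q
  set Z := Q - geOne Q - (fn a + fn d * opJ) with hZ
  have e : Q - geOne Q = fn a + fn d * opJ + Z := by rw [hZ]; abel
  have key : opJ * (Q - geOne Q) - (Q - geOne Q) * opJ = (opJ * fn a - fn a * opJ)
      + (opJ * fn d - fn d * opJ) * opJ + opJ * Z - Z * opJ := by
    rw [e]
    noncomm_ring
  rw [key]
  exact sub_mem (add_mem (add_mem (opJ_mul_fn_sub_mem_filt a)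
    (mul_mem_filt (opJ_mul_fn_sub_mem_filt d) opJ_mem_filt)) (mul_mem_filt opJ_mem_filt h))
    (mul_mem_filt h opJ_mem_filt)

theorem IsDiff.eq_of_mem_filt_zero {X : PDO A} (hX : IsDiff X) (h : X ∈ filt 0) :
    X = fn (X.coeff 0 0) := by
  refine ext_coeff fun k s => ?_
  rw [fn_coeff]
  rcases lt_trichotomy k 0 with hk | hk | hk
  · rw [hX k hk, if_neg (by omega)]
  · subst hk
    revert s
    refine forall_fin_four (by simp) ?_ ?_ ?_ <;> rw [if_neg (by simp)] <;>
      exact h _ _ (by simp [wt])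
  · rw [if_neg (by omega), h k s (by have := wt_nonneg s; omega)]

theorem IsDiff.eq_of_mem_filt_one {X : PDO A} (hX : IsDiff X) (h : X ∈ filt 1) :
    X = fn (X.coeff 0 0) + mono (X.coeff 0 1) 0 1 + mono (X.coeff 0 2) 0 2 := by
  refine ext_coeff fun k s => ?_
  rw [add_coeff, add_coeff, fn_coeff, mono_coeff, mono_coeff]
  rcases lt_trichotomy k 0 with hk | hk | hk
  · rw [hX k hk, if_neg (by omega), if_neg (by omega), if_neg (by omega)]
    simp
  · subst hk
    revert s
    refine forall_fin_four (by simp) (by simp) (by simp) ?_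
    rw [h _ _ (by simp [wt])]
    simp
  · rw [if_neg (by omega), if_neg (by omega), if_neg (by omega),
      h k s (by have := wt_nonneg s; omega)]
    simp

/-- The differential part of an operator commuting with `J` commutes with `J`. -/
theorem geOne_mul_opJ {Q : PDO A} (hQ : Q * opJ = opJ * Q) : geOne Q * opJ = opJ * geOne Q := by
  set P := geOne Q with hP
  have hPd : IsDiff P := isDiff_geOne Q
  have hPJ : IsDiff (P * opJ) := isDiff_geOne_mul_opJ Q
  have hE : opJ * P - P * opJ ∈ filt (-1) := by
    have e : opJ * P - P * opJ = -(opJ * (Q - P) - (Q - P) * opJ) := by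
      rw [mul_sub, sub_mul, hQ]
      abel
    rw [e]
    exact neg_mem (commutator_opJ_mem_filt Q)
  have hpdJ : pd * opJ = (Dop 0 * Dop 1 : PDO A) := by
    rw [opJ_eq]
    simp only [mul_assoc, pd_mul_Dop_mul, pd_mul_pdi, mul_one]
  -- Multiplication by ∂ makes the commutator a differential operator, X = D₁D₂P - ∂(PJ), of degree
  -- at most 1.
  set X := pd * (opJ * P - P * opJ) with hX
  have hX' : X = Dop 0 * Dop 1 * P - pd * (P * opJ) := by
    rw [hX, mul_sub, ← mul_assoc, hpdJ]
  have hX1 : X ∈ filt 1 := mul_mem_filt pd_mem_filt hE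
  have hXd : IsDiff X := by
    rw [hX']
    exact (((isDiff_Dop 0).mul (isDiff_Dop 1)).mul hPd).sub (isDiff_pd.mul hPJ)
  -- D₁X and D₂X are left multiples of ∂ with differential quotient. The quotient has degree 0, so
  -- it is a super field y. Since ∂y contains no D₁, D₂ or D₁D₂ terms, the coefficients of X must
  -- vanish one after another.
  have hfac : ∀ Y : PDO A, IsDiff Y → pd * Y ∈ filt 2 → ∃ y, Y = fn y := fun Y hY h =>
    ⟨_, hY.eq_of_mem_filt_zero (mem_filt_of_pd_mul h)⟩
  have h0 : ∃ y, Dop 0 * X = pd * fn y := by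
    have e : Dop 0 * X = pd * (Dop 1 * P - Dop 0 * (P * opJ)) := by
      rw [hX', mul_sub, mul_sub, mul_assoc, Dop_mul_Dop_mul, ← pd_mul_Dop_mul]
    have h2 : Dop 0 * X ∈ filt 2 := mul_mem_filt (Dop_mem_filt 0) hX1
    rw [e] at h2
    obtain ⟨y, hy⟩ := hfac _ (((isDiff_Dop 1).mul hPd).sub ((isDiff_Dop 0).mul hPJ)) h2
    exact ⟨y, by rw [e, hy]⟩
  have h1 : ∃ y, Dop 1 * X = pd * fn y := by
    have e : Dop 1 * X = pd * (-(Dop 0 * P) - Dop 1 * (P * opJ)) := by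
      rw [hX', mul_sub, mul_sub, mul_assoc, Dop_one_mul_Dop_zero_mul, Dop_mul_Dop_mul,
        ← pd_mul_Dop_mul, ← pd_mul_Dop_mul, mul_neg]
    have h2 : Dop 1 * X ∈ filt 2 := mul_mem_filt (Dop_mem_filt 1) hX1
    rw [e] at h2
    obtain ⟨y, hy⟩ := hfac _ (((isDiff_Dop 0).mul hPd).neg.sub ((isDiff_Dop 1).mul hPJ)) h2
    exact ⟨y, by rw [e, hy]⟩
  have hpar : ∀ a : A, par a = 0 → a = 0 := fun a h => by rw [← par_par a, h, par_zero]
  have hcoeff : ∀ (y : A) (k : ℤ) (s : Fin 4), s ≠ 0 → (pd * fn y).coeff k s = 0 := by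
    intro y k s hs
    rw [pd_mul_coeff, fn_coeff, fn_coeff, if_neg (by tauto), if_neg (by tauto), dd_zero, add_zero]
  obtain ⟨y0, hy0⟩ := h0
  obtain ⟨y1, hy1⟩ := h1
  have c3 : X.coeff 0 3 = 0 := hX1 0 3 (by simp [wt])
  have c2 : X.coeff 0 2 = 0 := by
    have := hcoeff y0 0 3 (by decide)
    rw [← hy0, Dop_zero_mul, d1L_coeff_three, c3, map_zero, zero_add] at this
    exact hpar _ this
  have c1 : X.coeff 0 1 = 0 := by
    have := hcoeff y1 0 3 (by decide)
    rw [← hy1, Dop_one_mul, d2L_coeff_three, c3, map_zero, zero_sub, neg_eq_zero] at this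
    exact hpar _ this
  have c0 : X.coeff 0 0 = 0 := by
    have := hcoeff y0 0 1 (by decide)
    rw [← hy0, Dop_zero_mul, d1L_coeff_one, c1, map_zero, zero_add] at this
    exact hpar _ this
  have hX0 : X = 0 := by
    rw [hXd.eq_of_mem_filt_one hX1, c0, c1, c2, fn_zero, mono_zero, mono_zero]
    simp
  have hfin : opJ * P - P * opJ = 0 := by
    rw [← pdi_mul_pd_mul (opJ * P - P * opJ), ← hX, hX0, mul_zero]
  exact (sub_eq_zero.1 hfin).symm

/-- The adjoint of the differential part of an operator commuting with `J` has no zeroth order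
term. -/
theorem adj_geOne_coeff_zero_zero {Q : PDO A} (hQ : Q * opJ = opJ * Q) :
    (adj (geOne Q)).coeff 0 0 = 0 := by
  -- With P the differential part, JP = PJ is differential, hence so is its adjoint -P*J; its
  -- coefficient at D₁D₂∂⁻¹ is minus the zeroth order coefficient of P*.
  have h : IsDiff (adj (opJ * geOne Q)) := by
    rw [← geOne_mul_opJ hQ]
    exact (isDiff_geOne_mul_opJ Q).adj
  have h2 := h (-1) (by omega) 3
  rw [adj_mul opPar_opJ, adj_opJ, mul_neg, neg_coeff, mul_opJ_coeff_three, neg_eq_zero] at h2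
  exact h2

/-! ### The operators `½ (D₁ f D₁ + D₂ f D₂)` -/

/-- The operator `½ (D₁ f D₁ + D₂ f D₂)`. -/
noncomputable def qop (f : A) : PDO A :=
  (1 / 2 : ℚ) • (Dop 0 * (fn f * Dop 0) + Dop 1 * (fn f * Dop 1))

theorem qop_add (f g : A) : qop (f + g) = qop f + qop g := by
  simp only [qop, fn_add, add_mul, mul_add, ← smul_add]
  congr 1
  abel

theorem qop_eq {f : A} (hf : par f = f) :
    qop f = fn f * pd + (1 / 2 : ℚ) • (fn (D 0 f) * Dop 0 + fn (D 1 f) * Dop 1) := by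
  rw [qop, Dop_mul_fn_mul, Dop_mul_fn_mul, hf, Dop_mul_self, Dop_mul_self]
  module

/-- Both products equal ½(D₁ f D₂ - D₂ f D₁): the product of `qop f` with D₁D₂ is this operator
followed by ∂ in one order and preceded by ∂ in the other. -/
theorem qop_mul_opJ (f : A) : qop f * opJ = opJ * qop f := by
  have h1 : qop f * (Dop 0 * Dop 1) =
      (1 / 2 : ℚ) • (Dop 0 * (fn f * Dop 1) - Dop 1 * (fn f * Dop 0)) * pd := by
    simp only [qop, smul_mul_assoc, add_mul, sub_mul, mul_assoc, Dop_mul_Dop_mul,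
      Dop_one_mul_Dop_zero_mul, Dop_mul_self, pd_mul_Dop, mul_neg]
    module
  have h2 : Dop 0 * Dop 1 * qop f =
      pd * (1 / 2 : ℚ) • (Dop 0 * (fn f * Dop 1) - Dop 1 * (fn f * Dop 0)) := by
    simp only [qop, mul_smul_comm, mul_add, mul_sub, mul_assoc, Dop_mul_Dop_mul,
      Dop_one_mul_Dop_zero_mul, pd_mul_Dop_mul, mul_neg]
    module
  have h3 : Dop 0 * Dop 1 * pdi = (pdi * (Dop 0 * Dop 1) : PDO A) := by
    rw [← mul_assoc, pdi_mul_Dop, mul_assoc, mul_assoc, pdi_mul_Dop]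
  rw [opJ_eq, ← mul_assoc, h1, mul_assoc _ pd, pd_mul_pdi, mul_one, h3, mul_assoc, h2,
    pdi_mul_pd_mul]

theorem adj_qop {f : A} (hf : par f = f) : adj (qop f) = -qop f := by
  have h0 : adj (Dop 0 : PDO A) = -Dop 0 := by
    have := adj_Dop_zero_mul (1 : PDO A)
    rwa [mul_one, map_one, adj_one, one_mul] at this
  have h1 : adj (Dop 1 : PDO A) = -Dop 1 := by
    have := adj_Dop_one_mul (1 : PDO A)
    rwa [mul_one, map_one, adj_one, one_mul] at this
  rw [qop, map_rat_smul adj, map_add, adj_Dop_zero_mul, adj_Dop_one_mul, map_mul opPar,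
    map_mul opPar, opPar_fn, hf, opPar_Dop, opPar_Dop, adj_fn_mul_of_even hf, adj_fn_mul_of_even hf, map_neg,
    map_neg, h0, h1, ← smul_neg]
  congr 1
  noncomm_ring

theorem opPar_qop {f : A} (hf : par f = f) : opPar (qop f) = qop f := by
  rw [qop, map_rat_smul opPar]
  simp only [map_add, map_mul, opPar_fn, hf, opPar_Dop, mul_neg, neg_mul, neg_neg]

theorem isDiff_qop (f : A) : IsDiff (qop f) :=
  (((isDiff_Dop 0).mul ((isDiff_fn f).mul (isDiff_Dop 0))).add
    ((isDiff_Dop 1).mul ((isDiff_fn f).mul (isDiff_Dop 1)))).smul _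

theorem Dop_coeff_zero_zero (i : Fin 2) : (Dop i : PDO A).coeff 0 0 = 0 := by
  fin_cases i <;> simp [Dop, mono_coeff]

theorem qop_coeff_zero_zero (f : A) : (qop f).coeff 0 0 = 0 := by
  have h : ∀ i : Fin 2, (Dop i * (fn f * Dop i)).coeff 0 0 = 0 := fun i =>
    (isDiff_Dop i).mul_coeff_zero_zero ((isDiff_fn f).mul (isDiff_Dop i))
      ((isDiff_fn f).mul_coeff_zero_zero (isDiff_Dop i) (Dop_coeff_zero_zero i))
  rw [qop, smul_coeff, add_coeff, h, h, add_zero, smul_zero]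

theorem qop_sub_mem_filt {f : A} (hf : par f = f) : qop f - fn f * pd ∈ filt 1 := by
  rw [qop_eq hf, add_sub_cancel_left]
  exact smul_mem_filt _ (add_mem (mul_mem_filt (p := 0) (fn_mem_filt _ le_rfl) (Dop_mem_filt 0))
    (mul_mem_filt (p := 0) (fn_mem_filt _ le_rfl) (Dop_mem_filt 1)))

theorem qop_mem_filt (f : A) : qop f ∈ filt 2 := by
  refine smul_mem_filt _ (add_mem ?_ ?_) <;>
    exact mul_mem_filt (q := 1) (Dop_mem_filt _) (mul_mem_filt (p := 0) (fn_mem_filt _ le_rfl)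
      (Dop_mem_filt _))

/-- A first order differential operator without zeroth order term that commutes with `J` and has
leading part `f ∂` is `½ (D₁ f D₁ + D₂ f D₂)`. -/
theorem eq_qop {M : PDO A} {f : A} (hf : par f = f) (hM : IsDiff M) (h0 : M.coeff 0 0 = 0)
    (hJ : M * opJ = opJ * M) (hl : M - fn f * pd ∈ filt 1) : M = qop f := by
  rw [← sub_eq_zero]
  set N := M - qop f with hN
  have hN1 : N ∈ filt 1 := by
    have := sub_mem hl (qop_sub_mem_filt hf)
    rwa [sub_sub_sub_cancel_right] at this
  have hNd : IsDiff N := hM.sub (isDiff_qop f)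
  have hN0 : N.coeff 0 0 = 0 := by rw [hN, sub_coeff, h0, qop_coeff_zero_zero, sub_zero]
  -- The difference is b D₁ + c D₂. Commutation with J, cleared of ∂⁻¹, equates each of b and c with
  -- its own negative in the coefficients of D₁∂ and D₂∂.
  have hNJ : Dop 0 * (Dop 1 * N) = pd * (N * opJ) := by
    have e : N * opJ = opJ * N := by rw [hN, sub_mul, mul_sub, hJ, qop_mul_opJ]
    rw [e, opJ_eq]
    simp only [mul_assoc, pd_mul_Dop_mul, pd_mul_pdi_mul]
  have z3 : N.coeff 0 3 = 0 := hN1 _ _ (by simp [wt])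
  have z1 : ∀ s, N.coeff 1 s = 0 := fun s => hN1 _ _ (by have := wt_nonneg s; omega)
  have c1 : N.coeff 0 1 = 0 := by
    have := congrArg (fun X : PDO A => X.coeff 1 2) hNJ
    simp only [Dop_zero_mul, Dop_one_mul, d1L_coeff_two, d2L_coeff_three, d2L_coeff_two,
      pd_mul_coeff, mul_opJ_coeff_two, z1, sub_self, z3, map_zero, dd_zero, zero_add, zero_sub,
      map_neg, par_zero, add_zero, σ_σ] at this
    exact eq_zero_of_eq_neg this.symm
  have c2 : N.coeff 0 2 = 0 := by
    have := congrArg (fun X : PDO A => X.coeff 1 1) hNJ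
    simp only [Dop_zero_mul, Dop_one_mul, d1L_coeff_one, d2L_coeff_one, d2L_coeff_zero,
      pd_mul_coeff, mul_opJ_coeff_one, z1, sub_self, z3, map_zero, dd_zero, zero_add, zero_sub,
      map_neg, par_zero, add_zero, σ_σ, neg_zero] at this
    exact eq_zero_of_eq_neg this
  rw [hNd.eq_of_mem_filt_one hN1, hN0, c1, c2, fn_zero, mono_zero, mono_zero]
  simp

end PDO

end SuperHD

namespace SuperHD

open SuperFieldAlgebra PDO

variable {A : Type u} [SuperFieldAlgebra A]

/-! ### Factorization of `L_{2m}` -/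

theorem mono_zero_one (a : A) : mono a 0 1 = fn a * Dop 0 := by
  rw [show (Dop 0 : PDO A) = mono 1 0 1 from rfl, fn_mul_mono, mul_one]

theorem mono_zero_two (a : A) : mono a 0 2 = fn a * Dop 1 := by
  rw [show (Dop 1 : PDO A) = mono 1 0 2 from rfl, fn_mul_mono, mul_one]

theorem mono_zero_three (a : A) : mono a 0 3 = fn a * (Dop 0 * Dop 1) := by
  rw [Dop_zero_mul_Dop_one, fn_mul_mono, mul_one]

theorem mono_one_zero (a : A) : mono a 1 0 = fn a * pd := by
  rw [pd, fn_mul_mono, mul_one]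

theorem L2m_eq (U : A) : L2m U = pd * pd - fn (dd U) * pd
    - (1 / 2 : ℚ) • (fn (D 1 U * D 0 U) * (Dop 0 * Dop 1))
    + (1 / 4 : ℚ) • (-(2 : ℚ) • (fn (D 1 (dd U)) * Dop 1) + fn (D 1 U * dd U) * Dop 1
      - fn (D 0 U * D 0 (D 1 U)) * Dop 1)
    + (1 / 4 : ℚ) • (-(2 : ℚ) • (fn (D 0 (dd U)) * Dop 0) + fn (D 0 U * dd U) * Dop 0
      + fn (D 1 U * D 0 (D 1 U)) * Dop 0) := by
  rw [L2m, mono_zero_three, mono_zero_two, mono_zero_one, mono_one_zero, pd_mul_pd]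
  simp only [fn_smul, fn_add, fn_sub, smul_mul_assoc, add_mul, sub_mul]

theorem IsEven.par_D {U : A} (hU : IsEven U) (i : Fin 2) : par (D i U) = -D i U := by
  rw [SuperHD.par_D, hU]

theorem IsEven.par_dd {U : A} (hU : IsEven U) : par (dd U) = dd U := by
  rw [← SuperHD.dd_par, hU]

theorem odd_mul_self {a : A} (ha : par a = -a) : a * a = 0 :=
  eq_zero_of_eq_neg (odd_mul_odd a a ha ha)

/-- The factorization of `L_{2m}`. -/
theorem factor_mul_factor {U : A} (hU : IsEven U) :
    (pd - fn (dd U) + (1 / 2 : ℚ) • (fn (D 0 U) * Dop 0 + fn (D 1 U) * Dop 1))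
      * (pd - (1 / 2 : ℚ) • (fn (D 0 U) * Dop 0 + fn (D 1 U) * Dop 1)) = L2m U := by
  have e00 : D 0 U * D 0 U = 0 := odd_mul_self (hU.par_D 0)
  have e11 : D 1 U * D 1 U = 0 := odd_mul_self (hU.par_D 1)
  have e01 : D 0 U * D 1 U = -(D 1 U * D 0 U) := odd_mul_odd _ _ (hU.par_D 0) (hU.par_D 1)
  have c0 : dd U * D 0 U = D 0 U * dd U := even_comm hU.par_dd _
  have c1 : dd U * D 1 U = D 1 U * dd U := even_comm hU.par_dd _
  rw [L2m_eq]
  simp only [mul_add, add_mul, mul_sub, sub_mul, smul_mul_assoc, mul_smul_comm, mul_assoc,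
    Dop_mul_fn_mul, pd_mul_fn_mul, fn_mul_fn_mul, Dop_mul_Dop_mul, Dop_mul_self,
    Dop_one_mul_Dop_zero, pd_mul_Dop, hU.par_D, dd_D, D_D_same, D_one_D_zero, neg_mul, mul_neg,
    fn_neg, e00, e11, e01, c0, c1, fn_zero, zero_mul, mul_zero, smul_add, smul_sub, smul_neg,
    smul_smul]
  module

/-! ### Factorization through K = exp U and the resulting Lax commutator -/

section Log

variable {U : A} {K : Aˣ}

theorem par_inv (hK : par (K : A) = K) : par (↑K⁻¹ : A) = ↑K⁻¹ := by
  have h : par (↑K⁻¹ : A) * K = 1 := by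
    calc par (↑K⁻¹ : A) * K = par (↑K⁻¹ : A) * par (K : A) := by rw [hK]
      _ = 1 := by rw [← par_mul, Units.inv_mul, par_one]
  calc par (↑K⁻¹ : A) = par (↑K⁻¹ : A) * K * ↑K⁻¹ := by rw [Units.mul_inv_cancel_right]
    _ = ↑K⁻¹ := by rw [h, one_mul]

theorem IsLog.D_K (hU : IsLog U K) (i : Fin 2) : D i (K : A) = K * D i U := by
  rw [hU.2, Units.mul_inv_cancel_left]

theorem IsLog.D_inv (hU : IsLog U K) (hK : par (K : A) = K) (i : Fin 2) :
    D i (↑K⁻¹ : A) = -(↑K⁻¹ * D i U) := by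
  have h := D_mul i (↑K⁻¹ : A) K
  rw [Units.inv_mul, D_one, ← par, par_inv hK, hU.D_K, Units.inv_mul_cancel_left] at h
  have h2 : D i (↑K⁻¹ : A) * K = -D i U := eq_neg_of_add_eq_zero_left h.symm
  calc D i (↑K⁻¹ : A) = D i (↑K⁻¹ : A) * K * ↑K⁻¹ := by rw [Units.mul_inv_cancel_right]
    _ = -(↑K⁻¹ * D i U) := by rw [h2, neg_mul, even_comm (par_inv hK)]

theorem qop_inv (hU : IsLog U K) (hK : par (K : A) = K) :
    qop (↑K⁻¹ : A) =
      fn (↑K⁻¹ : A) * (pd - (1 / 2 : ℚ) • (fn (D 0 U) * Dop 0 + fn (D 1 U) * Dop 1)) := by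
  rw [qop_eq (par_inv hK), hU.D_inv hK, hU.D_inv hK]
  simp only [fn_neg, ← fn_mul_fn, mul_sub, mul_smul_comm, mul_add, mul_assoc, neg_mul]
  module

theorem qop_mul_fn_inv (hU : IsLog U K) (hK : par (K : A) = K) :
    qop (K : A) * fn (↑K⁻¹ : A) =
      pd - fn (dd U) + (1 / 2 : ℚ) • (fn (D 0 U) * Dop 0 + fn (D 1 U) * Dop 1) := by
  have e : ∀ i, D i U * (↑K⁻¹ * D i U) = 0 := fun i => by
    rw [← mul_assoc, ← even_comm (par_inv hK), mul_assoc, odd_mul_self (hU.1.par_D i), mul_zero]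
  have hdd : dd (↑K⁻¹ : A) = -(↑K⁻¹ * dd U) := by
    rw [dd, hU.D_inv hK, map_neg, D_mul, hU.D_inv hK, ← par, par_inv hK, neg_mul, mul_assoc,
      odd_mul_self (hU.1.par_D 0), mul_zero, neg_zero, zero_add, dd]
  have c : ∀ a : A, a * ↑K⁻¹ = ↑K⁻¹ * a := fun a => (even_comm (par_inv hK) a).symm
  rw [qop_eq hK, hU.D_K, hU.D_K]
  simp only [add_mul, smul_mul_assoc, mul_assoc, pd_mul_fn, Dop_mul_fn, par_inv hK, hU.D_inv hK,
    hdd, mul_add, fn_mul_fn, fn_mul_fn_mul, mul_neg, e, fn_neg, neg_zero, mul_zero, fn_zero, c,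
    Units.mul_inv_cancel_left, Units.mul_inv, Units.inv_mul,
    Units.inv_mul_cancel_left, fn_one, one_mul, smul_zero, zero_mul, zero_add]
  module

/-- This writes L_{2m} as a product of two skew-adjoint operators commuting with J; the structure of
the Lax flow and the transformation of the Harry Dym operator both follow from it. -/
theorem qop_mul_qop_inv (hU : IsLog U K) (hK : par (K : A) = K) :
    qop (K : A) * qop (↑K⁻¹ : A) = L2m U := by
  rw [qop_inv hU hK, ← mul_assoc, qop_mul_fn_inv hU hK, factor_mul_factor hU.1]

/-! ### The Lax flow is tangent to the family `L_{2m}` -/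

theorem opPar_L2m {U : A} (hU : IsEven U) : opPar (L2m U) = L2m U := by
  have h0 := hU.par_D 0
  have h1 := hU.par_D 1
  have h2 := hU.par_dd
  have h3 : par (D 0 (D 1 U)) = D 0 (D 1 U) := by rw [SuperHD.par_D, h1, map_neg, neg_neg]
  have h4 : ∀ i, par (D i (dd U)) = -D i (dd U) := fun i => by rw [SuperHD.par_D, h2]
  rw [L2m_eq]
  simp only [map_add, map_sub, map_neg, map_rat_smul opPar, map_mul, opPar_fn, opPar_Dop, par_mul,
    h0, h1, h2, h3, h4, mul_neg, neg_mul, neg_neg, fn_neg,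
    show opPar (pd : PDO A) = pd from parSuperHom.map_pd]

/-- The parity maps the root to a root of the same even operator, so uniqueness applies. -/
theorem IsSqrt.opPar_eq {R : PDO A} (hU : IsEven U) (hR : IsSqrt R (L2m U)) : opPar R = R := by
  have h := parSuperHom.map_isSqrt hR
  change IsSqrt (opPar R) (opPar (L2m U)) at h
  rw [opPar_L2m hU] at h
  exact h.eq hR (L2m_coeff_one_three U)

theorem adj_pd : adj (pd : PDO A) = -pd := by
  rw [← mul_one pd, adj_pd_mul, adj_one, one_mul, mul_one]

/-- Leading terms of `V q + q W` for `V = a + d J + ⋯`, `W = a - d J + ⋯` and `q = f ∂ + ⋯`. -/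
theorem mul_qop_add_qop_mul_mem_filt {a d f : A} (hf : par f = f) {V W : PDO A}
    (hV : V - (fn a + fn d * opJ) ∈ filt (-1)) (hW : W - (fn a - fn d * opJ) ∈ filt (-1)) :
    V * qop f + qop f * W - (2 : ℚ) • (fn (a * f) * pd) ∈ filt 1 := by
  have b1 : (V - (fn a + fn d * opJ)) * qop f ∈ filt 1 := mul_mem_filt hV (qop_mem_filt f)
  have b2 : qop f * (W - (fn a - fn d * opJ)) ∈ filt 1 := mul_mem_filt (qop_mem_filt f) hW
  have hdJ : fn d * opJ ∈ filt 0 := mul_mem_filt (p := 0) (fn_mem_filt _ le_rfl) opJ_mem_filt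
  have c1 : (fn a + fn d * opJ) * (qop f - fn f * pd) ∈ filt 1 :=
    mul_mem_filt (p := 0) (add_mem (fn_mem_filt _ le_rfl) hdJ) (qop_sub_mem_filt hf)
  have c2 : (qop f - fn f * pd) * (fn a - fn d * opJ) ∈ filt 1 :=
    mul_mem_filt (q := 0) (qop_sub_mem_filt hf) (sub_mem (fn_mem_filt _ le_rfl) hdJ)
  have d1 : fn d * (opJ * fn f - fn f * opJ) * pd ∈ filt 1 :=
    mul_mem_filt (mul_mem_filt (p := 0) (fn_mem_filt _ le_rfl) (opJ_mul_fn_sub_mem_filt f))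
      pd_mem_filt
  have d2 : fn (f * dd a) ∈ filt 1 := fn_mem_filt _ (by omega)
  have d3 : fn (f * dd d) * opJ ∈ filt 1 :=
    mul_mem_filt (p := 1) (fn_mem_filt _ (by omega)) opJ_mem_filt
  have hJpd : opJ * pd = (pd * opJ : PDO A) := by
    rw [opJ_eq]
    simp only [mul_assoc, pd_mul_Dop_mul, pd_mul_pdi, pdi_mul_pd]
  have e2 : fn f * pd * (fn a - fn d * opJ) = fn (a * f) * pd + fn (f * dd a)
      - fn (f * dd d) * opJ - fn d * (fn f * opJ) * pd := by
    rw [mul_sub, mul_assoc (fn f), pd_mul_fn, mul_assoc (fn f) pd, pd_mul_fn_mul, mul_add,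
      mul_add, fn_mul_fn, fn_mul_fn_mul, fn_mul_fn_mul, fn_mul_fn_mul, fn_mul_fn_mul, ← hJpd,
      even_comm hf a, even_comm hf d]
    noncomm_ring
  have e3 : fn a * (fn f * pd) = fn (a * f) * pd := by rw [fn_mul_fn_mul]
  have e4 : qop f * W = qop f * (W - (fn a - fn d * opJ))
      + (qop f - fn f * pd) * (fn a - fn d * opJ) + fn f * pd * (fn a - fn d * opJ) := by
    noncomm_ring
  have e5 : V * qop f = (V - (fn a + fn d * opJ)) * qop f
      + (fn a + fn d * opJ) * (qop f - fn f * pd) + fn a * (fn f * pd)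
      + fn d * (opJ * fn f) * pd := by
    noncomm_ring
  -- At leading order J commutes with f, so the contributions of d J and -d J cancel and the two
  -- copies of a f ∂ remain.
  have key : V * qop f + qop f * W - (2 : ℚ) • (fn (a * f) * pd) =
      (V - (fn a + fn d * opJ)) * qop f + qop f * (W - (fn a - fn d * opJ))
        + (fn a + fn d * opJ) * (qop f - fn f * pd) + (qop f - fn f * pd) * (fn a - fn d * opJ)
        + fn d * (opJ * fn f - fn f * opJ) * pd + fn (f * dd a) - fn (f * dd d) * opJ := by
    rw [e4, e5, e2, e3, mul_sub (fn d), sub_mul (fn d * (opJ * fn f)), two_smul]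
    abel
  rw [key]
  exact sub_mem (add_mem (add_mem (add_mem (add_mem (add_mem b1 b2) c1) c2) d1) d2) d3

/-- Along the `n`-th Lax flow, `U` changes by `-2` times the zeroth order term of
`L_{2m}^{n/2}`. -/
theorem lax_commutator_of_isLog (hU : IsLog U K) (hK : par (K : A) = K) {R : PDO A}
    (hR : IsSqrt R (L2m U)) {n : ℕ} (hn : Odd n) {F : A} (hF : F = -(2 : ℚ) • (R ^ n).coeff 0 0) :
    geOne (R ^ n) * L2m U - L2m U * geOne (R ^ n) =
      qop (F * K) * qop (↑K⁻¹ : A) - qop (K : A) * qop (F * ↑K⁻¹) := by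
  set L := L2m U with hLdef
  set X := qop (K : A) with hX
  set Y := qop (↑K⁻¹ : A) with hY
  have hKi := par_inv hK
  have hL : L = X * Y := (qop_mul_qop_inv hU hK).symm
  have hR1 : R - pd ∈ filt 1 := hR.sub_pd_mem_filt (L2m_coeff_one_three U)
  have hRp : opPar R = R := IsSqrt.opPar_eq hU.1 hR
  have hXa : adj X = -X := adj_qop hK
  have hYa : adj Y = -Y := adj_qop hKi
  have hLa : adj L = Y * X := by
    rw [hL, adj_mul (opPar_qop hK), hXa, hYa, neg_mul_neg]
  have hRR : R * R = L := hR.1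
  have hRRa : adj R * adj R = Y * X := by rw [← hLa, ← hRR, adj_mul hRp]
  have hRa : -adj R - pd ∈ filt 1 := by
    have := adj_mem_filt hR1
    rw [map_sub, adj_pd] at this
    convert neg_mem this using 1
    abel
  have hLJ : L * opJ = opJ * L := by
    rw [hL, mul_assoc, qop_mul_opJ, ← mul_assoc, qop_mul_opJ, mul_assoc]
  have hRJ : R * opJ = opJ * R := by
    rw [← sub_eq_zero]
    refine eq_zero_of_mul_add_mul hR1 hR1 ?_
    have : R * (R * opJ - opJ * R) + (R * opJ - opJ * R) * R = (R * R) * opJ - opJ * (R * R) := by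
      noncomm_ring
    rw [this, hRR, hLJ, sub_self]
  -- Since L* = YX, one has YL = YXY = L*Y. Hence R*Y + YR solves the homogeneous equation with left
  -- factor -R* and right factor R, both beginning with ∂; the relation for X is dual.
  have hYR : adj R * Y = -(Y * R) := by
    rw [eq_neg_iff_add_eq_zero]
    refine eq_zero_of_mul_add_mul hRa hR1 ?_
    have : -adj R * (adj R * Y + Y * R) + (adj R * Y + Y * R) * R =
        Y * (R * R) - (adj R * adj R) * Y := by noncomm_ring
    rw [this, hRR, hRRa, hL]
    noncomm_ring
  have hXR : R * X = -(X * adj R) := by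
    rw [eq_neg_iff_add_eq_zero]
    refine eq_zero_of_mul_add_mul hR1 hRa ?_
    have : R * (R * X + X * adj R) + (R * X + X * adj R) * -adj R =
        (R * R) * X - X * (adj R * adj R) := by noncomm_ring
    rw [this, hRR, hRRa, hL]
    noncomm_ring
  set Q := R ^ n with hQ
  have hQJ : Q * opJ = opJ * Q := (Commute.pow_left (show Commute R opJ from hRJ) n)
  have hQp : opPar Q = Q := by rw [hQ, map_pow, hRp]
  have hYR' : ∀ m : ℕ, adj R ^ m * Y = (-1) ^ m * (Y * R ^ m) := by
    intro m
    induction m with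
    | zero => simp
    | succ m ih =>
      rw [pow_succ, mul_assoc, hYR, mul_neg, ← mul_assoc, ih, pow_succ R, pow_succ (-1 : PDO A)]
      noncomm_ring
  have hXR' : ∀ m : ℕ, R ^ m * X = (-1) ^ m * (X * adj R ^ m) := by
    intro m
    induction m with
    | zero => simp
    | succ m ih =>
      rw [pow_succ, mul_assoc, hXR, mul_neg, ← mul_assoc, ih, pow_succ (adj R),
        pow_succ (-1 : PDO A)]
      noncomm_ring
  -- The oddness of n enters here: each factor R contributes a sign on passing through Y or X.
  have hQY : adj Q * Y + Y * Q = 0 := by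
    rw [hQ, adj_pow hRp, hYR' n, hn.neg_one_pow, neg_one_mul, neg_add_cancel]
  have hQX : Q * X + X * adj Q = 0 := by
    rw [hQ, adj_pow hRp, hXR' n, hn.neg_one_pow, neg_one_mul, neg_add_cancel]
  set P := geOne Q with hP
  have hPp : opPar P = P := by
    have := parSuperHom.map_geOne Q
    change opPar (geOne Q) = geOne (opPar Q) at this
    rw [hP, this, hQp]
  have hPJ : P * opJ = opJ * P := geOne_mul_opJ hQJ
  have hPaJ : adj P * opJ = opJ * adj P := by
    have h1 : adj (P * opJ) = adj (opJ * P) := by rw [hPJ]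
    rw [adj_mul hPp, adj_mul opPar_opJ, adj_opJ, neg_mul, mul_neg, neg_inj] at h1
    exact h1.symm
  set a := Q.coeff 0 0 with ha
  set d := Q.coeff (-1) 3 with hd
  have hap : par a = a := by
    have := congrArg (fun Z : PDO A => Z.coeff 0 0) hQp
    simpa [opPar_coeff] using this
  have hdp : par d = d := by
    have := congrArg (fun Z : PDO A => Z.coeff (-1) 3) hQp
    simpa [opPar_coeff] using this
  have hZ := sub_geOne_mem_filt Q
  rw [← hP] at hZ
  set T := Q - P with hT
  have hTa : adj T - (fn a - fn d * opJ) ∈ filt (-1) := by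
    have h1 := adj_mem_filt hZ
    have h2 := opJ_mul_fn_sub_mem_filt d
    convert sub_mem h1 h2 using 1
    rw [map_sub adj T, map_add adj, adj_fn, adj_fn_mul_of_even hdp, adj_opJ]
    noncomm_ring
  have hFf : ∀ f : A, fn (F * f) * pd = -((2 : ℚ) • (fn (a * f) * pd)) := fun f => by
    rw [hF, neg_smul, neg_mul, smul_mul_assoc, fn_neg, fn_smul, neg_mul, smul_mul_assoc]
  have hFp : par F = F := by rw [hF, par_smul, hap]
  -- The left side is differential, has no zeroth order term and commutes with J. By `hQX` it also
  -- equals -(TX + XT*), where T is only a + dJ to leading order; this yields the leading part -2aK∂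
  -- and `eq_qop` applies.
  have hMX : P * X + X * adj P = qop (F * K) := by
    have e : P * X + X * adj P = -(T * X + X * adj T) := by
      have h1 : T * X + X * adj T = (Q * X + X * adj Q) - (P * X + X * adj P) := by
        rw [hT, map_sub]
        noncomm_ring
      rw [h1, hQX, zero_sub, neg_neg]
    have hPd : IsDiff P := isDiff_geOne Q
    refine eq_qop (by rw [par_mul, hFp, hK]) ((hPd.mul (isDiff_qop _)).add
      ((isDiff_qop _).mul hPd.adj)) ?_ ?_ ?_
    · rw [add_coeff, hPd.mul_coeff_zero_zero (isDiff_qop _) (qop_coeff_zero_zero _),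
        (isDiff_qop _).mul_coeff_zero_zero hPd.adj (adj_geOne_coeff_zero_zero hQJ), add_zero]
    · rw [add_mul, mul_add, mul_assoc, qop_mul_opJ, ← mul_assoc, hPJ, mul_assoc, mul_assoc, hPaJ,
        ← mul_assoc X, qop_mul_opJ, mul_assoc]
    · rw [e, hFf]
      convert neg_mem (mul_qop_add_qop_mul_mem_filt hK hZ hTa) using 1
      abel
  have hMY : adj P * Y + Y * P = qop (F * ↑K⁻¹) := by
    have e : adj P * Y + Y * P = -(adj T * Y + Y * T) := by
      have h1 : adj T * Y + Y * T = (adj Q * Y + Y * Q) - (adj P * Y + Y * P) := by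
        rw [hT, map_sub]
        noncomm_ring
      rw [h1, hQY, zero_sub, neg_neg]
    have hPd : IsDiff P := isDiff_geOne Q
    refine eq_qop (by rw [par_mul, hFp, hKi]) ((hPd.adj.mul (isDiff_qop _)).add
      ((isDiff_qop _).mul hPd)) ?_ ?_ ?_
    · rw [add_coeff, hPd.adj.mul_coeff_zero_zero (isDiff_qop _) (qop_coeff_zero_zero _),
        (isDiff_qop _).mul_coeff_zero_zero hPd (geOne_coeff_zero_zero Q), add_zero]
    · rw [add_mul, mul_add, mul_assoc, qop_mul_opJ, ← mul_assoc, hPaJ, mul_assoc, mul_assoc, hPJ,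
        ← mul_assoc Y, qop_mul_opJ, mul_assoc]
    · rw [e, hFf]
      -- For Y the roles of T and its adjoint are exchanged, which replaces d by -d.
      have hTa' : adj T - (fn a + fn (-d) * opJ) ∈ filt (-1) := by
        rwa [fn_neg, neg_mul, ← sub_eq_add_neg]
      have hZ' : T - (fn a - fn (-d) * opJ) ∈ filt (-1) := by
        rwa [fn_neg, neg_mul, sub_neg_eq_add]
      convert neg_mem (mul_qop_add_qop_mul_mem_filt hKi hTa' hZ') using 1
      abel
  -- [P, XY] = (PX + XP*)Y - X(P*Y + YP), the terms X P* Y cancelling.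
  rw [← hMX, ← hMY, hL]
  noncomm_ring

end Log

end SuperHD

namespace SuperHD

open SuperFieldAlgebra PDO

/-! ### Dual numbers -/

section Dual

variable {A : Type u} [SuperFieldAlgebra A]

open TrivSqZeroExt

/-- Super fields depending on an even parameter `ε` with `ε² = 0`. -/
instance : SuperFieldAlgebra (DualNumber A) where
  toRing := inferInstanceAs (Ring (TrivSqZeroExt A A))
  toAlgebra := inferInstanceAs (Algebra ℚ (TrivSqZeroExt A A))
  σ :=
    { toFun := fun x => inl (par x.fst) + inr (par x.snd)
      map_one' := by ext <;> simp
      map_mul' := fun x y => by ext <;> simp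
      map_zero' := by ext <;> simp
      map_add' := fun x y => by ext <;> simp }
  σ_σ x := by ext <;> simp [σ_σ]
  even_mul_comm x y h := by
    have h1 : par x.fst = x.fst := by simpa using congrArg fst h
    have h2 : par x.snd = x.snd := by simpa using congrArg snd h
    ext
    · simpa using even_comm h1 _
    · simp [even_comm h1, even_comm h2, add_comm]
  odd_mul_odd x y h h' := by
    have h1 : par x.fst = -x.fst := by simpa using congrArg fst h
    have h2 : par x.snd = -x.snd := by simpa using congrArg snd h
    have h3 : par y.fst = -y.fst := by simpa using congrArg fst h'
    have h4 : par y.snd = -y.snd := by simpa using congrArg snd h'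
    ext
    · simpa using odd_mul_odd _ _ h1 h3
    · simp [odd_mul_odd _ _ h1 h4, odd_mul_odd _ _ h2 h3, add_comm]
  D i :=
    { toFun := fun x => inl (D i x.fst) + inr (D i x.snd)
      map_zero' := by ext <;> simp
      map_add' := fun x y => by ext <;> simp }
  σ_D i x := by ext <;> simp [σ_D]
  D_mul i x y := by
    ext
    · simp [D_mul]
    · simp [D_mul]
      abel
  D_sq x := by ext <;> simp [D_sq]
  D_anticomm x := by ext <;> simp [D_anticomm]

theorem fst_par (x : DualNumber A) : (par x).fst = par x.fst := by
  change (inl (par x.fst) + inr (par x.snd) : TrivSqZeroExt A A).fst = _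
  simp

theorem snd_par (x : DualNumber A) : (par x).snd = par x.snd := by
  change (inl (par x.fst) + inr (par x.snd) : TrivSqZeroExt A A).snd = _
  simp

theorem fst_D (i : Fin 2) (x : DualNumber A) : (D i x).fst = D i x.fst := by
  change (inl (D i x.fst) + inr (D i x.snd) : TrivSqZeroExt A A).fst = _
  simp

theorem snd_D (i : Fin 2) (x : DualNumber A) : (D i x).snd = D i x.snd := by
  change (inl (D i x.fst) + inr (D i x.snd) : TrivSqZeroExt A A).snd = _
  simp

theorem fst_dd (x : DualNumber A) : (dd x).fst = dd x.fst := by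
  rw [dd, fst_D, fst_D, dd]

theorem snd_dd (x : DualNumber A) : (dd x).snd = dd x.snd := by
  rw [dd, snd_D, snd_D, dd]

theorem dual_fst_mul (x y : DualNumber A) : (x * y).fst = x.fst * y.fst := rfl

theorem dual_snd_mul (x y : DualNumber A) :
    (x * y).snd = x.fst * y.snd + x.snd * y.fst := rfl

/-- The element `a + ε b`. -/
def dual (a b : A) : DualNumber A := (a, b)

@[simp] theorem fst_dual (a b : A) : (dual a b).fst = a := rfl

@[simp] theorem snd_dual (a b : A) : (dual a b).snd = b := rfl

theorem dual_ext {x y : DualNumber A} (h1 : x.fst = y.fst) (h2 : x.snd = y.snd) : x = y :=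
  TrivSqZeroExt.ext h1 h2

/-- A time derivative is a morphism to dual numbers. -/
def TimeDerivation.toDual (δ : TimeDerivation A) : SuperHom A (DualNumber A) where
  toFun a := dual a (δ.d a)
  map_one' := by
    have h := δ.d_mul 1 1
    rw [mul_one, one_mul, mul_one, left_eq_add] at h
    exact dual_ext rfl h
  map_mul' a b := dual_ext rfl (by
    rw [snd_dual, dual_snd_mul, δ.d_mul, add_comm]
    rfl)
  map_zero' := dual_ext rfl (map_zero δ.d)
  map_add' a b := dual_ext rfl (map_add δ.d a b)
  ε := 1
  ε_mul_self := rfl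
  map_par' a := dual_ext (fst_par (dual a (δ.d a))).symm
    ((δ.d_σ a).trans (snd_par (dual a (δ.d a))).symm)
  map_D' i a := by
    rw [one_smul]
    exact dual_ext (fst_D i (dual a (δ.d a))).symm
      ((δ.d_D i a).trans (snd_D i (dual a (δ.d a))).symm)

/-- The inclusion of constants. -/
def inlHom : SuperHom A (DualNumber A) :=
  TimeDerivation.toDual ⟨0, by simp, by simp, by simp⟩

/-- The `ε`-part of an operator. -/
def sndOp : PDO (DualNumber A) →+ PDO A where
  toFun P := ⟨fun k s => (P.coeff k s).snd, by
    obtain ⟨M, hM⟩ := P.bdd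
    exact ⟨M, fun k hk => funext fun s => by rw [hM k hk]; rfl⟩⟩
  map_zero' := rfl
  map_add' _ _ := rfl

theorem sndOp_coeff (P : PDO (DualNumber A)) (k : ℤ) (s : Fin 4) :
    (sndOp P).coeff k s = (P.coeff k s).snd := rfl

/-- The operator `P + ε Q`. -/
def dualOp (P Q : PDO A) : PDO (DualNumber A) where
  coeff k s := dual (P.coeff k s) (Q.coeff k s)
  bdd := by
    obtain ⟨N, hN⟩ := P.bdd
    obtain ⟨M, hM⟩ := Q.bdd
    refine ⟨max N M, fun k hk => funext fun s => ?_⟩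
    rw [hN k (by omega), hM k (by omega)]
    rfl

theorem dualOp_coeff (P Q : PDO A) (k : ℤ) (s : Fin 4) :
    (dualOp P Q).coeff k s = dual (P.coeff k s) (Q.coeff k s) := rfl

theorem sndOp_dualOp (P Q : PDO A) : sndOp (dualOp P Q) = Q := rfl

theorem inlHom_map (P : PDO A) : inlHom.map P = dualOp P 0 :=
  ext_coeff fun k => by
    refine forall_fin_four ?_ ?_ ?_ ?_ <;> rw [SuperHom.map_coeff] <;>
      exact one_smul ℤ (dual (P.coeff k _) 0)

theorem dualOp_add (P P' Q Q' : PDO A) :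
    dualOp P Q + dualOp P' Q' = dualOp (P + P') (Q + Q') := rfl

theorem fn_dual_zero_one_mul (P Q : PDO A) : fn (dual 0 1) * dualOp P Q = dualOp 0 P :=
  ext_coeff fun k s => by
    rw [fn_mul_coeff]
    refine dual_ext ?_ ?_
    · rw [dual_fst_mul, dualOp_coeff, dualOp_coeff, fst_dual, fst_dual, fst_dual, zero_mul]
      rfl
    · rw [dual_snd_mul, dualOp_coeff, dualOp_coeff]
      simp

theorem par_dual (a b : A) : par (dual a b) = dual (par a) (par b) :=
  dual_ext (fst_par _) (snd_par _)

theorem D_dual (i : Fin 2) (a b : A) : D i (dual a b) = dual (D i a) (D i b) :=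
  dual_ext (fst_D _ _) (snd_D _ _)

theorem dd_dual (a b : A) : dd (dual a b) = dual (dd a) (dd b) :=
  dual_ext (fst_dd _) (snd_dd _)

theorem dual_mul_dual (a b a' b' : A) :
    dual a b * dual a' b' = dual (a * a') (a * b' + b * a') := rfl

/-- The parameter `ε` is central. -/
theorem mul_fn_dual_zero_one (P : PDO (DualNumber A)) :
    P * fn (dual 0 1) = fn (dual 0 1) * P := by
  have hD : ∀ i : Fin 2, D i (dual 0 1 : DualNumber A) = 0 := fun i => by
    rw [D_dual, map_zero, D_one]; rfl
  have hp : par (dual 0 1 : DualNumber A) = dual 0 1 := by rw [par_dual, par_zero, par_one]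
  have hDop : ∀ i : Fin 2, Dop i * fn (dual 0 1 : DualNumber A) = fn (dual 0 1) * Dop i :=
    fun i => by rw [Dop_mul_fn, hD, hp, fn_zero, zero_add]
  have hpd : pd * fn (dual 0 1 : DualNumber A) = fn (dual 0 1) * pd := by
    rw [pd_mul_fn, dd, hD, map_zero, fn_zero, zero_add]
  have hk : ∀ (k : ℤ) (X : PDO (DualNumber A)),
      ddL k (fn (dual 0 1) * X) = fn (dual 0 1) * ddL k X := by
    have h1 : ∀ X : PDO (DualNumber A), ddL 1 (fn (dual 0 1) * X) = fn (dual 0 1) * ddL 1 X :=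
      fun X => by rw [← pd_mul, ← pd_mul, ← mul_assoc, hpd, mul_assoc]
    intro k X
    induction k with
    | zero => rw [ddL_zero, ddL_zero]
    | succ k ih => rw [← ddL_one_ddL, ih, h1, ddL_one_ddL]
    | pred k ih =>
      apply ddL_one_injective
      rw [ddL_one_ddL, h1, ddL_one_ddL, sub_add_cancel, ih]
  have : rmul (fn (dual 0 1)) = lmul (fn (dual 0 1 : DualNumber A)) := by
    refine addHom_ext (c := 0) (fun d P hP => ?_) (fun d P hP => ?_) fun a k s => ?_
    · exact mul_mem_filt hP (fn_mem_filt _ le_rfl)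
    · exact filt_mono (by omega) (mul_mem_filt (p := 0) (fn_mem_filt _ le_rfl) hP)
    · have e := hk k 1
      rw [mul_one] at e
      have hone : ∀ X : PDO (DualNumber A), fnL a X = fn a * X := fun X => (fn_mul a X).symm
      rw [rmul_apply, lmul_apply, mono_mul, e, hone]
      have e2 : mono a k s = fn a * eL s (ddL k 1) := by
        rw [← hone, ← mono_mul, mul_one]
      rw [e2, ← mul_assoc (fn (dual 0 1)), fn_mul_fn, even_comm hp, ← fn_mul_fn, mul_assoc]
      congr 1
      revert s
      refine forall_fin_four ?_ ?_ ?_ ?_ <;> intro _ <;>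
        simp only [eL_zero, eL_one, eL_two, eL_three, ← Dop_zero_mul, ← Dop_one_mul, ← mul_assoc,
          hDop]
  exact DFunLike.congr_fun this P

theorem dualOp_eq (P Q : PDO A) :
    dualOp P Q = inlHom.map P + fn (dual 0 1) * inlHom.map Q := by
  rw [inlHom_map, inlHom_map, fn_dual_zero_one_mul, dualOp_add, add_zero, zero_add]

/-- The first order product rule, from the centrality of the parameter and the vanishing of its
square. -/
theorem dualOp_mul (P Q P' Q' : PDO A) :
    dualOp P Q * dualOp P' Q' = dualOp (P * P') (P * Q' + Q * P') := by
  simp only [dualOp_eq, map_mul, map_add]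
  have h := mul_fn_dual_zero_one (inlHom.map P)
  have h2 := mul_fn_dual_zero_one (inlHom.map Q)
  have h0 : fn (dual 0 1 : DualNumber A) * fn (dual 0 1) = 0 := by
    rw [fn_mul_fn, dual_mul_dual]
    simp only [zero_mul, mul_zero, add_zero]
    exact fn_zero
  set e := fn (dual 0 1 : DualNumber A)
  set p := inlHom.map P
  set q := inlHom.map Q
  set p' := inlHom.map P'
  set q' := inlHom.map Q'
  have h3 : e * q * (e * q') = 0 := by
    rw [← mul_assoc, mul_assoc e q e, h2, ← mul_assoc, h0, zero_mul, zero_mul]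
  have h4 : p * (e * q') = e * (p * q') := by rw [← mul_assoc, h, mul_assoc]
  rw [add_mul, mul_add, mul_add, h3, h4]
  noncomm_ring

/-- The derivative of `L_{2m}` at `U` in the direction `V`. -/
noncomputable def linL2m (U V : A) : PDO A := sndOp (L2m (dual U V))

theorem L2m_dual (U V : A) : L2m (dual U V) = dualOp (L2m U) (linL2m U V) := by
  refine ext_coeff fun k s => dual_ext ?_ rfl
  rw [dualOp_coeff, fst_dual]
  have h : ∀ (x : DualNumber A) (k : ℤ) (s : Fin 4) (m : ℤ) (t : Fin 4),
      ((mono x k s).coeff m t).fst = (mono x.fst k s).coeff m t := by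
    intro x k s m t
    rw [mono_coeff, mono_coeff]
    split_ifs <;> rfl
  simp only [L2m, add_coeff, sub_coeff, fst_add, fst_sub, h, fst_smul, fst_neg, dual_fst_mul,
    fst_D, fst_dd, fst_dual, fst_one]

theorem SuperHom.map_L2m {A' : Type v} [SuperFieldAlgebra A'] (f : SuperHom A A') (hf : f.ε = 1)
    (U : A) : f.map (L2m U) = L2m (f U) := by
  have hD : ∀ i a, f (D i a) = D i (f a) := fun i a => by rw [f.map_D, hf, one_smul]
  have hs : ∀ (c : ℚ) (a : A), f (c • a) = c • f a := fun c a => map_rat_smul f.toRingHom c a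
  have hDop : ∀ i, f.map (Dop i) = Dop i := fun i => by rw [f.map_Dop, hf, one_smul]
  rw [L2m_eq, L2m_eq]
  simp only [map_add, map_sub, map_neg, map_rat_smul f.map, map_mul, f.map_fn, hDop, f.map_pd, hD,
    f.map_dd]

/-- L_{2m} is natural, in particular under the morphism a ↦ a + ε δa; the ε-parts are compared. -/
theorem TimeDerivation.onPDO_L2m (δ : TimeDerivation A) (U : A) :
    δ.onPDO (L2m U) = linL2m U (δ.d U) := by
  have h := δ.toDual.map_L2m rfl U
  have h2 : δ.toDual U = dual U (δ.d U) := rfl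
  rw [h2] at h
  rw [linL2m, ← h]
  refine ext_coeff fun k => forall_fin_four ?_ ?_ ?_ ?_ <;>
    rw [sndOp_coeff, SuperHom.map_coeff] <;>
    exact (congrArg TrivSqZeroExt.snd (one_smul ℤ (δ.toDual ((L2m U).coeff k _)))).symm

/-- The coefficient of ∂ in L_{2m} is -U_y. This is how the Lax equation recovers the flow, and why
it does so only after applying ∂. -/
theorem linL2m_coeff_one_zero (U V : A) : (linL2m U V).coeff 1 0 = -dd V := by
  rw [linL2m, sndOp_coeff, L2m]
  simp [mono_coeff, dd_dual]

theorem qop_dual (a b : A) : qop (dual a b) = dualOp (qop a) (qop b) := by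
  have hf : fn (dual a b) = dualOp (fn a) (fn b) := by
    refine ext_coeff fun k s => ?_
    rw [dualOp_coeff, fn_coeff, fn_coeff, fn_coeff]
    split_ifs <;> rfl
  have hDop : ∀ i : Fin 2, (Dop i : PDO (DualNumber A)) = dualOp (Dop i) 0 := fun i => by
    rw [← inlHom_map, SuperHom.map_Dop]
    exact (one_smul ℤ (Dop i : PDO (DualNumber A))).symm
  have hs : ∀ (c : ℚ) (P Q : PDO A), c • dualOp P Q = dualOp (c • P) (c • Q) := fun c P Q => rfl
  simp only [qop, hf, hDop, dualOp_mul, dualOp_add, hs, mul_zero, zero_mul, add_zero, zero_add]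

/-- The derivative of `L_{2m}` when `U` has an exponential. -/
theorem linL2m_of_isLog {U : A} {K : Aˣ} (hU : IsLog U K) (hK : par (K : A) = K) {F : A}
    (hF : par F = F) :
    linL2m U F = qop (F * K) * qop (↑K⁻¹ : A) - qop (K : A) * qop (F * ↑K⁻¹) := by
  have hKi := par_inv hK
  have c1 := even_comm hF (↑K⁻¹ : A)
  have c2 := even_comm hF (K : A)
  -- K(1 + εF) plays the role of the exponential of U + εF, with inverse K⁻¹(1 - εF). The
  -- factorization over the dual numbers then differentiates the factorization over A.
  let K' : (DualNumber A)ˣ :=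
    { val := dual K (F * K)
      inv := dual ↑K⁻¹ (-(F * ↑K⁻¹))
      val_inv := by
        rw [dual_mul_dual, Units.mul_inv]
        refine dual_ext rfl ?_
        rw [snd_dual, mul_neg, c1, Units.mul_inv_cancel_left, Units.mul_inv_cancel_right,
          neg_add_cancel]
        rfl
      inv_val := by
        rw [dual_mul_dual, Units.inv_mul]
        refine dual_ext rfl ?_
        rw [snd_dual, c2, Units.inv_mul_cancel_left, neg_mul, Units.inv_mul_cancel_right,
          add_neg_cancel]
        rfl }
  have hK' : par (K' : DualNumber A) = K' := by
    change par (dual _ _) = dual _ _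
    rw [par_dual, par_mul, hF, hK]
  have hU' : IsLog (dual U F) K' := by
    refine ⟨?_, fun i => ?_⟩
    · rw [IsEven, par_dual, hF, hU.1]
    · change D i (dual U F) = dual _ _ * D i (dual _ _)
      rw [D_dual, D_dual, dual_mul_dual, ← hU.2]
      refine dual_ext rfl ?_
      rw [snd_dual, snd_dual, D_mul, ← par, hF, mul_add, hU.D_K, ← even_comm hK, Units.inv_mul_cancel_left,
        neg_mul, ← mul_assoc F K, c2, mul_assoc (K : A) F, Units.inv_mul_cancel_left, mul_assoc F,
        Units.inv_mul_cancel_left, add_neg_cancel_right]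
  have h := qop_mul_qop_inv hU' hK'
  change qop (dual _ _) * qop (dual _ _) = _ at h
  rw [qop_dual, qop_dual, dualOp_mul] at h
  rw [linL2m, ← h, sndOp_dualOp, eq_sub_iff_add_eq, add_right_comm, ← mul_add, ← qop_add, neg_add_cancel]
  simp [qop, fn_zero]

end Dual

end SuperHD

namespace SuperHD

open SuperFieldAlgebra PDO

/-! ### Adjoining an exponential -/

section ExpExt

open AddMonoidAlgebra

variable {A : Type u} [SuperFieldAlgebra A]

/-- The extension of `A` by an invertible even element `T` with `D i T = T * D i U`, as a type
of Laurent polynomials in `T`. -/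
def ExpExt (U : A) (_ : IsEven U) : Type u := AddMonoidAlgebra A ℤ

/-- The additive endomorphism of Laurent polynomials given on each monomial. -/
noncomputable def onMonomials (φ : ℤ → A →+ A) : AddMonoidAlgebra A ℤ →+ AddMonoidAlgebra A ℤ :=
  (Finsupp.liftAddHom fun k => (singleAddHom k).comp (φ k)).comp
    (coeffAddEquiv (R := A) (M := ℤ)).toAddMonoidHom

theorem onMonomials_single (φ : ℤ → A →+ A) (k : ℤ) (a : A) :
    onMonomials φ (single k a) = single k (φ k a) :=
  Finsupp.liftAddHom_apply_single _ _ _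

@[elab_as_elim]
theorem laurent_induction {p : AddMonoidAlgebra A ℤ → Prop} (x : AddMonoidAlgebra A ℤ)
    (single : ∀ k a, p (single k a)) (zero : p 0) (add : ∀ x y, p x → p y → p (x + y)) : p x := by
  obtain ⟨x⟩ := x
  induction x using Finsupp.induction_linear with
  | zero => exact zero
  | add x y hx hy => exact add _ _ hx hy
  | single k a => exact single k a

/-- Right multiplication by `c` composed with the parity. -/
def parMulRight (c : A) : A →+ A := (AddMonoidHom.mulRight c).comp (σ : A →+* A).toAddMonoidHom

/-- The parity of Laurent polynomials. -/
noncomputable def laurentPar : AddMonoidAlgebra A ℤ →+ AddMonoidAlgebra A ℤ :=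
  onMonomials fun _ => (σ : A →+* A).toAddMonoidHom

theorem laurentPar_single (k : ℤ) (a : A) :
    laurentPar (single k a) = single k (par a) := onMonomials_single _ _ _

/-- The super derivatives of Laurent polynomials in an exponential of `U`. -/
noncomputable def laurentD (U : A) (i : Fin 2) : AddMonoidAlgebra A ℤ →+ AddMonoidAlgebra A ℤ :=
  onMonomials fun k => D i + k • parMulRight (D i U)

theorem laurentD_single (U : A) (i : Fin 2) (k : ℤ) (a : A) :
    laurentD U i (single k a) = single k (D i a + k • (par a * D i U)) := onMonomials_single _ _ _

theorem laurentPar_mul (x y : AddMonoidAlgebra A ℤ) :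
    laurentPar (x * y) = laurentPar x * laurentPar y := by
  induction x using laurent_induction (A := A) with
  | zero => simp
  | add x x' h h' =>
    rw [add_mul, map_add, h, h', map_add, add_mul]
  | single k a =>
    induction y using laurent_induction (A := A) with
    | zero => simp
    | add y y' h h' =>
      rw [mul_add, map_add, h, h', map_add, mul_add]
    | single l b =>
      rw [single_mul_single, laurentPar_single, laurentPar_single, laurentPar_single,
        single_mul_single, par_mul]

theorem laurentPar_laurentPar (x : AddMonoidAlgebra A ℤ) : laurentPar (laurentPar x) = x := by
  induction x using laurent_induction (A := A) with
  | zero => simp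
  | add x x' h h' =>
    rw [map_add, map_add, h, h']
  | single k a =>
    rw [laurentPar_single, laurentPar_single, par_par]

/-- Being even is not inherited by the summands in an induction over Laurent polynomials. The
expression x + par x is always even and additive in x, and an even x is half of it; the odd case
uses x - par x likewise. -/
theorem laurent_add_par_mul_comm (x y : AddMonoidAlgebra A ℤ) :
    (x + laurentPar x) * y = y * (x + laurentPar x) := by
  induction x using laurent_induction (A := A) with
  | zero => simp
  | add x x' h h' =>
    rw [map_add, add_add_add_comm, add_mul, h, h', mul_add _ (_ + _)]
  | single k a =>
    induction y using laurent_induction (A := A) with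
    | zero => simp
    | add y y' h h' =>
      rw [mul_add, h, h', add_mul]
    | single l b =>
      rw [laurentPar_single, ← single_add, single_mul_single, single_mul_single, add_comm k,
        even_comm (by rw [par_add, par_par, add_comm])]

theorem laurent_sub_par_mul_sub_par (x y : AddMonoidAlgebra A ℤ) :
    (x - laurentPar x) * (y - laurentPar y) = -((y - laurentPar y) * (x - laurentPar x)) := by
  induction x using laurent_induction (A := A) with
  | zero => simp
  | add x x' h h' =>
    rw [map_add, add_sub_add_comm, add_mul, h, h', mul_add, neg_add]
  | single k a =>
    induction y using laurent_induction (A := A) with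
    | zero => simp
    | add y y' h h' =>
      rw [map_add, add_sub_add_comm, mul_add, h, h', add_mul, neg_add]
    | single l b =>
      rw [laurentPar_single, laurentPar_single, ← single_sub, ← single_sub, single_mul_single,
        single_mul_single, add_comm k, odd_mul_odd (a - par a) (b - par b), single_neg]
      · change par _ = _
        rw [par_sub, par_par, neg_sub]
      · change par _ = _
        rw [par_sub, par_par, neg_sub]

theorem laurentD_mul {U : A} (hU : IsEven U) (i : Fin 2) (x y : AddMonoidAlgebra A ℤ) :
    laurentD U i (x * y) = laurentD U i x * y + laurentPar x * laurentD U i y := by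
  induction x using laurent_induction (A := A) with
  | zero => simp
  | add x x' h h' =>
    rw [add_mul, map_add, h, h', map_add, map_add, add_mul, add_mul, add_add_add_comm]
  | single k a =>
    induction y using laurent_induction (A := A) with
    | zero => simp
    | add y y' h h' =>
      rw [mul_add, map_add, h, h', map_add, mul_add, mul_add, add_add_add_comm]
    | single l b =>
      rw [single_mul_single, laurentD_single, laurentD_single, laurentD_single, laurentPar_single,
        single_mul_single, single_mul_single, ← single_add, D_mul, par_mul]
      congr 1
      have h : D i U * b = par b * D i U := odd_mul (hU.par_D i) b
      rw [add_mul, mul_add, smul_mul_assoc, mul_smul_comm, mul_assoc, mul_assoc, h, add_smul]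
      abel

theorem par_laurentD {U : A} (hU : IsEven U) (i : Fin 2) (x : AddMonoidAlgebra A ℤ) :
    laurentPar (laurentD U i x) = -laurentD U i (laurentPar x) := by
  induction x using laurent_induction (A := A) with
  | zero => simp
  | add x x' h h' =>
    rw [map_add, map_add, h, h', map_add, map_add, neg_add]
  | single k a =>
    have h : par (D i U) = -D i U := hU.par_D i
    rw [laurentD_single, laurentPar_single, laurentPar_single, laurentD_single, ← single_neg]
    congr 1
    rw [par_add, par_D, neg_add, par, par, map_zsmul, ← par, ← par, par_mul, h, mul_neg, smul_neg]

/-- For i = j the difference cancels and the quadratic term contains the square of an odd field; for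
i ≠ j every extra term is antisymmetric in i and j. So the relations between D₁ and D₂ persist in
the extension. -/
theorem laurentD_laurentD {U : A} (hU : IsEven U) (i j : Fin 2) (k : ℤ) (a : A) :
    laurentD U i (laurentD U j (single k a)) = single k (D i (D j a) +
      (k • (a * D i (D j U)) + k • (par (D j a) * D i U - par (D i a) * D j U)
        - (k * k) • (a * (D j U * D i U)))) := by
  have h : par (D j U) = -D j U := hU.par_D j
  rw [laurentD_single, laurentD_single]
  congr 1
  have h' : par (k • (par a * D j U)) = -(k • (a * D j U)) := by
    rw [par, map_zsmul, ← par, par_mul, h, par_par, mul_neg, smul_neg]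
  rw [map_add, map_zsmul, D_mul, D_par, par_add, h', add_mul, smul_add, ← par, par_par, neg_mul,
    neg_mul, smul_mul_assoc]
  simp only [smul_neg, smul_sub, smul_add, mul_assoc, smul_smul]
  abel

variable {U : A} {hU : IsEven U}

noncomputable instance : Ring (ExpExt U hU) := inferInstanceAs (Ring (AddMonoidAlgebra A ℤ))

noncomputable instance : Algebra ℚ (ExpExt U hU) :=
  inferInstanceAs (Algebra ℚ (AddMonoidAlgebra A ℤ))

noncomputable instance : SuperFieldAlgebra (ExpExt U hU) where
  σ :=
    { (laurentPar : AddMonoidAlgebra A ℤ →+ AddMonoidAlgebra A ℤ) with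
      map_one' := (laurentPar_single 0 1).trans (by rw [par_one]; rfl)
      map_mul' := laurentPar_mul }
  σ_σ := laurentPar_laurentPar
  even_mul_comm x y h := by
    have h1 := laurent_add_par_mul_comm (A := A) x y
    have h2 : laurentPar (A := A) x = x := h
    rw [h2] at h1
    change (x + x) * y = y * (x + x) at h1
    rw [← two_smul ℚ, smul_mul_assoc, mul_smul_comm] at h1
    exact smul_right_injective _ (two_ne_zero (α := ℚ)) h1
  odd_mul_odd x y h h' := by
    have h1 := laurent_sub_par_mul_sub_par (A := A) x y
    have h2 : laurentPar (A := A) x = -x := h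
    have h3 : laurentPar (A := A) y = -y := h'
    rw [h2, h3] at h1
    change (x - -x) * (y - -y) = -((y - -y) * (x - -x)) at h1
    rw [sub_neg_eq_add, sub_neg_eq_add, ← two_smul ℚ, ← two_smul ℚ y, smul_mul_assoc,
      mul_smul_comm, smul_mul_assoc, mul_smul_comm, ← smul_neg, ← smul_neg] at h1
    exact smul_right_injective _ (two_ne_zero (α := ℚ))
      (smul_right_injective _ (two_ne_zero (α := ℚ)) h1)
  D i := laurentD U i
  σ_D := par_laurentD hU
  D_mul := laurentD_mul hU
  D_sq x := by
    change laurentD U 0 (laurentD U 0 x) = laurentD U 1 (laurentD U 1 x)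
    induction x using laurent_induction (A := A) with
    | zero => simp
    | add x x' h h' =>
      rw [map_add, map_add, h, h', map_add, map_add]
    | single k a =>
      rw [laurentD_laurentD hU, laurentD_laurentD hU, D_sq, D_sq, odd_mul_self (hU.par_D 0),
        odd_mul_self (hU.par_D 1), sub_self, sub_self]
  D_anticomm x := by
    change laurentD U 0 (laurentD U 1 x) = -laurentD U 1 (laurentD U 0 x)
    induction x using laurent_induction (A := A) with
    | zero => simp
    | add x x' h h' =>
      rw [map_add, map_add, h, h', map_add, map_add, neg_add]
    | single k a =>
      rw [laurentD_laurentD hU, laurentD_laurentD hU, D_anticomm, D_anticomm, ← single_neg,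
        odd_mul_odd (D 1 U) (D 0 U) (hU.par_D 1) (hU.par_D 0)]
      congr 1
      simp only [mul_neg, smul_neg, smul_sub]
      abel

/-- The exponential of `U`. -/
noncomputable def expUnit (U : A) (hU : IsEven U) : (ExpExt U hU)ˣ where
  val := (single 1 1 : AddMonoidAlgebra A ℤ)
  inv := (single (-1) 1 : AddMonoidAlgebra A ℤ)
  val_inv := (single_mul_single _ _ _ _).trans (by rw [add_neg_cancel, mul_one]; rfl)
  inv_val := (single_mul_single _ _ _ _).trans (by rw [neg_add_cancel, mul_one]; rfl)

/-- The inclusion of `A`. -/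
noncomputable def toExpExt (U : A) (hU : IsEven U) : SuperHom A (ExpExt U hU) where
  toRingHom := singleZeroRingHom
  ε := 1
  ε_mul_self := rfl
  map_par' a := (laurentPar_single 0 a).symm
  map_D' i a := by
    rw [one_smul]
    refine ((laurentD_single U i 0 a).trans ?_).symm
    rw [zero_smul, add_zero]
    rfl

theorem toExpExt_injective : Function.Injective (toExpExt U hU) := single_right_injective

theorem par_expUnit : par (expUnit U hU : ExpExt U hU) = expUnit U hU :=
  (laurentPar_single 1 1).trans (by rw [par_one]; rfl)

theorem isLog_expUnit : IsLog (toExpExt U hU U) (expUnit U hU) := by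
  refine ⟨(SuperHom.map_par _ _).symm.trans (congrArg _ hU), fun i => ?_⟩
  have h1 : D i (toExpExt U hU U) = (single 0 (D i U) : AddMonoidAlgebra A ℤ) :=
    (one_smul ℤ _).symm.trans ((toExpExt U hU).map_D i U).symm
  have h2 : D i (expUnit U hU : ExpExt U hU) = (single 1 (D i U) : AddMonoidAlgebra A ℤ) :=
    (laurentD_single U i 1 1).trans (by rw [D_one, par_one, zero_add, one_smul, one_mul])
  rw [h1, h2]
  exact ((single_mul_single _ _ _ _).trans (by rw [neg_add_cancel, one_mul])).symm

end ExpExt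

/-! ### Morphisms and the linearization of L_{2m} -/

namespace SuperHom

variable {A : Type u} {A' : Type v} [SuperFieldAlgebra A] [SuperFieldAlgebra A']
  (f : SuperHom A A')

/-- The extension of a morphism to dual numbers. -/
def onDual : SuperHom (DualNumber A) (DualNumber A') where
  toFun x := dual (f x.fst) (f x.snd)
  map_one' := dual_ext (map_one f.toRingHom) (map_zero f.toRingHom)
  map_mul' x y := dual_ext (map_mul f.toRingHom _ _) (by
    rw [snd_dual, dual_snd_mul, map_add, map_mul, map_mul]
    rfl)
  map_zero' := dual_ext (map_zero f.toRingHom) (map_zero f.toRingHom)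
  map_add' x y := dual_ext (map_add f.toRingHom _ _) (map_add f.toRingHom _ _)
  ε := f.ε
  ε_mul_self := f.ε_mul_self
  map_par' x := by rw [par_dual, fst_par, snd_par, map_par, map_par]
  map_D' i x := by
    rw [D_dual, fst_D, snd_D, map_D, map_D]
    rfl

theorem map_linL2m (hf : f.ε = 1) (U V : A) : f.map (linL2m U V) = linL2m (f U) (f V) := by
  have h : f.onDual.map (L2m (dual U V)) = L2m (dual (f U) (f V)) := f.onDual.map_L2m hf _
  rw [linL2m, linL2m, ← h]
  exact ext_coeff fun k s => by rw [sndOp_coeff, map_coeff, map_coeff, sndOp_coeff]; rfl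

theorem map_injective (hf : f.ε = 1) (h : Function.Injective f) : Function.Injective f.map := by
  intro P Q e
  refine ext_coeff fun k => ?_
  have e' := fun s => congrArg (fun X => X.coeff k s) e
  simp only [map_coeff] at e'
  refine forall_fin_four ?_ ?_ ?_ ?_
  · exact h (by simpa [sign_zero] using e' 0)
  · exact h (by simpa [sign_one, hf] using e' 1)
  · exact h (by simpa [sign_two, hf] using e' 2)
  · exact h (by simpa [sign_three] using e' 3)

end SuperHom

/-! ### The right-hand sides of the flows -/

section Flow

variable {A : Type u} [SuperFieldAlgebra A]

/-- The bosonic super field `-2 res`, where `res` is the zeroth order term of `R^n`. -/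
noncomputable def flow (R : PDO A) (n : ℕ) : A := -(2 : ℚ) • (R ^ n).coeff 0 0

theorem par_flow {U : A} (hU : IsEven U) {R : PDO A} (hR : IsSqrt R (L2m U)) (n : ℕ) :
    par (flow R n) = flow R n := by
  have h := congrArg (fun P => P.coeff 0 0) (map_pow opPar R n)
  rw [IsSqrt.opPar_eq hU hR, opPar_coeff] at h
  rw [flow, par_smul]
  exact congrArg _ ((one_smul ℤ _).symm.trans h)

/-- When U has an exponential, both sides have the same expression in terms of q(K) and q(K⁻¹). In
general A is embedded in the extension by an exponential; everything involved is natural and the map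
on operators is injective. -/
theorem lax_commutator {U : A} (hU : IsEven U) {R : PDO A} (hR : IsSqrt R (L2m U)) {n : ℕ}
    (hn : Odd n) :
    geOne (R ^ n) * L2m U - L2m U * geOne (R ^ n) = linL2m U (flow R n) := by
  set f := toExpExt U hU
  have hf : f.ε = 1 := rfl
  apply f.map_injective hf toExpExt_injective
  have hR' := f.map_isSqrt hR
  rw [f.map_L2m hf] at hR'
  have hF : f (flow R n) = flow (f.map R) n := by
    rw [flow, flow, map_rat_smul f.toRingHom, ← map_pow, f.map_coeff, f.sign_zero, one_smul]
  have hpar := par_flow isLog_expUnit.1 hR' n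
  rw [map_sub, map_mul, map_mul, f.map_geOne, f.map_L2m hf, map_pow, f.map_linL2m hf, hF,
    linL2m_of_isLog isLog_expUnit par_expUnit hpar,
    lax_commutator_of_isLog isLog_expUnit par_expUnit hR' hn (F := flow (f.map R) n) rfl]

end Flow

end SuperHD

namespace SuperHD

open SuperFieldAlgebra PDO

/-! ### Commutativity of the flows -/

section Commute

variable {A : Type u} [SuperFieldAlgebra A]

/-- Modulo negative degree J behaves like a scalar. -/
theorem fn_add_fn_mul_opJ_mul (a d a' d' : A) :
    (fn a + fn d * opJ) * (fn a' + fn d' * opJ)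
      - (fn (a * a') + fn (a * d') * opJ + fn (d * a') * opJ + fn (d * d') * (opJ * opJ))
      ∈ filt (-1) := by
  have h1 : fn d * (opJ * fn a' - fn a' * opJ) ∈ filt (-1) :=
    mul_mem_filt (p := 0) (fn_mem_filt _ le_rfl) (opJ_mul_fn_sub_mem_filt a')
  have h2 : fn d * ((opJ * fn d' - fn d' * opJ) * opJ) ∈ filt (-1) :=
    mul_mem_filt (p := 0) (fn_mem_filt _ le_rfl)
      (mul_mem_filt (q := 0) (opJ_mul_fn_sub_mem_filt d') opJ_mem_filt)
  have e : (fn a + fn d * opJ) * (fn a' + fn d' * opJ)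
      - (fn (a * a') + fn (a * d') * opJ + fn (d * a') * opJ + fn (d * d') * (opJ * opJ))
      = fn d * (opJ * fn a' - fn a' * opJ) + fn d * ((opJ * fn d' - fn d' * opJ) * opJ) := by
    simp only [← fn_mul_fn]
    noncomm_ring
  rw [e]
  exact add_mem h1 h2

/-- The removed parts are a + dJ and a' + d'J to leading order. As a and d are bosonic and J acts as
a scalar, they commute modulo negative degree, so their commutator has no zeroth order coefficient.
-/
theorem commutator_sub_geOne_mem_filt {Q Q' : PDO A} (hQ : opPar Q = Q) :
    (Q - geOne Q) * (Q' - geOne Q') - (Q' - geOne Q') * (Q - geOne Q) ∈ filt (-1) := by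
  have he : ∀ k, par (Q.coeff k 0) = Q.coeff k 0 := fun k => by
    have h := congrArg (fun P => P.coeff k 0) hQ
    rw [opPar_coeff] at h
    exact (one_smul ℤ _).symm.trans h
  have he3 : ∀ k, par (Q.coeff k 3) = Q.coeff k 3 := fun k => by
    have h := congrArg (fun P => P.coeff k 3) hQ
    rw [opPar_coeff] at h
    exact (one_smul ℤ _).symm.trans h
  have hN := sub_geOne_mem_filt_zero Q
  have hN' := sub_geOne_mem_filt_zero Q'
  have hZ := sub_geOne_mem_filt Q
  have hZ' := sub_geOne_mem_filt Q'
  have e1 := fn_add_fn_mul_opJ_mul (Q.coeff 0 0) (Q.coeff (-1) 3) (Q'.coeff 0 0) (Q'.coeff (-1) 3)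
  have e2 := fn_add_fn_mul_opJ_mul (Q'.coeff 0 0) (Q'.coeff (-1) 3) (Q.coeff 0 0) (Q.coeff (-1) 3)
  have hX : ∀ a d : A, fn a + fn d * opJ ∈ filt 0 := fun a d =>
    add_mem (fn_mem_filt _ le_rfl) (mul_mem_filt (p := 0) (fn_mem_filt _ le_rfl) opJ_mem_filt)
  have hX1 := hX (Q.coeff 0 0) (Q.coeff (-1) 3)
  have hX2 := hX (Q'.coeff 0 0) (Q'.coeff (-1) 3)
  have c1 := even_comm (he 0) (Q'.coeff 0 0)
  have c2 := even_comm (he 0) (Q'.coeff (-1) 3)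
  have c3 := even_comm (he3 (-1)) (Q'.coeff 0 0)
  have c4 := even_comm (he3 (-1)) (Q'.coeff (-1) 3)
  rw [c1, c2, c3, c4] at e1
  set N := Q - geOne Q
  set N' := Q' - geOne Q'
  set X := fn (Q.coeff 0 0) + fn (Q.coeff (-1) 3) * opJ
  set X' := fn (Q'.coeff 0 0) + fn (Q'.coeff (-1) 3) * opJ
  have h1 : (N - X) * N' ∈ filt (-1) := mul_mem_filt (q := 0) hZ hN'
  have h2 : X * (N' - X') ∈ filt (-1) := mul_mem_filt (p := 0) hX1 hZ'
  have h3 : (N' - X') * N ∈ filt (-1) := mul_mem_filt (q := 0) hZ' hN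
  have h4 : X' * (N - X) ∈ filt (-1) := mul_mem_filt (p := 0) hX2 hZ
  have h5 := sub_mem e1 e2
  have e : N * N' - N' * N = (N - X) * N' + X * (N' - X') - ((N' - X') * N + X' * (N - X))
      + (X * X' - X' * X) := by noncomm_ring
  rw [e]
  refine add_mem (sub_mem (add_mem h1 h2) (add_mem h3 h4)) ?_
  convert h5 using 1
  abel

/-- The symmetry behind the commutation of the flows. -/
theorem geOne_commutator_coeff_symm {Q Q' : PDO A} (h : Q * Q' = Q' * Q) (hQ : opPar Q = Q) :
    (geOne Q * Q' - Q' * geOne Q).coeff 0 0 = (geOne Q' * Q - Q * geOne Q').coeff 0 0 := by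
  have hN := commutator_sub_geOne_mem_filt (Q' := Q') hQ 0 0 (by simp [wt])
  -- With P, P' the differential parts and N, N' the rest, [P, Q'] = [P', Q] + [P, P'] - [N, N'] +
  -- [Q, Q']. The term [P, P'] has no zeroth order coefficient by the left ideal property, [N, N']
  -- has negative degree, and [Q, Q'] = 0.
  have e : geOne Q * Q' - Q' * geOne Q = (geOne Q' * Q - Q * geOne Q')
      + (geOne Q * geOne Q' - geOne Q' * geOne Q)
      - ((Q - geOne Q) * (Q' - geOne Q') - (Q' - geOne Q') * (Q - geOne Q))
      + (Q * Q' - Q' * Q) := by noncomm_ring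
  rw [e, h, sub_self, add_zero, sub_coeff, add_coeff, hN, sub_zero, sub_coeff (geOne Q * geOne Q'),
    (isDiff_geOne Q).mul_coeff_zero_zero (isDiff_geOne Q') (geOne_coeff_zero_zero Q'),
    (isDiff_geOne Q').mul_coeff_zero_zero (isDiff_geOne Q) (geOne_coeff_zero_zero Q),
    sub_zero, add_zero]

theorem linL2m_mem_filt (U V : A) : linL2m U V ∈ filt 2 := by
  have h : L2m (dual U V) - pd * pd ∈ filt 2 := L2m_sub_mem_filt _
  intro k s hk
  have h1 := congrArg TrivSqZeroExt.snd (h k s hk)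
  have h2 : ((pd * pd : PDO (DualNumber A)).coeff k s).snd = 0 := by
    rw [pd_mul_pd, mono_coeff]
    split_ifs <;> rfl
  rw [sub_coeff, TrivSqZeroExt.snd_sub, h2, sub_zero] at h1
  exact h1

/-- The square root along the infinitesimal flow. -/
theorem isSqrt_dualOp {U : A} (hU : IsEven U) {R : PDO A} (hR : IsSqrt R (L2m U)) {n : ℕ}
    (hn : Odd n) :
    IsSqrt (dualOp R (geOne (R ^ n) * R - R * geOne (R ^ n))) (L2m (dual U (flow R n))) := by
  have hlax := lax_commutator hU hR hn
  set P := geOne (R ^ n)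
  have hsq : R * (P * R - R * P) + (P * R - R * P) * R = linL2m U (flow R n) := by
    rw [← hlax, ← hR.1]
    noncomm_ring
  have hpd := hR.sub_pd_mem_filt (L2m_coeff_one_three U)
  -- [P, R] solves RT + TR = (derivative of L_{2m}), whose right side has degree at most 2. It
  -- therefore has degree at most 0, and the perturbed root still begins with ∂.
  have hT : P * R - R * P ∈ filt (2 - 2) :=
    mem_filt_of_mul_add_mul hpd hpd (by rw [hsq]; exact linL2m_mem_filt _ _)
  have hc : ∀ k s, 0 < k → (P * R - R * P).coeff k s = 0 := fun k s hk => by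
    refine hT k s ?_
    have : 0 ≤ wt s := by fin_cases s <;> simp [wt]
    omega
  refine ⟨?_, ?_, fun k hk => ?_⟩
  · rw [dualOp_mul, hsq, hR.1, L2m_dual]
  · funext s
    rw [dualOp_coeff, hc 1 s one_pos, hR.2.1]
    revert s
    exact forall_fin_four rfl rfl rfl rfl
  · funext s
    rw [dualOp_coeff, hc k s (by omega), hR.2.2 k hk]
    rfl

theorem dualOp_commutator_pow (P R : PDO A) (m : ℕ) :
    dualOp R (P * R - R * P) ^ m = dualOp (R ^ m) (P * R ^ m - R ^ m * P) := by
  induction m with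
  | zero =>
    rw [pow_zero, pow_zero, mul_one, one_mul, sub_self, ← inlHom_map, map_one]
  | succ m ih =>
    rw [pow_succ, ih, dualOp_mul, pow_succ]
    congr 1
    noncomm_ring

theorem flow_dualOp (P R : PDO A) (m : ℕ) :
    flow (dualOp R (P * R - R * P)) m =
      dual (flow R m) (-(2 : ℚ) • (P * R ^ m - R ^ m * P).coeff 0 0) := by
  rw [flow, dualOp_commutator_pow]
  rfl

/-- The variation of the m-th flow along the n-th is -2 times the zeroth order coefficient of
[(Rⁿ)_{≥1}, R^m], to which the symmetry of commuting powers applies. -/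
theorem snd_flow_symm {U : A} (hU : IsEven U) {R : PDO A} (hR : IsSqrt R (L2m U)) (m n : ℕ) :
    (flow (dualOp R (geOne (R ^ n) * R - R * geOne (R ^ n))) m).snd =
      (flow (dualOp R (geOne (R ^ m) * R - R * geOne (R ^ m))) n).snd := by
  rw [flow_dualOp, flow_dualOp, snd_dual, snd_dual, geOne_commutator_coeff_symm]
  · rw [← pow_add, ← pow_add, add_comm]
  · rw [map_pow, IsSqrt.opPar_eq hU hR]

/-- First order Taylor expansion: the dual part of a differential polynomial at U + εV is its
Fréchet derivative. -/
theorem DiffPoly.eval_dual (V p : DiffPoly) (U : A) :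
    p.eval (dual U (V.eval U)) = dual (p.eval U) ((V.lin p).eval U) := by
  induction p with
  | U => rfl
  | D i p ih => rw [eval, ih, D_dual]; rfl
  | smul r p ih => rw [eval, ih]; rfl
  | add p q ihp ihq => rw [eval, ihp, ihq]; rfl
  | mul p q ihp ihq => rw [eval, ihp, ihq, dual_mul_dual, add_comm]; rfl

theorem DiffPoly.lin_eval (V p : DiffPoly) (U : A) :
    (V.lin p).eval U = (p.eval (dual U (V.eval U))).snd := by
  rw [eval_dual, snd_dual]

end Commute

/-! ### The Lax equation in terms of the flow -/

section Lax

variable {A : Type u} [SuperFieldAlgebra A] {U : A} {R : PDO A} {n : ℕ}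

theorem laxEquation_iff (hU : IsEven U) (hR : IsSqrt R (L2m U)) (hn : Odd n)
    (δ : TimeDerivation A) : LaxEquation n δ U R ↔ linL2m U (δ.d U) = linL2m U (flow R n) := by
  rw [LaxEquation, δ.onPDO_L2m, ← lax_commutator hU hR hn]

theorem LaxEquation.dd_eq (hU : IsEven U) (hR : IsSqrt R (L2m U)) (hn : Odd n)
    {δ : TimeDerivation A} (h : LaxEquation n δ U R) : dd (δ.d U) = dd (flow R n) := by
  have e := congrArg (fun P => P.coeff 1 0) ((laxEquation_iff hU hR hn δ).1 h)
  rwa [linL2m_coeff_one_zero, linL2m_coeff_one_zero, neg_inj] at e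

end Lax

/-- The flows given by differential polynomials commute. -/
theorem lin_eval_symm {F : ℕ → DiffPoly}
    (hF : ∀ n, Odd n → ∀ (A : Type u) [SuperFieldAlgebra A] (U : A), IsEven U →
      ∀ R : PDO A, IsSqrt R (L2m U) → (F n).eval U = flow R n)
    {m n : ℕ} (hm : Odd m) (hn : Odd n) {A : Type u} [SuperFieldAlgebra A] {U : A}
    (hU : IsEven U) : ((F m).lin (F n)).eval U = ((F n).lin (F m)).eval U := by
  obtain ⟨R, hR, -⟩ := existsUnique_isSqrt U
  -- `hF` is applied over the dual numbers, at U + εF_l(U), where the root is the one supplied by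
  -- `isSqrt_dualOp`.
  have h : ∀ k l, Odd k → Odd l → (F k).eval (dual U ((F l).eval U)) =
      flow (dualOp R (geOne (R ^ l) * R - R * geOne (R ^ l))) k := fun k l hk hl => by
    rw [hF l hl A U hU R hR]
    refine hF k hk _ _ ?_ _ (isSqrt_dualOp hU hR hl)
    rw [IsEven, par_dual, hU, par_flow hU hR]
  rw [DiffPoly.lin_eval, DiffPoly.lin_eval, h n m hn hm, h m n hm hn, snd_flow_symm hU hR]

end SuperHD

namespace SuperHD

open SuperFieldAlgebra PDO

/-! ### Universal differential polynomials -/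

/-- An algebra of super fields with a bosonic super field. -/
structure Pointed : Type (u + 1) where
  carrier : Type u
  [inst : SuperFieldAlgebra carrier]
  U : carrier
  even : IsEven U

attribute [instance] Pointed.inst

namespace DiffPoly

/-- The expression of the parity of a differential polynomial. -/
def parity : DiffPoly → DiffPoly
  | U => U
  | D i p => smul (-1) (D i (parity p))
  | smul r p => smul r (parity p)
  | add p q => add (parity p) (parity q)
  | mul p q => mul (parity p) (parity q)

theorem parity_eval {A : Type u} [SuperFieldAlgebra A] {f : A} (hf : IsEven f) (p : DiffPoly) :
    (parity p).eval f = par (p.eval f) := by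
  induction p with
  | U => exact hf.symm
  | D i p ih => rw [parity, eval, eval, eval, ih, par_D, neg_smul, one_smul]
  | smul r p ih => rw [parity, eval, eval, ih, par_smul]
  | add p q ihp ihq => rw [parity, eval, eval, ihp, ihq, par_add]
  | mul p q ihp ihq => rw [parity, eval, eval, ihp, ihq, par_mul]

theorem eval_zero {A : Type u} [SuperFieldAlgebra A] (p : DiffPoly) : p.eval (0 : A) = 0 := by
  induction p with
  | U => rfl
  | D i p ih => rw [eval, ih, map_zero]
  | smul r p ih => rw [eval, ih, smul_zero]
  | add p q ihp ihq => rw [eval, ihp, ihq, add_zero]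
  | mul p q ihp ihq => rw [eval, ihp, ihq, mul_zero]

end DiffPoly

/-- The algebra of the differential polynomials, with constant term, in a bosonic super field,
as functions of the super field. -/
def universalFields : Subalgebra ℚ (∀ X : Pointed.{u}, X.carrier) where
  carrier := {x | ∃ (c : ℚ) (p : DiffPoly), ∀ X : Pointed.{u}, x X = c • 1 + p.eval X.U}
  mul_mem' := by
    rintro x y ⟨c, p, hx⟩ ⟨d, q, hy⟩
    refine ⟨c * d, .add (.add (.smul c q) (.smul d p)) (.mul p q), fun X => ?_⟩
    rw [Pi.mul_apply, hx, hy]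
    simp only [DiffPoly.eval, add_mul, mul_add, smul_mul_smul_comm, smul_mul_assoc, mul_smul_comm,
      one_mul, mul_one, smul_add, mul_smul]
    rw [smul_comm d c]
    abel
  add_mem' := by
    rintro x y ⟨c, p, hx⟩ ⟨d, q, hy⟩
    refine ⟨c + d, .add p q, fun X => ?_⟩
    rw [Pi.add_apply, hx, hy, DiffPoly.eval, add_smul, add_add_add_comm]
  algebraMap_mem' r := ⟨r, .smul 0 .U, fun X => by
    rw [DiffPoly.eval, zero_smul, add_zero, Pi.algebraMap_apply, Algebra.algebraMap_eq_smul_one]⟩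

instance : SuperFieldAlgebra universalFields.{u} where
  σ :=
    { toFun := fun x => ⟨fun X => par (x.1 X), by
        obtain ⟨c, p, hx⟩ := x.2
        exact ⟨c, p.parity, fun X => by
          beta_reduce
          rw [hx, par_add, par_smul, par_one, p.parity_eval X.even]⟩⟩
      map_one' := Subtype.ext (funext fun X => par_one)
      map_mul' := fun x y => Subtype.ext (funext fun X => par_mul _ _)
      map_zero' := Subtype.ext (funext fun X => par_zero)
      map_add' := fun x y => Subtype.ext (funext fun X => par_add _ _) }
  σ_σ x := Subtype.ext (funext fun X => σ_σ _)
  even_mul_comm x y h := Subtype.ext (funext fun X =>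
    even_mul_comm _ _ (congrFun (congrArg Subtype.val h) X))
  odd_mul_odd x y h h' := Subtype.ext (funext fun X =>
    odd_mul_odd _ _ (congrFun (congrArg Subtype.val h) X) (congrFun (congrArg Subtype.val h') X))
  D i :=
    { toFun := fun x => ⟨fun X => D i (x.1 X), by
        obtain ⟨c, p, hx⟩ := x.2
        exact ⟨0, .D i p, fun X => by
          beta_reduce
          rw [hx, map_add, D_smul, D_one, smul_zero, zero_add, zero_smul, zero_add]
          rfl⟩⟩
      map_zero' := Subtype.ext (funext fun X => map_zero _)
      map_add' := fun x y => Subtype.ext (funext fun X => map_add _ _ _) }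
  σ_D i x := Subtype.ext (funext fun X => σ_D _ _)
  D_mul i x y := Subtype.ext (funext fun X => D_mul _ _ _)
  D_sq x := Subtype.ext (funext fun X => D_sq _)
  D_anticomm x := Subtype.ext (funext fun X => D_anticomm _)

/-- The universal bosonic super field. -/
def universalU : universalFields.{u} :=
  ⟨fun X => X.U, 0, .U, fun X => by rw [zero_smul, zero_add]; rfl⟩

/-- Evaluation at a bosonic super field. -/
def evalAt (X : Pointed.{u}) : SuperHom universalFields.{u} X.carrier where
  toFun x := x.1 X
  map_one' := rfl
  map_mul' _ _ := rfl
  map_zero' := rfl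
  map_add' _ _ := rfl
  ε := 1
  ε_mul_self := rfl
  map_par' _ := rfl
  map_D' i x := (one_smul ℤ (D i (x.1 X))).symm

theorem pd_pow (A : Type u) [SuperFieldAlgebra A] (n : ℕ) : (pd : PDO A) ^ n = mono 1 n 0 := by
  induction n with
  | zero => rfl
  | succ n ih =>
    rw [pow_succ', ih, pd_mul, ddL_mono_one]
    rw [Nat.cast_succ, add_comm]

theorem L2m_zero {A : Type u} [SuperFieldAlgebra A] : L2m (0 : A) = pd * pd := by
  rw [pd_mul_pd, L2m]
  simp only [dd_zero, map_zero, mul_zero, zero_mul, smul_zero, sub_zero, add_zero, mono_zero]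

theorem isSqrt_pd {A : Type u} [SuperFieldAlgebra A] : IsSqrt pd (L2m (0 : A)) := by
  refine ⟨L2m_zero.symm, ?_, fun k hk => ?_⟩
  · funext s
    rw [pd, mono_coeff]
    revert s
    exact forall_fin_four (by simp) (by simp) (by simp) (by simp)
  · funext s
    rw [pd, mono_coeff, if_neg (by omega)]
    rfl

/-- The zeroth order terms of the odd powers of `L_{2m}^{1/2}` are differential polynomials. -/
theorem exists_diffPoly_eval_eq_flow {n : ℕ} (hn : Odd n) :
    ∃ F : DiffPoly, ∀ (A : Type u) [SuperFieldAlgebra A] (U : A), IsEven U →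
      ∀ R : PDO A, IsSqrt R (L2m U) → F.eval U = flow R n := by
  -- Over the universal algebra every coefficient of the root is by construction a constant plus a
  -- differential polynomial. Evaluation at any bosonic field maps this root to the root there.
  obtain ⟨R₀, hR₀, -⟩ := existsUnique_isSqrt universalU.{u}
  obtain ⟨c, p, h⟩ := (flow R₀ n).2
  have key : ∀ (A : Type u) [SuperFieldAlgebra A] (U : A), IsEven U →
      ∀ R : PDO A, IsSqrt R (L2m U) → flow R n = c • 1 + p.eval U := by
    intro A _ U hU R hR
    have h1 := (evalAt ⟨A, U, hU⟩).map_isSqrt hR₀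
    rw [SuperHom.map_L2m _ rfl] at h1
    have h2 : R = (evalAt ⟨A, U, hU⟩).map R₀ := hR.eq h1 (L2m_coeff_one_three U)
    rw [h2, ← h ⟨A, U, hU⟩, flow, flow, ← map_pow, SuperHom.map_coeff]
    exact congrArg _ (one_smul ℤ _)
  -- At U = 0 the root is ∂, and ∂ⁿ with n odd has no zeroth order term, so the constant disappears.
  -- This is concluded in each A separately, which also covers the zero algebra.
  have hc : ∀ (A : Type u) [SuperFieldAlgebra A], c • (1 : A) = 0 := by
    intro A _
    have h0 := key A 0 par_zero pd isSqrt_pd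
    obtain ⟨k, rfl⟩ := hn
    rwa [p.eval_zero, add_zero, flow, pd_pow, mono_coeff, if_neg (by omega), smul_zero,
      eq_comm] at h0
  exact ⟨p, fun A _ U hU R hR => by rw [key A U hU R hR, hc, zero_add]⟩

end SuperHD

namespace SuperHD

open SuperFieldAlgebra PDO

/-! ### The action of differential operators -/

section Action

variable {A : Type u} [SuperFieldAlgebra A]

theorem ddL_fn_coeff (k : ℕ) (f : A) : (ddL k (fn f)).coeff 0 0 = dd^[k] f := by
  rw [ddL_coeff_eq_sum k _ 0 0 (k + 1) fun j hj => by rw [fn_coeff, if_neg (by omega)],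
    Finset.sum_range_succ, Finset.sum_eq_zero fun j hj => by
      rw [Finset.mem_range] at hj
      rw [fn_coeff, if_neg (by omega), dd_iterate_zero, smul_zero],
    zero_add, fn_coeff, if_pos (by simp), Ring.choose_natCast, Nat.choose_self]
  simp

theorem ddL_fn_coeff_of_ne {k m : ℤ} {s : Fin 4} (f : A) (h : s ≠ 0 ∨ k < m) :
    (ddL k (fn f)).coeff m s = 0 := by
  rw [ddL_coeff_eq_sum k _ m s 0 fun j _ => by rw [fn_coeff, if_neg (by omega)],
    Finset.sum_range_zero]

/-- The action on super fields in terms of the product of operators. -/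
theorem act_eq_coeff (P : PDO A) (f : A) : act P f = (P * fn f).coeff 0 0 := by
  have hterm : ∀ k : ℤ, (mulTerm P (fn f) k).coeff 0 0 =
      P.coeff k 0 * (ddL k (fn f)).coeff 0 0 + P.coeff k 1 * D 0 ((ddL k (fn f)).coeff 0 0)
        + P.coeff k 2 * D 1 ((ddL k (fn f)).coeff 0 0)
        + P.coeff k 3 * D 0 (D 1 ((ddL k (fn f)).coeff 0 0)) := by
    intro k
    have h1 : ∀ m, (ddL k (fn f)).coeff m 1 = 0 := fun m => ddL_fn_coeff_of_ne f (.inl (by simp))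
    have h2 : ∀ m, (ddL k (fn f)).coeff m 2 = 0 := fun m => ddL_fn_coeff_of_ne f (.inl (by simp))
    have h3 : ∀ m, (ddL k (fn f)).coeff m 3 = 0 := fun m => ddL_fn_coeff_of_ne f (.inl (by simp))
    simp only [mulTerm, Fin.sum_univ_four, add_coeff, fnL_coeff, eL_zero, eL_one, eL_two, eL_three,
      d1L_coeff_zero, d2L_coeff_zero, d2L_coeff_one, h1, h2, h3, map_zero, par_zero, add_zero,
      sub_zero]
  have hneg : ∀ k : ℤ, k < 0 → (mulTerm P (fn f) k).coeff 0 0 = 0 := fun k hk => by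
    rw [hterm, ddL_fn_coeff_of_ne f (.inr hk)]
    simp
  rw [mul_coeff, act]
  have e : ∀ k : ℕ, P.coeff k 0 * dd^[k] f + P.coeff k 1 * D 0 (dd^[k] f)
      + P.coeff k 2 * D 1 (dd^[k] f) + P.coeff k 3 * D 0 (D 1 (dd^[k] f)) =
      (mulTerm P (fn f) k).coeff 0 0 := fun k => by rw [hterm, ddL_fn_coeff]
  rw [finsum_congr e, ← finsum_mem_range (f := fun k : ℤ => (mulTerm P (fn f) k).coeff 0 0)
    Nat.cast_injective]
  refine finsum_congr fun k => ?_
  by_cases hk : k < 0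
  · simp [hneg k hk]
  · lift k to ℕ using not_lt.1 hk
    simp

/-- Subtracting its zeroth order coefficient from Qf leaves an operator without zeroth order term.
By the left ideal property, `P` times that has none either. -/
theorem act_mul {P Q : PDO A} (hP : IsDiff P) (hQ : IsDiff Q) (f : A) :
    act (P * Q) f = act P (act Q f) := by
  have hQf : IsDiff (Q * fn f) := hQ.mul (isDiff_fn f)
  have h := hP.mul_coeff_zero_zero (hQf.sub (isDiff_fn ((Q * fn f).coeff 0 0)))
    (by rw [sub_coeff, fn_coeff, if_pos ⟨rfl, rfl⟩, sub_self])
  rw [mul_sub, sub_coeff, sub_eq_zero] at h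
  rw [act_eq_coeff, act_eq_coeff, act_eq_coeff, mul_assoc, h]

theorem act_add (P Q : PDO A) (f : A) : act (P + Q) f = act P f + act Q f := by
  rw [act_eq_coeff, act_eq_coeff, act_eq_coeff, add_mul, add_coeff]

theorem act_smul (c : ℚ) (P : PDO A) (f : A) : act (c • P) f = c • act P f := by
  rw [act_eq_coeff, act_eq_coeff, smul_mul_assoc, smul_coeff]

theorem act_fn (a f : A) : act (fn a) f = a * f := by
  rw [act_eq_coeff, fn_mul_fn, fn_coeff, if_pos ⟨rfl, rfl⟩]

theorem act_Dop (i : Fin 2) (f : A) : act (Dop i) f = D i f := by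
  rw [act_eq_coeff, Dop_mul_fn, add_coeff, fn_mul_coeff, Dop_coeff_zero_zero, mul_zero, add_zero,
    fn_coeff, if_pos ⟨rfl, rfl⟩]

theorem act_pd (f : A) : act pd f = D 0 (D 0 f) := by
  rw [← Dop_mul_self 0, act_mul (isDiff_Dop 0) (isDiff_Dop 0), act_Dop, act_Dop]

end Action

/-! ### Superconformal transformations -/

section Superconformal

variable {A : Type u} [SuperFieldAlgebra A]

/-- The commutative ring of bosonic super fields. -/
def evenSubring (A : Type u) [SuperFieldAlgebra A] : Subring A where
  carrier := {a | par a = a}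
  mul_mem' ha hb := by rw [Set.mem_ofPred_eq, par_mul, ha, hb]
  one_mem' := par_one
  add_mem' ha hb := by rw [Set.mem_ofPred_eq, par_add, ha, hb]
  zero_mem' := par_zero
  neg_mem' ha := by rw [Set.mem_ofPred_eq, par_neg, ha]

/-- Super fields become a module over a commutative ring, so identities with bosonic coefficients
come within reach of `ring`, `module` and `linear_combination`. -/
instance : CommRing (evenSubring A) :=
  { (inferInstance : Ring (evenSubring A)) with
    mul_comm := fun a b => Subtype.ext (even_comm a.2 b.1) }

theorem even_mul_eq_smul (e : evenSubring A) (a : A) : (e : A) * a = e • a := rfl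

theorem mul_even_eq_smul (e : evenSubring A) (a : A) : a * e = e • a := (even_comm e.2 a).symm

theorem D_even_smul (i : Fin 2) (e : evenSubring A) (a : A) :
    D i (e • a) = D i (e : A) * a + e • D i a := by
  rw [← even_mul_eq_smul, D_mul]
  congr 2
  exact e.2

theorem D_even_mul (i : Fin 2) (e e' : evenSubring A) :
    D i ((e * e' : evenSubring A) : A) = e' • D i (e : A) + e • D i (e' : A) := by
  rw [Subring.coe_mul, even_mul_eq_smul, D_even_smul, mul_even_eq_smul]

theorem fn_Dop_mul_fn_Dop (a b : A) (a' b' : evenSubring A) :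
    (fn a * Dop 0 + fn b * Dop 1) * (fn (a' : A) * Dop 0 + fn (b' : A) * Dop 1) =
      fn (a * a' + b * b') * pd + fn (a * D 0 (a' : A) + b * D 1 (a' : A)) * Dop 0
        + fn (a * D 0 (b' : A) + b * D 1 (b' : A)) * Dop 1
        + fn (a * b' - b * a') * (Dop 0 * Dop 1) := by
  have h1 : par (a' : A) = a' := a'.2
  have h2 : par (b' : A) = b' := b'.2
  simp only [add_mul, mul_add, mul_assoc, Dop_mul_fn_mul, h1, h2, Dop_mul_self,
    Dop_one_mul_Dop_zero, fn_mul_fn_mul, fn_add, fn_sub, sub_mul, mul_neg]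
  abel

theorem D_confFactor {p q k : evenSubring A} (hk : k = p * p + q * q) (i : Fin 2) :
    D i (k : A) = (2 : evenSubring A) • (p • D i (p : A) + q • D i (q : A)) := by
  rw [hk, Subring.coe_add, map_add, D_even_mul, D_even_mul]
  module

/-- Here p = D₁θ₁ and q = D₂θ₁; the left factors are 𝒟₁, 𝒟₂ and the right factors K²𝒟₁, K²𝒟₂. The
Cauchy–Riemann type relations between p and q turn the first order terms into derivatives of K, and
the D₁D₂ terms cancel in the sum. -/
theorem confD_sum {p q k ki : evenSubring A} (h0 : D 0 (q : A) = -D 1 (p : A))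
    (h1 : D 1 (q : A) = D 0 (p : A)) (hk : k = p * p + q * q) (hki : ki * k = 1) :
    (fn ((ki * p : evenSubring A) : A) * Dop 0 + fn ((ki * q : evenSubring A) : A) * Dop 1) *
        (fn ((k * p : evenSubring A) : A) * Dop 0 + fn ((k * q : evenSubring A) : A) * Dop 1)
      + (fn ((-(ki * q) : evenSubring A) : A) * Dop 0 + fn ((ki * p : evenSubring A) : A) * Dop 1) *
        (fn ((-(k * q) : evenSubring A) : A) * Dop 0 + fn ((k * p : evenSubring A) : A) * Dop 1)
      = (2 : ℚ) • qop (k : A) := by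
  have e0 : ((ki * p : evenSubring A) : A) * (k * p : evenSubring A)
      + ((ki * q : evenSubring A) : A) * (k * q : evenSubring A)
      + (((-(ki * q) : evenSubring A) : A) * (-(k * q) : evenSubring A)
      + ((ki * p : evenSubring A) : A) * (k * p : evenSubring A)) = (2 : ℚ) • (k : A) := by
    rw [two_smul]
    norm_cast
    linear_combination 2 * k * hki - 2 * ki * k * hk
  have e1 : ((ki * p : evenSubring A) : A) * D 0 ((k * p : evenSubring A) : A)
      + ((ki * q : evenSubring A) : A) * D 1 ((k * p : evenSubring A) : A)
      + (((-(ki * q) : evenSubring A) : A) * D 0 ((-(k * q) : evenSubring A) : A)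
      + ((ki * p : evenSubring A) : A) * D 1 ((-(k * q) : evenSubring A) : A))
      = D 0 (k : A) := by
    simp only [Subring.coe_neg, map_neg, D_even_mul, even_mul_eq_smul, h0, h1, neg_mul, mul_neg,
      neg_neg]
    linear_combination (norm := module) hki • D 0 (k : A) - (ki • hk) • D 0 (k : A)
  have e2 : ((ki * p : evenSubring A) : A) * D 0 ((k * q : evenSubring A) : A)
      + ((ki * q : evenSubring A) : A) * D 1 ((k * q : evenSubring A) : A)
      + (((-(ki * q) : evenSubring A) : A) * D 0 ((k * p : evenSubring A) : A)
      + ((ki * p : evenSubring A) : A) * D 1 ((k * p : evenSubring A) : A))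
      = D 1 (k : A) := by
    simp only [Subring.coe_neg, map_neg, D_even_mul, even_mul_eq_smul, h0, h1, neg_mul, mul_neg,
      neg_neg]
    linear_combination (norm := module) hki • D 1 (k : A) - (ki • hk) • D 1 (k : A)
  have e3 : ((ki * p : evenSubring A) : A) * (k * q : evenSubring A)
      - ((ki * q : evenSubring A) : A) * (k * p : evenSubring A)
      + (((-(ki * q) : evenSubring A) : A) * (k * p : evenSubring A)
      - ((ki * p : evenSubring A) : A) * (-(k * q) : evenSubring A)) = 0 := by
    norm_cast
    ring
  have key : ∀ a b c d a' b' c' d' : A, fn a * pd + fn b * Dop 0 + fn c * Dop 1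
      + fn d * (Dop 0 * Dop 1) + (fn a' * pd + fn b' * Dop 0 + fn c' * Dop 1
      + fn d' * (Dop 0 * Dop 1)) = fn (a + a') * pd + fn (b + b') * Dop 0 + fn (c + c') * Dop 1
      + fn (d + d') * (Dop 0 * Dop 1) := fun a b c d a' b' c' d' => by
    simp only [fn_add, add_mul]
    abel
  rw [fn_Dop_mul_fn_Dop, fn_Dop_mul_fn_Dop, qop_eq k.2, key, e0, e1, e2, e3, fn_zero, zero_mul,
    fn_smul, smul_mul_assoc]
  module

/-- This is the pull-back of ∂_x = 𝒟₁². The first order coefficients become half the derivatives of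
K⁻¹ by the same relations between p and q. -/
theorem confD_sq {p q k ki : evenSubring A} (h0 : D 0 (q : A) = -D 1 (p : A))
    (h1 : D 1 (q : A) = D 0 (p : A)) (hk : k = p * p + q * q) (hki : ki * k = 1)
    (hDi : ∀ i, D i (ki : A) = -((ki * ki) • D i (k : A))) :
    (fn ((ki * p : evenSubring A) : A) * Dop 0 + fn ((ki * q : evenSubring A) : A) * Dop 1) *
        (fn ((ki * p : evenSubring A) : A) * Dop 0 + fn ((ki * q : evenSubring A) : A) * Dop 1)
      = qop (ki : A) := by
  have e0 : ((ki * p : evenSubring A) : A) * (ki * p : evenSubring A)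
      + ((ki * q : evenSubring A) : A) * (ki * q : evenSubring A) = ki := by
    norm_cast
    linear_combination ki * hki - (ki * ki) * hk
  have e1 : ((ki * p : evenSubring A) : A) * D 0 ((ki * p : evenSubring A) : A)
      + ((ki * q : evenSubring A) : A) * D 1 ((ki * p : evenSubring A) : A)
      = (1 / 2 : ℚ) • D 0 (ki : A) := by
    rw [eq_comm, one_div, inv_smul_eq_iff₀ two_ne_zero, two_smul]
    simp only [D_even_mul, even_mul_eq_smul, hDi, D_confFactor hk, h0, h1]
    linear_combination (norm := module) (4 * ki * ki * p) • hki • D 0 (p : A)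
      - (4 * ki * ki * ki * p) • hk • D 0 (p : A)
  have e2 : ((ki * p : evenSubring A) : A) * D 0 ((ki * q : evenSubring A) : A)
      + ((ki * q : evenSubring A) : A) * D 1 ((ki * q : evenSubring A) : A)
      = (1 / 2 : ℚ) • D 1 (ki : A) := by
    rw [eq_comm, one_div, inv_smul_eq_iff₀ two_ne_zero, two_smul]
    simp only [D_even_mul, even_mul_eq_smul, hDi, D_confFactor hk, h0, h1]
    linear_combination (norm := module) (4 * ki * ki * q) • hki • D 0 (p : A)
      - (4 * ki * ki * ki * q) • hk • D 0 (p : A)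
  have e3 : ((ki * p : evenSubring A) : A) * (ki * q : evenSubring A)
      - ((ki * q : evenSubring A) : A) * (ki * p : evenSubring A) = 0 := by
    norm_cast
    ring
  rw [fn_Dop_mul_fn_Dop, qop_eq ki.2, e0, e1, e2, e3, fn_zero, zero_mul, fn_smul, fn_smul,
    smul_mul_assoc, smul_mul_assoc]
  module

end Superconformal

/-! ### The Harry Dym operator under a superconformal transformation -/

namespace SuperDiffeo

variable {A : Type u} {B : Type v} [SuperFieldAlgebra A] [SuperFieldAlgebra B] {c : Coordinates B}
  {φ : SuperDiffeo A c} {K : Aˣ} {U : A}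

theorem par_pull_θ (φ : SuperDiffeo A c) (j : Fin 2) :
    par (φ.pull (c.θ j)) = -φ.pull (c.θ j) := by
  rw [← φ.pull_σ, c.θ_odd, map_neg]

theorem par_D_pull_θ (φ : SuperDiffeo A c) (i j : Fin 2) :
    par (D i (φ.pull (c.θ j))) = D i (φ.pull (c.θ j)) := by
  rw [par_D, par_pull_θ, map_neg, neg_neg]

theorem par_confFactor (φ : SuperDiffeo A c) : par φ.confFactor = φ.confFactor := by
  simp only [confFactor, pow_two, par_add, par_mul, par_D_pull_θ]

theorem IsSuperconformal.D_pull (hφ : φ.IsSuperconformal) (k : Fin 2) (f : B) :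
    D k (φ.pull f) = ∑ j, D k (φ.pull (c.θ j)) * φ.pull (D j f) := by
  rw [φ.chain_rule, ← hφ.1 k, sub_self, zero_mul, zero_add]

theorem isDiff_newD (φ : SuperDiffeo A c) (a : A) (i : Fin 2) : IsDiff (φ.newD a i) := by
  rw [newD]
  split_ifs <;>
  exact (isDiff_fn _).mul (((isDiff_fn _).mul (isDiff_Dop 0)).add ((isDiff_fn _).mul (isDiff_Dop 1)))

theorem newD_zero (φ : SuperDiffeo A c) (a : A) : φ.newD a 0 =
    fn a * (fn (D 0 (φ.pull (c.θ 0))) * Dop 0 + fn (D 1 (φ.pull (c.θ 0))) * Dop 1) := if_pos rfl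

theorem newD_one (φ : SuperDiffeo A c) (a : A) : φ.newD a 1 =
    fn a * (fn (-D 1 (φ.pull (c.θ 0))) * Dop 0 + fn (D 0 (φ.pull (c.θ 0))) * Dop 1) :=
  if_neg (by simp)

theorem act_fn_mul_fn_Dop (a b d f : A) :
    act (fn a * (fn b * Dop 0 + fn d * Dop 1)) f = a * (b * D 0 f + d * D 1 f) := by
  have h0 := (isDiff_fn b).mul (isDiff_Dop (A := A) 0)
  have h1 := (isDiff_fn d).mul (isDiff_Dop (A := A) 1)
  rw [act_mul (isDiff_fn a) (h0.add h1), act_fn, act_add, act_mul (isDiff_fn b) (isDiff_Dop 0),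
    act_mul (isDiff_fn d) (isDiff_Dop 1), act_fn, act_fn, act_Dop, act_Dop]

/-- The super derivatives of the new coordinates. -/
theorem IsSuperconformal.pull_D (hφ : φ.IsSuperconformal) (hK : (K : A) = φ.confFactor)
    (i : Fin 2) (f : B) : φ.pull (D i f) = act (φ.newD (↑K⁻¹ : A) i) (φ.pull f) := by
  have hp := par_D_pull_θ φ 0 0
  have hq := par_D_pull_θ φ 1 0
  -- The chain rule gives a linear system for the pull-backs of 𝒟₁f and 𝒟₂f with matrix rows (p, -q)
  -- and (q, p), whose determinant is K.
  have h0 := hφ.D_pull 0 f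
  have h1 := hφ.D_pull 1 f
  rw [Fin.sum_univ_two, hφ.2.1] at h0
  rw [Fin.sum_univ_two, hφ.2.2] at h1
  rw [confFactor, pow_two, pow_two] at hK
  have hc := even_comm hp (D 1 (φ.pull (c.θ 0)))
  have key : ∀ x y : A, (K : A) * x = y → x = (↑K⁻¹ : A) * y := fun x y h => by
    rw [← h, Units.inv_mul_cancel_left]
  fin_cases i
  · change φ.pull (D 0 f) = act (φ.newD (↑K⁻¹ : A) 0) (φ.pull f)
    rw [newD_zero, act_fn_mul_fn_Dop, h0, h1]
    refine key _ _ ?_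
    rw [hK, mul_add, mul_add, ← mul_assoc, ← mul_assoc, ← mul_assoc, ← mul_assoc, mul_neg, neg_mul,
      hc, add_mul]
    abel
  · change φ.pull (D 1 f) = act (φ.newD (↑K⁻¹ : A) 1) (φ.pull f)
    rw [newD_one, act_fn_mul_fn_Dop, h0, h1]
    refine key _ _ ?_
    rw [hK, mul_add, mul_add, ← mul_assoc, ← mul_assoc, ← mul_assoc, ← mul_assoc, neg_mul_neg,
      neg_mul, neg_mul, hc, add_mul]
    abel

/-- The two factors of the Harry Dym operator become the two factors of L_{2m}. The relations
between p = D₁θ₁ and q = D₂θ₁ come from θ₁ being a common potential: D₁D₂ = -D₂D₁ and D₁² = D₂². -/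
theorem newD_products (hK : (K : A) = φ.confFactor) (hU : IsLog U K) :
    (1 / 2 : ℚ) • (φ.newD (↑K⁻¹ : A) 0 * fn ((K : A) ^ 2) * φ.newD (↑K⁻¹ : A) 0
        + φ.newD (↑K⁻¹ : A) 1 * fn ((K : A) ^ 2) * φ.newD (↑K⁻¹ : A) 1) = qop (K : A) ∧
      φ.newD (↑K⁻¹ : A) 0 * φ.newD (↑K⁻¹ : A) 0 = qop (↑K⁻¹ : A) := by
  have hKe : par (K : A) = K := by rw [hK, par_confFactor]
  let p : evenSubring A := ⟨_, par_D_pull_θ φ 0 0⟩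
  let q : evenSubring A := ⟨_, par_D_pull_θ φ 1 0⟩
  let k : evenSubring A := ⟨K, hKe⟩
  let ki : evenSubring A := ⟨(↑K⁻¹ : A), par_inv hKe⟩
  have h0 : D 0 (q : A) = -D 1 (p : A) := D_anticomm _
  have h1 : D 1 (q : A) = D 0 (p : A) := (D_sq _).symm
  have hk : k = p * p + q * q := Subtype.ext (hK.trans (by rw [confFactor, pow_two, pow_two]; rfl))
  have hki : ki * k = 1 := Subtype.ext (Units.inv_mul K)
  have hDi : ∀ i, D i (ki : A) = -((ki * ki) • D i (k : A)) := fun i => by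
    change D i (↑K⁻¹ : A) = -((↑K⁻¹ : A) * ↑K⁻¹ * D i (K : A))
    rw [hU.D_inv hKe, hU.2 i, mul_assoc]
  have n0 : φ.newD (↑K⁻¹ : A) 0 = fn ((ki * p : evenSubring A) : A) * Dop 0
      + fn ((ki * q : evenSubring A) : A) * Dop 1 := by
    rw [newD_zero, mul_add, fn_mul_fn_mul, fn_mul_fn_mul]
    rfl
  have n1 : φ.newD (↑K⁻¹ : A) 1 = fn ((-(ki * q) : evenSubring A) : A) * Dop 0
      + fn ((ki * p : evenSubring A) : A) * Dop 1 := by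
    rw [newD_one, mul_add, fn_mul_fn_mul, fn_mul_fn_mul, mul_neg]
    rfl
  have m0 : fn ((K : A) ^ 2) * φ.newD (↑K⁻¹ : A) 0 = fn ((k * p : evenSubring A) : A) * Dop 0
      + fn ((k * q : evenSubring A) : A) * Dop 1 := by
    rw [newD_zero, fn_mul_fn_mul, pow_two, Units.mul_inv_cancel_right, mul_add, fn_mul_fn_mul,
      fn_mul_fn_mul]
    rfl
  have m1 : fn ((K : A) ^ 2) * φ.newD (↑K⁻¹ : A) 1 = fn ((-(k * q) : evenSubring A) : A) * Dop 0
      + fn ((k * p : evenSubring A) : A) * Dop 1 := by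
    rw [newD_one, fn_mul_fn_mul, pow_two, Units.mul_inv_cancel_right, mul_add, fn_mul_fn_mul,
      fn_mul_fn_mul, mul_neg]
    rfl
  constructor
  · rw [mul_assoc, mul_assoc, m0, m1, n0, n1, confD_sum h0 h1 hk hki, smul_smul]
    norm_num
    rfl
  · rw [n0, confD_sq h0 h1 hk hki hDi]

/-- The Harry Dym operator is transformed into `L_{2m}`. -/
theorem newD_mul_eq_L2m (hK : (K : A) = φ.confFactor) (hU : IsLog U K) :
    (1 / 2 : ℚ) • (φ.newD (↑K⁻¹ : A) 0 * fn ((K : A) ^ 2) * φ.newD (↑K⁻¹ : A) 0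
        + φ.newD (↑K⁻¹ : A) 1 * fn ((K : A) ^ 2) * φ.newD (↑K⁻¹ : A) 1)
      * (φ.newD (↑K⁻¹ : A) 0 * φ.newD (↑K⁻¹ : A) 0) = L2m U := by
  obtain ⟨h1, h2⟩ := newD_products hK hU
  rw [h1, h2, qop_mul_qop_inv hU (by rw [hK, par_confFactor])]

/-- The action is multiplicative on differential operators, so both sides unfold into the same chain
of multiplications and super derivatives, matched one by one by `pull_D`. -/
theorem IsSuperconformal.pull_act_L2 (hφ : φ.IsSuperconformal) (hK : (K : A) = φ.confFactor)
    (hU : IsLog U K) {W : B} (hW : φ.pull W = K) (f : B) :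
    φ.pull (act (L2 W) f) = act (L2m U) (φ.pull f) := by
  have hD := fun i => isDiff_newD φ (↑K⁻¹ : A) i
  have hd := fun i => isDiff_Dop (A := B) i
  have hW2 := isDiff_fn (W ^ 2)
  have hK2 := isDiff_fn ((K : A) ^ 2)
  rw [← newD_mul_eq_L2m hK hU, L2]
  rw [act_mul (((((hd 0).mul hW2).mul (hd 0)).add (((hd 1).mul hW2).mul (hd 1))).smul _) isDiff_pd,
    act_mul (((((hD 0).mul hK2).mul (hD 0)).add (((hD 1).mul hK2).mul (hD 1))).smul _)
      ((hD 0).mul (hD 0)), act_smul, act_smul, act_add, act_add]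
  simp only [act_mul ((hd _).mul hW2) (hd _), act_mul (hd _) hW2,
    act_mul ((hD _).mul hK2) (hD _), act_mul (hD _) hK2, act_mul (hD 0) (hD 0), act_fn, act_Dop,
    act_pd]
  rw [map_rat_smul φ.pull, map_add]
  simp only [hφ.pull_D hK, map_mul, map_pow, hW]

end SuperDiffeo

/-- The factorized form of `L_{2m}`. -/
theorem IsLog.factorization {A : Type u} [SuperFieldAlgebra A] {U : A} {K : Aˣ} (hU : IsLog U K)
    (hK : par (K : A) = K) :
    (fn (K : A) * pd + (1 / 2 : ℚ) • (fn (D 1 (K : A)) * Dop 1)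
        + (1 / 2 : ℚ) • (fn (D 0 (K : A)) * Dop 0))
      * fn (↑K⁻¹ : A)
      * (pd - (1 / 2 : ℚ) • (fn (D 1 U) * Dop 1) - (1 / 2 : ℚ) • (fn (D 0 U) * Dop 0))
      = L2m U := by
  have e1 : fn (K : A) * pd + (1 / 2 : ℚ) • (fn (D 1 (K : A)) * Dop 1)
      + (1 / 2 : ℚ) • (fn (D 0 (K : A)) * Dop 0) = qop (K : A) := by
    rw [qop_eq hK]
    module
  have e2 : (pd - (1 / 2 : ℚ) • (fn (D 1 U) * Dop 1) - (1 / 2 : ℚ) • (fn (D 0 U) * Dop 0) : PDO A)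
      = pd - (1 / 2 : ℚ) • (fn (D 0 U) * Dop 0 + fn (D 1 U) * Dop 1) := by module
  rw [e1, e2, mul_assoc, ← qop_inv hU hK, qop_mul_qop_inv hU hK]

end SuperHD

namespace SuperHD

open SuperFieldAlgebra PDO

/-! ### Normal forms of differential super polynomials

The derivative `E_s ∂^k U` has the index `4 k + s`. -/

namespace NormalForm

/-- The super field `E_s a`, where `E_0 = 1`, `E_1 = D₁`, `E_2 = D₂`, `E_3 = D₁D₂`. -/
def applyE {A : Type u} [SuperFieldAlgebra A] (a : A) : ℕ → A
  | 0 => a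
  | 1 => D 0 a
  | 2 => D 1 a
  | _ => D 0 (D 1 a)

/-- The derivative of `U` with index `v`. -/
def var {A : Type u} [SuperFieldAlgebra A] (U : A) (v : ℕ) : A := applyE (dd^[v / 4] U) (v % 4)

/-- The sign of the derivative with index `v` under the parity. -/
def sgn (v : ℕ) : ℚ := if v % 4 = 1 ∨ v % 4 = 2 then -1 else 1

/-- The value of a monomial. -/
def evalMon {A : Type u} [SuperFieldAlgebra A] (U : A) : List ℕ → A
  | [] => 1
  | v :: m => var U v * evalMon U m

/-- The value of a linear combination of monomials. -/
def eval {A : Type u} [SuperFieldAlgebra A] (U : A) : List (List ℕ × ℚ) → A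
  | [] => 0
  | t :: p => t.2 • evalMon U t.1 + eval U p

/-- The product of a variable and a sorted monomial. -/
def insertVar (v : ℕ) : List ℕ → ℚ × List ℕ
  | [] => (1, [v])
  | w :: m =>
    if v < w then (1, v :: w :: m)
    -- A repeated odd variable gives zero; in the last branch a sign appears when two odd variables
    -- are exchanged.
    else if v = w then (if sgn v = -1 then 0 else 1, v :: w :: m)
    else (if sgn v = -1 ∧ sgn w = -1 then -(insertVar v m).1 else (insertVar v m).1,
      w :: (insertVar v m).2)

/-- The product of two monomials. -/
def mulMon (n : List ℕ) : List ℕ → ℚ × List ℕ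
  | [] => (1, n)
  | v :: m => ((mulMon n m).1 * (insertVar v (mulMon n m).2).1, (insertVar v (mulMon n m).2).2)

/-- Addition of a multiple of a monomial. -/
def addTerm (m : List ℕ) (c : ℚ) : List (List ℕ × ℚ) → List (List ℕ × ℚ)
  | [] => if c = 0 then [] else [(m, c)]
  | t :: p => if m = t.1 then (if c + t.2 = 0 then p else (m, c + t.2) :: p)
    else t :: addTerm m c p

/-- Sum of linear combinations. -/
def add (p : List (List ℕ × ℚ)) : List (List ℕ × ℚ) → List (List ℕ × ℚ)
  | [] => p
  | t :: q => addTerm t.1 t.2 (add p q)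

/-- Multiple of a linear combination. -/
def scale (c : ℚ) : List (List ℕ × ℚ) → List (List ℕ × ℚ)
  | [] => []
  | t :: p => (t.1, c * t.2) :: scale c p

/-- Product of a multiple of a monomial and a linear combination. -/
def mulTerm (m : List ℕ) (c : ℚ) : List (List ℕ × ℚ) → List (List ℕ × ℚ)
  | [] => []
  | t :: q => addTerm (mulMon t.1 m).2 (c * t.2 * (mulMon t.1 m).1) (mulTerm m c q)

/-- Product of linear combinations. -/
def mul (q : List (List ℕ × ℚ)) : List (List ℕ × ℚ) → List (List ℕ × ℚ)
  | [] => []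
  -- The recursion runs over the left factor, so `mul q p` stands for p times q; `mulMon` has the
  -- same reversed order of arguments.
  | t :: p => add (mulTerm t.1 t.2 q) (mul q p)

/-- The super derivative of a variable. -/
def derivVar (i : Fin 2) (v : ℕ) : ℚ × ℕ :=
  -- With v = 4k + s, the super derivative of E_s ∂^k U is brought back to the basis by D₁² = D₂² =
  -- ∂ and D₂D₁ = -D₁D₂, the latter being the source of the signs.
  if i = 0 then
    (1, if v % 4 = 0 then v + 1 else if v % 4 = 1 then v + 3 else if v % 4 = 2 then v + 1
      else v + 3)
  else if v % 4 = 0 then (1, v + 2) else if v % 4 = 1 then (-1, v + 2)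
  else if v % 4 = 2 then (1, v + 2) else (-1, v + 2)

/-- The super derivative of a monomial. -/
def derivMon (i : Fin 2) : List ℕ → List (List ℕ × ℚ)
  | [] => []
  | v :: m => add (mulTerm [(derivVar i v).2] (derivVar i v).1 [(m, 1)])
      (mulTerm [v] (sgn v) (derivMon i m))

/-- The super derivative of a linear combination. -/
def deriv (i : Fin 2) : List (List ℕ × ℚ) → List (List ℕ × ℚ)
  | [] => []
  | t :: p => add (scale t.2 (derivMon i t.1)) (deriv i p)

/-- The sign of a monomial under the parity. -/
def sgnMon : List ℕ → ℚ
  | [] => 1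
  | v :: m => sgn v * sgnMon m

/-- The parity of a linear combination. -/
def parity : List (List ℕ × ℚ) → List (List ℕ × ℚ)
  | [] => []
  | t :: p => (t.1, sgnMon t.1 * t.2) :: parity p

/-- The normal form of a differential polynomial. -/
def ofDiffPoly : DiffPoly → List (List ℕ × ℚ)
  | .U => [([0], 1)]
  | .D i p => deriv i (ofDiffPoly p)
  | .smul r p => scale r (ofDiffPoly p)
  | .add p q => add (ofDiffPoly p) (ofDiffPoly q)
  | .mul p q => mul (ofDiffPoly q) (ofDiffPoly p)

section Soundness

variable {A : Type u} [SuperFieldAlgebra A] {U : A}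

theorem par_var (hU : IsEven U) (v : ℕ) : par (var U v) = sgn v • var U v := by
  have h : par (dd^[v / 4] U) = dd^[v / 4] U := by
    generalize v / 4 = k
    induction k with
    | zero => exact hU
    | succ k ih => rw [Function.iterate_succ_apply', ← dd_par, ih]
  have hv : v % 4 < 4 := Nat.mod_lt _ (by norm_num)
  rw [var, sgn]
  generalize dd^[v / 4] U = a at *
  generalize v % 4 = s at *
  interval_cases s <;> simp [applyE, par_D, h]

theorem var_mul (hU : IsEven U) (v : ℕ) (a : A) :
    var U v * a = if sgn v = -1 then par a * var U v else a * var U v := by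
  have h := par_var hU v
  split_ifs with hs
  · rw [hs, neg_smul, one_smul] at h
    exact odd_mul h a
  · have : sgn v = 1 := by
      rw [sgn] at hs ⊢
      split_ifs at hs ⊢ <;> simp_all
    rw [this, one_smul] at h
    exact even_comm h a

theorem sgn_eq_or (v : ℕ) : sgn v = 1 ∨ sgn v = -1 := by
  rw [sgn]
  split_ifs <;> simp

theorem evalMon_insertVar (hU : IsEven U) (v : ℕ) (m : List ℕ) :
    var U v * evalMon U m = (insertVar v m).1 • evalMon U (insertVar v m).2 := by
  induction m with
  | nil => rw [insertVar, one_smul]; rfl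
  | cons w m ih =>
    rw [insertVar]
    split_ifs with h1 h2 h3 h4
    · rw [one_smul]; rfl
    · subst h2
      have h := par_var hU v
      rw [h3, neg_smul, one_smul] at h
      rw [zero_smul, evalMon, ← mul_assoc, odd_mul_self h, zero_mul]
    · rw [one_smul]; rfl
    · simp only [evalMon]
      rw [← mul_assoc, var_mul hU v, if_pos h4.1, par_var hU w, h4.2, neg_smul, one_smul, neg_mul,
        neg_mul, mul_assoc, ih, mul_smul_comm, neg_smul]
    · simp only [evalMon]
      have e : var U v * var U w = var U w * var U v := by
        rcases sgn_eq_or v with hv | hv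
        · rw [var_mul hU v, if_neg (by rw [hv]; norm_num)]
        · have hw : sgn w = 1 := (sgn_eq_or w).resolve_right fun hw => h4 ⟨hv, hw⟩
          rw [var_mul hU w, if_neg (by rw [hw]; norm_num)]
      rw [← mul_assoc, e, mul_assoc, ih, mul_smul_comm]

theorem evalMon_mulMon (hU : IsEven U) (n m : List ℕ) :
    evalMon U m * evalMon U n = (mulMon n m).1 • evalMon U (mulMon n m).2 := by
  induction m with
  | nil => rw [mulMon, one_smul, evalMon, one_mul]
  | cons v m ih =>
    rw [mulMon, evalMon, mul_assoc, ih, mul_smul_comm, evalMon_insertVar hU, smul_smul]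

theorem eval_addTerm (m : List ℕ) (c : ℚ) (p : List (List ℕ × ℚ)) :
    eval U (addTerm m c p) = c • evalMon U m + eval U p := by
  induction p with
  | nil =>
    rw [addTerm]
    split_ifs with h
    · rw [h, zero_smul, zero_add]
    · rfl
  | cons t p ih =>
    rw [addTerm]
    split_ifs with h h2
    · rw [eval, ← h, ← add_assoc, ← add_smul, h2, zero_smul, zero_add]
    · rw [eval, eval, ← h, ← add_assoc, ← add_smul]
    · rw [eval, eval, ih, add_left_comm]

theorem eval_add (p q : List (List ℕ × ℚ)) : eval U (add p q) = eval U p + eval U q := by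
  induction q with
  | nil => rw [add, eval, add_zero]
  | cons t q ih => rw [add, eval_addTerm, ih, eval, add_left_comm]

theorem eval_scale (c : ℚ) (p : List (List ℕ × ℚ)) : eval U (scale c p) = c • eval U p := by
  induction p with
  | nil => rw [scale, eval, smul_zero]
  | cons t p ih => rw [scale, eval, eval, ih, smul_add, smul_smul]

theorem eval_mulTerm (hU : IsEven U) (m : List ℕ) (c : ℚ) (q : List (List ℕ × ℚ)) :
    eval U (mulTerm m c q) = c • evalMon U m * eval U q := by
  induction q with
  | nil => rw [mulTerm, eval, mul_zero]
  | cons t q ih =>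
    rw [mulTerm, eval_addTerm, ih, eval, mul_add, smul_mul_smul_comm, evalMon_mulMon hU, smul_smul]

theorem eval_mul (hU : IsEven U) (q p : List (List ℕ × ℚ)) :
    eval U (mul q p) = eval U p * eval U q := by
  induction p with
  | nil => rw [mul, eval, zero_mul]
  | cons t p ih => rw [mul, eval_add, eval_mulTerm hU, ih, eval, add_mul]

theorem var_four_mul_add (k : ℕ) {s : ℕ} (hs : s < 4) :
    var U (4 * k + s) = applyE (dd^[k] U) s := by
  rw [var, show (4 * k + s) / 4 = k by omega, show (4 * k + s) % 4 = s by omega]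

theorem D_var (i : Fin 2) (v : ℕ) :
    D i (var U v) = (derivVar i v).1 • var U (derivVar i v).2 := by
  obtain ⟨k, s, hs, rfl⟩ : ∃ k s, s < 4 ∧ v = 4 * k + s :=
    ⟨v / 4, v % 4, Nat.mod_lt _ (by norm_num), (Nat.div_add_mod v 4).symm⟩
  have h0 : D 0 (D 0 (dd^[k] U)) = dd^[k + 1] U := (Function.iterate_succ_apply' dd k U).symm
  have h1 : D 1 (D 1 (dd^[k] U)) = dd^[k + 1] U := by rw [← D_sq, h0]
  have hm : (4 * k + s) % 4 = s := by omega
  rw [var_four_mul_add k hs, derivVar, hm]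
  interval_cases s
  · have e1 := var_four_mul_add (U := U) k (s := 1) (by norm_num)
    have e2 := var_four_mul_add (U := U) k (s := 2) (by norm_num)
    fin_cases i <;> simp [applyE, e1, e2]
  · have e1 := var_four_mul_add (U := U) (k + 1) (s := 0) (by norm_num)
    have e2 := var_four_mul_add (U := U) k (s := 3) (by norm_num)
    rw [show 4 * (k + 1) + 0 = 4 * k + 1 + 3 by ring] at e1
    rw [show 4 * k + 3 = 4 * k + 1 + 2 by ring] at e2
    fin_cases i
    · simp [applyE, e1, h0]
    · simp [applyE, e2, D_anticomm]
  · have e1 := var_four_mul_add (U := U) (k + 1) (s := 0) (by norm_num)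
    have e2 := var_four_mul_add (U := U) k (s := 3) (by norm_num)
    rw [show 4 * (k + 1) + 0 = 4 * k + 2 + 2 by ring] at e1
    rw [show 4 * k + 3 = 4 * k + 2 + 1 by ring] at e2
    fin_cases i
    · simp [applyE, e2]
    · simp [applyE, e1, h1]
  · have e1 := var_four_mul_add (U := U) (k + 1) (s := 1) (by norm_num)
    have e2 := var_four_mul_add (U := U) (k + 1) (s := 2) (by norm_num)
    rw [show 4 * (k + 1) + 1 = 4 * k + 3 + 2 by ring] at e1
    rw [show 4 * (k + 1) + 2 = 4 * k + 3 + 3 by ring] at e2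
    fin_cases i
    · simp [applyE, e2, ← h1, D_anticomm]
      rw [D_sq]
    · simp [applyE, e1, ← h1, D_anticomm]

theorem eval_derivMon (hU : IsEven U) (i : Fin 2) (m : List ℕ) :
    eval U (derivMon i m) = D i (evalMon U m) := by
  induction m with
  | nil => rw [derivMon, eval, evalMon, D_one]
  | cons v m ih =>
    have e : evalMon U (v :: m) = var U v * evalMon U m := rfl
    rw [derivMon, eval_add, eval_mulTerm hU, eval_mulTerm hU, ih, e, D_mul, ← par, par_var hU,
      D_var]
    simp only [evalMon, eval, mul_one, one_smul, add_zero]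

theorem eval_deriv (hU : IsEven U) (i : Fin 2) (p : List (List ℕ × ℚ)) :
    eval U (deriv i p) = D i (eval U p) := by
  induction p with
  | nil => rw [deriv, eval, map_zero]
  | cons t p ih => rw [deriv, eval_add, eval_scale, eval_derivMon hU, ih, eval, map_add, D_smul]

theorem par_evalMon (hU : IsEven U) (m : List ℕ) :
    par (evalMon U m) = sgnMon m • evalMon U m := by
  induction m with
  | nil => rw [evalMon, sgnMon, par_one, one_smul]
  | cons v m ih => rw [evalMon, sgnMon, par_mul, ih, par_var hU, smul_mul_smul_comm]

theorem eval_parity (hU : IsEven U) (p : List (List ℕ × ℚ)) :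
    eval U (parity p) = par (eval U p) := by
  induction p with
  | nil => rw [parity, eval, par_zero]
  | cons t p ih =>
    rw [parity, eval, eval, ih, par_add, par_smul, par_evalMon hU, smul_smul, mul_comm]

theorem eval_ofDiffPoly (hU : IsEven U) (p : DiffPoly) : eval U (ofDiffPoly p) = p.eval U := by
  induction p with
  | U => simp [ofDiffPoly, eval, evalMon, var, applyE, DiffPoly.eval]
  | D i p ih => rw [ofDiffPoly, eval_deriv hU, ih, DiffPoly.eval]
  | smul r p ih => rw [ofDiffPoly, eval_scale, ih, DiffPoly.eval]
  | add p q ihp ihq => rw [ofDiffPoly, eval_add, ihp, ihq, DiffPoly.eval]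
  | mul p q ihp ihq => rw [ofDiffPoly, eval_mul hU, ihp, ihq, DiffPoly.eval]

/-- Only soundness is needed: once the procedure cancels a difference down to the empty list, the
values agree, whether or not normal forms are unique. -/
theorem eval_eq_of_add_scale {p q : List (List ℕ × ℚ)} (h : add p (scale (-1) q) = []) :
    eval U p = eval U q := by
  have e := congrArg (eval U) h
  rwa [eval_add, eval_scale, neg_smul, one_smul, eval, ← sub_eq_add_neg, sub_eq_zero] at e

end Soundness

end NormalForm

end SuperHD

namespace SuperHD

open SuperFieldAlgebra PDO

namespace NormalForm

/-! ### Normal forms of coefficients of operators -/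

/-- The binomial coefficient of an integer. -/
def binom (k : ℤ) (j : ℕ) : ℤ :=
  -- A form of `Ring.choose` suited to evaluation; with n = -k - 1 the upper index -(n + 1) gives
  -- (-1)^j times n + j over j.
  if 0 ≤ k then Nat.choose k.toNat j else (-1) ^ j * Nat.choose ((-k - 1).toNat + j) j

theorem binom_eq (k : ℤ) (j : ℕ) : binom k j = Ring.choose k j := by
  rw [binom]
  split_ifs with h
  · lift k to ℕ using h
    rw [Int.toNat_natCast, Ring.choose_natCast]
  · obtain ⟨n, rfl⟩ : ∃ n : ℕ, k = -(n + 1 : ℤ) := ⟨(-k - 1).toNat, by omega⟩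
    rw [Ring.choose_neg, show (n : ℤ) + 1 + j - 1 = ((n + j : ℕ) : ℤ) by push_cast; ring,
      Ring.choose_natCast, Int.negOnePow_def, show (- -(n + 1 : ℤ) - 1).toNat = n by omega]
    simp [Units.smul_def]

/-- The operator with the given coefficients. -/
noncomputable def evalOp {A : Type u} [SuperFieldAlgebra A] (U : A) :
    List (ℤ × Fin 4 × List (List ℕ × ℚ)) → PDO A
  | [] => 0
  | t :: T => mono (eval U t.2.2) t.1 t.2.1 + evalOp U T

/-- The coefficient of an operator. -/
def coeffOp (k : ℤ) (s : Fin 4) :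
    List (ℤ × Fin 4 × List (List ℕ × ℚ)) → List (List ℕ × ℚ)
  | [] => []
  | t :: T => if k = t.1 ∧ s = t.2.1 then add t.2.2 (coeffOp k s T) else coeffOp k s T

/-- The space derivative, iterated. -/
def derivIter (p : List (List ℕ × ℚ)) : ℕ → List (List ℕ × ℚ)
  | 0 => p
  | j + 1 => deriv 0 (deriv 0 (derivIter p j))

/-- The sum of the first `n` terms of a coefficient of `∂^k ∘ T`. -/
def ddCoeff (T : List (ℤ × Fin 4 × List (List ℕ × ℚ))) (k m : ℤ) (s : Fin 4) :
    ℕ → List (List ℕ × ℚ)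
  | 0 => []
  | j + 1 => add (ddCoeff T k m s j)
      (scale (binom k j) (derivIter (coeffOp (m - k + j) s T) j))

/-- Coefficients of `D₁ ∘ g`. -/
def d1Coeff (g : ℤ → Fin 4 → List (List ℕ × ℚ)) (m : ℤ) (s : Fin 4) : List (List ℕ × ℚ) :=
  add (deriv 0 (g m s)) (parity (![g (m - 1) 1, g m 0, g (m - 1) 3, g m 2] s))

/-- Coefficients of `D₂ ∘ g`. -/
def d2Coeff (g : ℤ → Fin 4 → List (List ℕ × ℚ)) (m : ℤ) (s : Fin 4) : List (List ℕ × ℚ) :=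
  add (deriv 1 (g m s))
    (scale (![1, -1, 1, -1] s) (parity (![g (m - 1) 2, g (m - 1) 3, g m 0, g m 1] s)))

/-- Coefficients of `E_s ∘ g`. -/
def eCoeff (r : Fin 4) (g : ℤ → Fin 4 → List (List ℕ × ℚ)) : ℤ → Fin 4 → List (List ℕ × ℚ) :=
  ![g, d1Coeff g, d2Coeff g, d1Coeff (d2Coeff g)] r

/-- A coefficient of the product of operators, the right factor of order at most `N`. -/
def mulCoeffOp (N : ℤ) (S : List (ℤ × Fin 4 × List (List ℕ × ℚ))) (m : ℤ) (s : Fin 4) :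
    List (ℤ × Fin 4 × List (List ℕ × ℚ)) → List (List ℕ × ℚ)
  | [] => []
  | t :: T => add (mul (eCoeff t.2.1
      -- With k = `t.1`, the j-th term involves the coefficient of index m' - k + j, which vanishes
      -- once this exceeds N; this leaves N + 1 - (m' - k) terms.
      (fun m' s' => ddCoeff S t.1 m' s' (N + 1 - (m' - t.1)).toNat) m s) t.2.2)
      (mulCoeffOp N S m s T)

section Soundness

variable {A : Type u} [SuperFieldAlgebra A] {U : A}

theorem evalOp_coeff (T : List (ℤ × Fin 4 × List (List ℕ × ℚ))) (k : ℤ) (s : Fin 4) :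
    (evalOp U T).coeff k s = eval U (coeffOp k s T) := by
  induction T with
  | nil => rfl
  | cons t T ih =>
    rw [evalOp, add_coeff, ih, mono_coeff, coeffOp]
    split_ifs
    · rw [eval_add]
    · rw [zero_add]

theorem evalOp_mem_filt {T : List (ℤ × Fin 4 × List (List ℕ × ℚ))} {d : ℤ}
    (h : ∀ t ∈ T, 2 * t.1 + wt t.2.1 ≤ d) : evalOp U T ∈ filt d := by
  induction T with
  | nil => exact zero_mem _
  | cons t T ih =>
    rw [evalOp]
    exact add_mem (mono_mem_filt _ (h t (by simp))) (ih fun t' ht => h t' (by simp [ht]))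

theorem evalOp_coeff_eq_zero {T : List (ℤ × Fin 4 × List (List ℕ × ℚ))} {N : ℤ}
    (h : ∀ t ∈ T, t.1 ≤ N) {k : ℤ} (hk : N < k) (s : Fin 4) : (evalOp U T).coeff k s = 0 := by
  induction T with
  | nil => rfl
  | cons t T ih =>
    have := h t (by simp)
    rw [evalOp, add_coeff, ih fun t' ht => h t' (by simp [ht]), mono_coeff, if_neg (by omega),
      add_zero]

theorem eval_derivIter (hU : IsEven U) (p : List (List ℕ × ℚ)) (j : ℕ) :
    eval U (derivIter p j) = dd^[j] (eval U p) := by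
  induction j with
  | zero => rfl
  | succ j ih =>
    rw [derivIter, eval_deriv hU, eval_deriv hU, ih, Function.iterate_succ_apply']
    rfl

theorem eval_ddCoeff (hU : IsEven U) (T : List (ℤ × Fin 4 × List (List ℕ × ℚ))) (k m : ℤ)
    (s : Fin 4) (n : ℕ) : eval U (ddCoeff T k m s n) =
      ∑ j ∈ Finset.range n,
        (Ring.choose k j : ℤ) • dd^[j] ((evalOp U T).coeff (m - k + j) s) := by
  induction n with
  | zero => rfl
  | succ n ih =>
    rw [ddCoeff, eval_add, ih, Finset.sum_range_succ, eval_scale, eval_derivIter hU, binom_eq,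
      evalOp_coeff, Int.cast_smul_eq_zsmul]

theorem eval_ddCoeff_eq (hU : IsEven U) {T : List (ℤ × Fin 4 × List (List ℕ × ℚ))} {N : ℤ}
    (h : ∀ t ∈ T, t.1 ≤ N) (k m : ℤ) (s : Fin 4) :
    eval U (ddCoeff T k m s (N + 1 - (m - k)).toNat) = (ddL k (evalOp U T)).coeff m s := by
  rw [eval_ddCoeff hU, ddL_coeff_eq_sum k _ m s (N + 1 - (m - k)).toNat fun j hj =>
    evalOp_coeff_eq_zero h (by omega) s]

theorem eval_d1Coeff (hU : IsEven U) {g : ℤ → Fin 4 → List (List ℕ × ℚ)} {P : PDO A}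
    (h : ∀ m s, eval U (g m s) = P.coeff m s) (m : ℤ) (s : Fin 4) :
    eval U (d1Coeff g m s) = (d1L P).coeff m s := by
  rw [d1Coeff, eval_add, eval_parity hU, eval_deriv hU, h]
  revert s
  refine forall_fin_four ?_ ?_ ?_ ?_ <;> simp only [Matrix.cons_val, h] <;> rfl

theorem eval_d2Coeff (hU : IsEven U) {g : ℤ → Fin 4 → List (List ℕ × ℚ)} {P : PDO A}
    (h : ∀ m s, eval U (g m s) = P.coeff m s) (m : ℤ) (s : Fin 4) :
    eval U (d2Coeff g m s) = (d2L P).coeff m s := by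
  rw [d2Coeff, eval_add, eval_scale, eval_parity hU, eval_deriv hU, h]
  revert s
  refine forall_fin_four ?_ ?_ ?_ ?_ <;>
    simp only [Matrix.cons_val, h, d2L_coeff_zero, d2L_coeff_one, d2L_coeff_two, d2L_coeff_three,
      one_smul, neg_smul, sub_eq_add_neg]

theorem eval_eCoeff (hU : IsEven U) {g : ℤ → Fin 4 → List (List ℕ × ℚ)} {P : PDO A}
    (h : ∀ m s, eval U (g m s) = P.coeff m s) (r : Fin 4) (m : ℤ) (s : Fin 4) :
    eval U (eCoeff r g m s) = (eL r P).coeff m s := by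
  revert r
  exact forall_fin_four (h m s) (eval_d1Coeff hU h m s) (eval_d2Coeff hU h m s)
    (eval_d1Coeff hU (eval_d2Coeff hU h) m s)

theorem eval_mulCoeffOp (hU : IsEven U) {T S : List (ℤ × Fin 4 × List (List ℕ × ℚ))} {N : ℤ}
    (h : ∀ t ∈ S, t.1 ≤ N) (m : ℤ) (s : Fin 4) :
    eval U (mulCoeffOp N S m s T) = (evalOp U T * evalOp U S).coeff m s := by
  induction T with
  | nil => rw [evalOp, zero_mul]; rfl
  | cons t T ih =>
    rw [mulCoeffOp, eval_add, ih, evalOp, add_mul, add_coeff, eval_mul hU, mono_mul, fnL_coeff,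
      eval_eCoeff hU (eval_ddCoeff_eq hU h t.1)]

end Soundness

/-- The coefficients of `L_{2m}`. -/
def coeffsL2m : List (ℤ × Fin 4 × List (List ℕ × ℚ)) :=
  -- The indices 1, …, 6 stand for D₁U, D₂U, D₁D₂U, U_y, D₁U_y, D₂U_y. Monomials are sorted, so
  -- -½(D₂U)(D₁U) appears as +½ times [1, 2].
  [(2, 0, [([], 1)]), (1, 0, [([4], -1)]), (0, 3, [([1, 2], 1 / 2)]),
    (0, 2, [([6], -1 / 2), ([2, 4], 1 / 4), ([1, 3], -1 / 4)]),
    (0, 1, [([5], -1 / 2), ([1, 4], 1 / 4), ([2, 3], 1 / 4)])]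

/-- The coefficients of the first terms of `L_{2m}^{1/2}`. -/
def coeffsSqrt : List (ℤ × Fin 4 × List (List ℕ × ℚ)) :=
  -- The terms of degree at least -4, determined successively by R² = L_{2m}. As L_{2m} has degree
  -- 4, this is exactly the accuracy required for the zeroth order coefficient of R L_{2m} = R³.
  [(1, 0, [([], 1)]), (0, 0, [([4], -1 / 2)]), (-1, 3, [([1, 2], 1 / 4)]),
    (-1, 2, [([6], -1 / 4), ([2, 4], 1 / 8), ([1, 3], -1 / 8)]),
    (-1, 1, [([5], -1 / 4), ([1, 4], 1 / 8), ([2, 3], 1 / 8)]),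
    (-1, 0, [([8], 1 / 4), ([4, 4], -1 / 8)]),
    (-2, 3, [([2, 5], 1 / 8), ([1, 6], -1 / 8), ([1, 2, 4], 1 / 8)]),
    (-2, 2, [([10], 1 / 8), ([3, 5], 1 / 16), ([2, 8], -1 / 16), ([4, 6], -3 / 16),
      ([1, 7], 1 / 16), ([2, 4, 4], 1 / 16), ([1, 3, 4], -1 / 16), ([1, 2, 5], 1 / 16)]),
    (-2, 1, [([9], 1 / 8), ([4, 5], -3 / 16), ([1, 8], -1 / 16), ([3, 6], -1 / 16),
      ([2, 7], -1 / 16), ([1, 4, 4], 1 / 16), ([2, 3, 4], 1 / 16), ([1, 2, 6], -1 / 16)]),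
    (-2, 0, [([12], -1 / 8), ([4, 8], 1 / 4), ([4, 4, 4], -1 / 16), ([1, 4, 5], 1 / 32),
      ([2, 3, 5], 1 / 32), ([2, 4, 6], 1 / 32), ([1, 3, 6], -1 / 32)]),
    (-3, 3, [([5, 6], 3 / 16), ([2, 9], -1 / 16), ([1, 10], 1 / 16), ([2, 4, 5], 1 / 8),
      ([1, 4, 6], -1 / 8), ([1, 2, 8], -1 / 8), ([1, 2, 4, 4], 5 / 64),
      ([1, 2, 3, 3], -1 / 64)])]

/-- The right-hand side of the first nontrivial flow. -/
def mkdvPoly : DiffPoly :=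
  .smul (1 / 16)
    (.add (.add (.add (.add (.add (.smul 4 (.D 0 (.D 0 (.D 0 (.D 0 (.D 0 (.D 0 .U)))))))
      (.smul (-2) (.mul (.mul (.D 0 (.D 0 .U)) (.D 0 (.D 0 .U))) (.D 0 (.D 0 .U)))))
      (.smul (-3) (.mul (.mul (.D 1 (.D 0 (.D 0 .U))) (.D 1 .U)) (.D 0 (.D 0 .U)))))
      (.smul 3 (.mul (.mul (.D 1 (.D 0 (.D 0 .U))) (.D 0 .U)) (.D 0 (.D 1 .U)))))
      (.smul 3 (.mul (.mul (.D 1 .U) (.D 0 (.D 0 (.D 0 .U)))) (.D 0 (.D 1 .U)))))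
      (.smul (-3) (.mul (.mul (.D 0 (.D 0 (.D 0 .U))) (.D 0 .U)) (.D 0 (.D 0 .U)))))

/-- The finite part of the verification that the truncated root squares to L_{2m} up to degree -3;
coefficients with larger m vanish for degree reasons. -/
theorem sqrt_mul_self_coeff : ∀ m ∈ [2, 1, 0, -1, -2], ∀ s : Fin 4, -3 < 2 * m + wt s →
    add (mulCoeffOp 1 coeffsSqrt m s coeffsSqrt) (scale (-1) (coeffOp m s coeffsL2m)) = [] := by
  decide +kernel

theorem sqrt_mul_L2m_coeff :
    add (scale (-2) (mulCoeffOp 2 coeffsL2m 0 0 coeffsSqrt)) (scale (-1) (ofDiffPoly mkdvPoly))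
      = [] := by
  decide +kernel

end NormalForm

end SuperHD

namespace SuperHD

open SuperFieldAlgebra PDO

/-! ### The first flows -/

section FirstFlows

open NormalForm

variable {A : Type u} [SuperFieldAlgebra A] {U : A}

theorem mkdvPoly_eval (U : A) : mkdvPoly.eval U = mkdvRHS U := by
  simp only [mkdvPoly, DiffPoly.eval, mkdvRHS, dd, pow_three, neg_smul, sub_eq_add_neg, mul_assoc]

theorem evalOp_coeffsL2m (hU : IsEven U) : evalOp U coeffsL2m = L2m U := by
  have h : D 1 U * D 0 U = -(D 0 U * D 1 U) := odd_mul_odd _ _ (hU.par_D 1) (hU.par_D 0)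
  simp only [coeffsL2m, evalOp, L2m, h, eval, evalMon, var, applyE, Function.iterate_zero, id,
    Function.iterate_one, Nat.reduceDiv, Nat.reduceMod, mul_one, add_zero, one_smul]
  simp only [mono_add, mono_sub, mono_neg, mono_smul, sub_eq_add_neg]
  module

theorem evalOp_coeffsSqrt_sub_pd_mem_filt : evalOp U coeffsSqrt - pd ∈ filt 1 := by
  have e : evalOp U coeffsSqrt = pd + evalOp U coeffsSqrt.tail := by
    rw [coeffsSqrt, evalOp]
    simp [eval, evalMon, pd]
  rw [e, add_sub_cancel_left]
  exact evalOp_mem_filt (by decide +kernel)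

theorem evalOp_coeffsSqrt_mul_self (hU : IsEven U) :
    evalOp U coeffsSqrt * evalOp U coeffsSqrt - L2m U ∈ filt (-3) := by
  intro k s hk
  rw [← evalOp_coeffsL2m hU]
  by_cases h : k ≤ 2
  · have hw : wt s ≤ 2 := by fin_cases s <;> simp [wt]
    have hm : k ∈ [2, 1, 0, -1, -2] := by
      have : -2 ≤ k := by omega
      interval_cases k <;> simp
    rw [sub_coeff, sub_eq_zero, evalOp_coeff coeffsL2m,
      ← eval_mulCoeffOp hU (T := coeffsSqrt) (S := coeffsSqrt) (N := 1) (by decide +kernel)]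
    exact eval_eq_of_add_scale (sqrt_mul_self_coeff k hm s hk)
  -- Beyond ∂² neither the square nor L_{2m} has any terms, both being of degree at most 4.
  · have hw : 0 ≤ wt s := by fin_cases s <;> simp [wt]
    have hR : evalOp U coeffsSqrt ∈ filt 2 := evalOp_mem_filt (by decide +kernel)
    have hL : evalOp U coeffsL2m ∈ filt (2 + 2) := evalOp_mem_filt (by decide +kernel)
    exact sub_mem (mul_mem_filt hR hR) hL k s (by omega)

/-- The difference of true and truncated root solves RT + TR' = L_{2m} - R'², whose right side has
degree at most -3, and two degrees are gained. -/
theorem IsSqrt.sub_evalOp_mem_filt (hU : IsEven U) {R : PDO A} (hR : IsSqrt R (L2m U)) :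
    R - evalOp U coeffsSqrt ∈ filt (-5) := by
  refine mem_filt_of_mul_add_mul (e := -3) (hR.sub_pd_mem_filt (L2m_coeff_one_three U))
    (evalOp_coeffsSqrt_sub_pd_mem_filt (U := U)) ?_
  have e : R * (R - evalOp U coeffsSqrt) + (R - evalOp U coeffsSqrt) * evalOp U coeffsSqrt =
      -(evalOp U coeffsSqrt * evalOp U coeffsSqrt - R * R) := by noncomm_ring
  rw [e, hR.1]
  exact neg_mem (evalOp_coeffsSqrt_mul_self hU)

theorem flow_one (hU : IsEven U) {R : PDO A} (hR : IsSqrt R (L2m U)) : flow R 1 = dd U := by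
  have h := IsSqrt.sub_evalOp_mem_filt hU hR 0 0 (by decide)
  rw [sub_coeff, sub_eq_zero, evalOp_coeff,
    show coeffOp 0 0 coeffsSqrt = [([4], -1 / 2)] by decide +kernel] at h
  rw [flow, pow_one, h]
  simp only [eval, evalMon, var, applyE, Nat.reduceDiv, Nat.reduceMod, Function.iterate_one, mul_one,
    add_zero, smul_smul]
  norm_num

theorem flow_three (hU : IsEven U) {R : PDO A} (hR : IsSqrt R (L2m U)) :
    flow R 3 = mkdvRHS U := by
  -- The truncation error times L_{2m} has degree at most -5 + 4 = -1, so the zeroth order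
  -- coefficient of R³ = R L_{2m} is exact.
  have h := mul_mem_filt (IsSqrt.sub_evalOp_mem_filt hU hR) (q := 4)
    (by rw [← evalOp_coeffsL2m hU]; exact evalOp_mem_filt (by decide +kernel) : L2m U ∈ filt 4)
    0 0 (by decide)
  rw [sub_mul, sub_coeff, sub_eq_zero] at h
  have e : R ^ 3 = R * L2m U := by rw [← hR.1, pow_three]
  rw [flow, e, h, ← evalOp_coeffsL2m hU, ← eval_mulCoeffOp hU (N := 2) (by decide +kernel),
    ← eval_scale, eval_eq_of_add_scale sqrt_mul_L2m_coeff, eval_ofDiffPoly hU, mkdvPoly_eval]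

end FirstFlows

/-! ### The Miura map -/

section Miura

open NormalForm

variable {A : Type u} [SuperFieldAlgebra A] {U : A}

/-- The chain rule: a time derivative commutes with D₁ and D₂, so its action on differential
polynomials is determined by its value on U. -/
theorem TimeDerivation.d_eval (δ : TimeDerivation A) {V : DiffPoly} (h : δ.d U = V.eval U)
    (p : DiffPoly) : δ.d (p.eval U) = (V.lin p).eval U := by
  induction p with
  | U => exact h
  | D i p ih => rw [DiffPoly.eval, δ.d_D, ih]; rfl
  | smul r p ih => rw [DiffPoly.eval, map_rat_smul δ.d, ih]; rfl
  | add p q ihp ihq => rw [DiffPoly.eval, map_add, ihp, ihq]; rfl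
  | mul p q ihp ihq => rw [DiffPoly.eval, δ.d_mul, ihp, ihq]; rfl

/-- The Miura map. -/
def miuraPoly : DiffPoly :=
  .add (.smul (1 / 2) (.D 0 (.D 1 .U))) (.smul (1 / 4) (.mul (.D 1 .U) (.D 0 .U)))

/-- The right-hand side of the super KdV equation with `a = -2`. -/
def skdvPoly (p : DiffPoly) : DiffPoly :=
  .smul (1 / 4) (.add (.add (.add (.D 0 (.D 0 (.D 0 (.D 0 (.D 0 (.D 0 p))))))
    (.smul (-3) (.D 0 (.D 0 (.mul p (.D 0 (.D 1 p)))))))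
    -- For a = -2 the coefficients -(a - 1)/2 and -3a are 3/2 and 6.
    (.smul (3 / 2) (.D 0 (.D 0 (.D 0 (.D 1 (.mul p p)))))))
    (.smul 6 (.mul (.mul p p) (.D 0 (.D 0 p)))))

theorem skdvPoly_eval (p : DiffPoly) (U : A) :
    (skdvPoly p).eval U = skdvRHS (-2) (p.eval U) := by
  simp only [skdvPoly, DiffPoly.eval, skdvRHS, dd, pow_two]
  module

/-- The Miura property is a single identity of differential polynomials: the derivative of the Miura
map along the modified flow equals the super KdV expression of the Miura map. -/
theorem lin_miuraPoly : add (ofDiffPoly (mkdvPoly.lin miuraPoly))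
    (scale (-1) (ofDiffPoly (skdvPoly miuraPoly))) = [] := by
  decide +kernel

/-- The Miura map sends solutions to solutions. -/
theorem d_miura (hU : IsEven U) {δ : TimeDerivation A} (h : δ.d U = mkdvRHS U) :
    δ.d (miura U) = skdvRHS (-2) (miura U) := by
  rw [← mkdvPoly_eval] at h
  change δ.d (miuraPoly.eval U) = skdvRHS (-2) (miuraPoly.eval U)
  rw [δ.d_eval h, ← skdvPoly_eval, ← eval_ofDiffPoly hU, ← eval_ofDiffPoly hU,
    eval_eq_of_add_scale lin_miuraPoly]

end Miura

end SuperHD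

open SuperHD SuperHD.PDO SuperFieldAlgebra in
theorem proposition2 :
    -- the operator `L_{2m}` is the image of the Harry Dym operator when `W = K` and `U = log K`
    (∀ (A : Type u) (B : Type v) [SuperFieldAlgebra A] [SuperFieldAlgebra B]
      (c : Coordinates B) (φ : SuperDiffeo A c), φ.IsSuperconformal →
      ∀ K : Aˣ, (K : A) = φ.confFactor →
      ∀ W : B, φ.pull W = (K : A) →
      ∀ U : A, IsLog U K →
        (∀ f : B, φ.pull (act (L2 W) f) = act (L2m U) (φ.pull f)) ∧
        (∀ (i : Fin 2) (f : B), φ.pull (D i f) = act (φ.newD (↑K⁻¹ : A) i) (φ.pull f)) ∧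
        (1 / 2 : ℚ) • (φ.newD (↑K⁻¹ : A) 0 * fn ((K : A) ^ 2) * φ.newD (↑K⁻¹ : A) 0
            + φ.newD (↑K⁻¹ : A) 1 * fn ((K : A) ^ 2) * φ.newD (↑K⁻¹ : A) 1)
          * (φ.newD (↑K⁻¹ : A) 0 * φ.newD (↑K⁻¹ : A) 0) = L2m U ∧
        (fn (K : A) * pd + (1 / 2 : ℚ) • (fn (D 1 (K : A)) * Dop 1)
            + (1 / 2 : ℚ) • (fn (D 0 (K : A)) * Dop 0))
          * fn (↑K⁻¹ : A)
          * (pd - (1 / 2 : ℚ) • (fn (D 1 U) * Dop 1) - (1 / 2 : ℚ) • (fn (D 0 U) * Dop 0))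
          = L2m U) ∧
    -- the square root `L_{2m}^{1/2} = ∂ + ⋯` exists and is unique
    (∀ (A : Type u) [SuperFieldAlgebra A] (U : A), IsEven U → ∃! R : PDO A, IsSqrt R (L2m U)) ∧
    -- the Lax equations define a hierarchy of commuting flows `U_{τ_n} = F n [U]`, `n` odd
    (∃ F : ℕ → DiffPoly,
      (∀ n, Odd n → ∀ (A : Type u) [SuperFieldAlgebra A] (U : A), IsEven U →
        IsEven ((F n).eval U) ∧
        ∀ R : PDO A, IsSqrt R (L2m U) → ∀ δ : TimeDerivation A,
          (δ.d U = (F n).eval U → LaxEquation n δ U R) ∧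
          (LaxEquation n δ U R → dd (δ.d U) = dd ((F n).eval U))) ∧
      (∀ m n, Odd m → Odd n → ∀ (A : Type u) [SuperFieldAlgebra A] (U : A), IsEven U →
        ((F m).lin (F n)).eval U = ((F n).lin (F m)).eval U) ∧
      -- the first flow is the translation, the first nontrivial one is the modified equation
      (∀ (A : Type u) [SuperFieldAlgebra A] (U : A), IsEven U →
        (F 1).eval U = dd U ∧ (F 3).eval U = mkdvRHS U)) ∧
    -- the Miura map sends solutions to solutions of the SKdV equation with `a = -2`
    (∀ (A : Type u) [SuperFieldAlgebra A] (U : A), IsEven U → ∀ δ : TimeDerivation A,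
      δ.d U = mkdvRHS U → δ.d (miura U) = skdvRHS (-2) (miura U)) := by
  refine ⟨?_, fun A _ U _ => existsUnique_isSqrt U, ?_, fun A _ U hU δ h => d_miura hU h⟩
  · intro A B _ _ c φ hφ K hK W hW U hU
    exact ⟨hφ.pull_act_L2 hK hU hW, hφ.pull_D hK, SuperDiffeo.newD_mul_eq_L2m hK hU,
      hU.factorization (by rw [hK, SuperDiffeo.par_confFactor])⟩
  · have hex : ∀ n, ∃ F : DiffPoly, Odd n → ∀ (A : Type u) [SuperFieldAlgebra A] (U : A),
        IsEven U → ∀ R : PDO A, IsSqrt R (L2m U) → F.eval U = flow R n := fun n => by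
      by_cases hn : Odd n
      · obtain ⟨F, hF⟩ := exists_diffPoly_eval_eq_flow hn
        exact ⟨F, fun _ => hF⟩
      -- For even n nothing is claimed and the polynomial is a default value.
      · exact ⟨.U, fun h => absurd h hn⟩
    choose F hF using hex
    refine ⟨F, fun n hn A _ U hU => ⟨?_, fun R hR δ => ⟨fun h => ?_, fun h => ?_⟩⟩,
      fun m n hm hn A _ U hU => lin_eval_symm hF hm hn hU, fun A _ U hU => ?_⟩
    · obtain ⟨R, hR, -⟩ := existsUnique_isSqrt U
      rw [hF n hn A U hU R hR]
      exact par_flow hU hR n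
    · rw [laxEquation_iff hU hR hn, h, hF n hn A U hU R hR]
    · rw [hF n hn A U hU R hR, h.dd_eq hU hR hn]
    · obtain ⟨R, hR, -⟩ := existsUnique_isSqrt U
      rw [hF 1 odd_one A U hU R hR, hF 3 (by decide) A U hU R hR]
      exact ⟨flow_one hU hR, flow_three hU hR⟩
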